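/- **Theorem (Permutability for the $j$-th central affine curve flow).** *Setting.* Let $n\ge 2$, let $j\ge 1$ with $n\nmid j$, and let $U\subseteq\mathbb R^2$ be open (for instance $U=\mathbb R^2$), with coordinates $(x,t)$. All functions are real and $C^\infty$ on $U$. Let $e_{ik}$ be the elementary $n\times n$ matrices, $e_1=(1,0,\dots,0)^t$, $b=\sum_{i=1}^{n-1}e_{i+1,i}$, $J=e_{1n}\lambda+b$, and $V_n=\bigoplus_{i=1}^{n-1}\mathbb R e_{in}$. *The flow.* For $u=\sum_{i=1}^{n-1}u_ie_{in}$ let $Y(u,\lambda)=\sum_{i\le 1}Y_i\lambda^i$ be the unique formal series with coefficients in $sl(n,\mathbb R)$, $Y_1=e_{1n}$, $[\partial_x+J+u,Y]=0$ and $Y^n=\lambda I$. Let $Y_{j,0}(u)$ be the coefficient of $\lambda^0$ in $Y(u,\lambda)^j$, let $\zeta_j(u)$ be the unique strictly upper triangular matrix function with $[\partial_x+b+u,\,Y_{j,0}(u)-\zeta_j(u)]\in V_n$, and put $Z_{j,0}(u)=Y_{j,0}(u)-\zeta_j(u)$. A map $\gamma:U\to\mathbb R^n$ is a solution of the $j$-th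 central affine curve flow if $\det g=1$ and $\gamma_t=gZ_{j,0}(u)e_1$ on $U$, where $g=(\gamma,\gamma_x,\dots,\gamma_x^{(n-1)})$ is the central affine moving frame and $u=\sum_{i=1}^{n-1} u_ie_{in}$ the central affine curvature, $u_i=\det(\gamma,\dots,\gamma_x^{(i-2)},\gamma_x^{(n)},\gamma_x^{(i)},\dots,\gamma_x^{(n-1)})$ (the $i$-th column of $g$ is replaced by $\gamma_x^{(n)}$). *Bäcklund transformations.* For $u$ as above and a function $h$, let $h\ast u=\sum_{i=1}^{n-1}\tilde u_ie_{in}$, where the $\tilde u_i$ are the differential polynomials in $u,h$ obtained by comparing the coefficients of $\partial_x,\dots,\partial_x^{n-1}$ in $$\Big(\partial_x^n-\sum_{i=1}^{n-1} u_i\partial_x^{i-1}\Big)(\partial_x+h)=(\partial_x+h)\Big(\partial_x^n-\sum_{i=1}^{n-1}\tilde u_i\partial_x^{i-1}\Big).$$ Let $f_{u,h}(x,t,\lambda)=J+hI+N$, where $N$ is strictly upper triangular with $N_{ik}=\binom{k-1}{i-1}h_x^{(k-i)}$ for $i<k<n$ and $N_{in}=\tilde u_i+\binom{n-1}{i-1}h_x^{(n-i)}$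 for $i<n$. For a constant $k$, $h$ is a solution of $(\mathrm{BT})_{u,k}$ if $\det f_{u,h}(x,t,\lambda)=(-1)^{n-1}(\lambda-k)$ and $h_t$ equals the $(1,1)$ entry of $f_{u,h}(x,t,0)\,Z_{j,0}(u)-Z_{j,0}(h\ast u)\,f_{u,h}(x,t,0)$. *Data.* Let $\gamma$ be a solution of the $j$-th central affine curve flow on $U$ with moving frame $g$ and curvature $u$. Let $k_1,k_2\in\mathbb R\setminus\{0\}$, and let $d(k_1),d(k_2)\in GL(n,\mathbb R)$ be constant matrices with $\det d(k_i)=(-1)^nk_i$. For $i=1,2$ let $h_i$ be a solution of $(\mathrm{BT})_{u,k_i}$, with $h_1\ne h_2$ at every point of $U$. Put $$g_i=d(k_i)\,g\,f_{u,h_i}(\cdot,\cdot,0)^{-1},\qquad \gamma_i=g_ie_1,\qquad \tilde h_i=h_i+\frac{(h_1-h_2)_x}{h_1-h_2}\qquad(i=1,2),$$ $$\gamma_{12}=d(k_2)\,g_1\,f_{h_1\ast u,\tilde h_2}(\cdot,\cdot,0)^{-1}e_1,\qquad \gamma_{21}=d(k_1)\,g_2\,f_{h_2\ast u,\tilde h_1}(\cdot,\cdot,0)^{-1}e_1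 .$$ *Claim.* On $U$: 1. $\gamma_{12}=\tilde h_2\ast\gamma_1$ and $\gamma_{21}=\tilde h_1\ast\gamma_2$, where for a curve $\beta$ with moving frame $g_\beta$ and curvature $u_\beta$ one writes $h\ast\beta=d\,g_\beta f_{u_\beta,h}(\cdot,\cdot,0)^{-1}e_1$, with $d=d(k_2)$ in the first formula and $d=d(k_1)$ in the second; 2. if $d(k_1)$ and $d(k_2)$ commute (for instance, if both are diagonal), then $\gamma_{12}=\gamma_{21}$; 3. $\gamma_{12}$ and $\gamma_{21}$ are again solutions of the $j$-th central affine curve flow on $U$. -/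

import Mathlib

open scoped ContDiff Matrix

noncomputable section

namespace CentralAffine

/-! Conventions. Functions of `(x, t)` are curried, `x` first, and are considered on an open set
`U ⊆ ℝ × ℝ`. Indices start at `0`: an element `∑ u_i e_{i n}` (`1 ≤ i ≤ n - 1`) of `V_n` is given
by the family `u : ℕ → ℝ`, where `u i` is the coefficient of `e_{i+1, n}`; only the values
`u 0, …, u (n - 2)` are ever used. -/

/-- `b = ∑ e_{i+1, i}`. -/
def bMat (n : ℕ) (R : Type*) [Zero R] [One R] : Matrix (Fin n) (Fin n) R :=
  Matrix.of fun a c => if (a : ℕ) = (c : ℕ) + 1 then 1 else 0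

/-- `e_{1 n}`. -/
def cornerMat (n : ℕ) (R : Type*) [Zero R] [One R] : Matrix (Fin n) (Fin n) R :=
  Matrix.of fun a c => if (a : ℕ) = 0 ∧ (c : ℕ) + 1 = n then 1 else 0

/-- The element `∑ u_i e_{i n}` of `V_n`. -/
def uMat (n : ℕ) (u : ℕ → ℝ) : Matrix (Fin n) (Fin n) ℝ :=
  Matrix.of fun a c => if (c : ℕ) + 1 = n ∧ (a : ℕ) + 1 < n then u a else 0

/-- The vector `e_1 = (1, 0, …, 0)ᵗ`. -/
def e1 (n : ℕ) : Fin n → ℝ := fun a => if (a : ℕ) = 0 then 1 else 0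

/-- A real matrix lies in `V_n`. -/
def MemV (n : ℕ) (M : Matrix (Fin n) (Fin n) ℝ) : Prop :=
  ∀ a c : Fin n, ¬ ((c : ℕ) + 1 = n ∧ (a : ℕ) + 1 < n) → M a c = 0

/-! ### The Drinfeld–Sokolov coefficients `Z_{j,0}(u)`

A formal series `∑_{i ≤ n₀} ξ_i λ^i` is a Laurent series in the variable `λ⁻¹`, so the coefficient
of `λ^i` is the Laurent coefficient with index `-i`. -/

/-- The spectral parameter `λ`. -/
def lam : LaurentSeries ℝ := HahnSeries.single (-1 : ℤ) (1 : ℝ)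

/-- The matrix coefficient of `λ^i` in a matrix of Laurent series in `λ⁻¹`. -/
def lamCoeff {n : ℕ} (i : ℤ) (M : Matrix (Fin n) (Fin n) (LaurentSeries ℝ)) :
    Matrix (Fin n) (Fin n) ℝ :=
  Matrix.of fun a c => HahnSeries.coeff (M a c) (-i)

/-- `J + u = e_{1n} λ + b + u`. -/
def laxMat (n : ℕ) (u : ℕ → ℝ) : Matrix (Fin n) (Fin n) (LaurentSeries ℝ) :=
  lam • cornerMat n (LaurentSeries ℝ) + bMat n (LaurentSeries ℝ) +
    (uMat n u).map (fun r => (HahnSeries.C r : LaurentSeries ℝ))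

/-- `Y` is the solution `Y(u, λ)` of `[∂_x + J + u, Y] = 0`, `Y^n = λ I` in formal series
`∑_{i ≤ 1} Y_i λ^i` with trace-free smooth coefficients. These equations determine `Y` up to an
`n`-th root of unity, which is fixed by the leading coefficient `Y_1 = e_{1n}` (so `Y = J` for
`u = 0`). -/
structure IsY (n : ℕ) (U : Set (ℝ × ℝ)) (u : ℕ → ℝ → ℝ → ℝ)
    (Y : ℝ → ℝ → Matrix (Fin n) (Fin n) (LaurentSeries ℝ)) : Prop where
  smooth : ∀ (i : ℤ) (a c : Fin n),
    ContDiffOn ℝ ∞ (fun p : ℝ × ℝ => lamCoeff i (Y p.1 p.2) a c) U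
  trace_zero : ∀ x t, (x, t) ∈ U → (Y x t).trace = 0
  degree_le : ∀ x t, (x, t) ∈ U → ∀ i : ℤ, 1 < i → lamCoeff i (Y x t) = 0
  leading : ∀ x t, (x, t) ∈ U → lamCoeff 1 (Y x t) = cornerMat n ℝ
  commute : ∀ x t, (x, t) ∈ U → ∀ (i : ℤ) (a c : Fin n),
    deriv (fun y => lamCoeff i (Y y t) a c) x
      + lamCoeff i (laxMat n (fun m => u m x t) * Y x t
          - Y x t * laxMat n (fun m => u m x t)) a c = 0
  pow_eq : ∀ x t, (x, t) ∈ U → (Y x t) ^ n = lam • 1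

/-- `Z = Z_{j,0}(u) = Y_{j,0}(u) - ζ_j(u)`, where `Y_{j,0}(u)` is the coefficient of `λ^0` in
`Y(u, λ)^j` and `ζ_j(u)` is the strictly upper triangular matrix with
`[∂_x + b + u, Y_{j,0}(u) - ζ_j(u)] ∈ V_n`. For `V_n`-valued smooth `u` the objects `Y(u, λ)` and
`ζ_j(u)` exist and are unique on `U`. -/
def IsZ (n j : ℕ) (U : Set (ℝ × ℝ)) (u : ℕ → ℝ → ℝ → ℝ)
    (Z : ℝ → ℝ → Matrix (Fin n) (Fin n) ℝ) : Prop :=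
  ∃ (Y : ℝ → ℝ → Matrix (Fin n) (Fin n) (LaurentSeries ℝ))
    (ζ : ℝ → ℝ → Matrix (Fin n) (Fin n) ℝ),
    IsY n U u Y ∧
    (∀ a c : Fin n, ContDiffOn ℝ ∞ (fun p : ℝ × ℝ => ζ p.1 p.2 a c) U) ∧
    (∀ x t, (x, t) ∈ U → ∀ a c : Fin n, c ≤ a → ζ x t a c = 0) ∧
    (∀ x t, (x, t) ∈ U → Z x t = lamCoeff 0 ((Y x t) ^ j) - ζ x t) ∧
    (∀ x t, (x, t) ∈ U → MemV n
      (Matrix.of (fun a c => deriv (fun y => Z y t a c) x)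
        + (bMat n ℝ + uMat n (fun m => u m x t)) * Z x t
        - Z x t * (bMat n ℝ + uMat n (fun m => u m x t))))

/-! ### Central affine curves and the `j`-th central affine curve flow -/

/-- The central affine moving frame `g = (γ, γ_x, …, γ_x^{(n-1)})`. -/
def frame (n : ℕ) (γ : ℝ → ℝ → Fin n → ℝ) (x t : ℝ) : Matrix (Fin n) (Fin n) ℝ :=
  Matrix.of fun a c => iteratedDeriv (c : ℕ) (fun y => γ y t a) x

/-- The central affine curvatures: `curv n γ i` is
`u_{i+1} = det (γ, …, γ_x^{(i-1)}, γ_x^{(n)}, γ_x^{(i+1)}, …, γ_x^{(n-1)})` for `i + 1 < n`. -/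
def curv (n : ℕ) (γ : ℝ → ℝ → Fin n → ℝ) (i : ℕ) (x t : ℝ) : ℝ :=
  if hi : i + 1 < n then
    ((frame n γ x t).updateCol ⟨i, Nat.lt_of_succ_lt hi⟩
      (fun a => iteratedDeriv n (fun y => γ y t a) x)).det
  else 0

/-- `γ` is a smooth solution on `U` of the `j`-th central affine curve flow
`γ_t = g Z_{j,0}(u) e_1`, with `x` the central affine arc-length parameter. -/
def IsCurveFlowSolution (n j : ℕ) (U : Set (ℝ × ℝ)) (γ : ℝ → ℝ → Fin n → ℝ) : Prop :=
  (∀ a : Fin n, ContDiffOn ℝ ∞ (fun p : ℝ × ℝ => γ p.1 p.2 a) U) ∧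
  (∀ x t, (x, t) ∈ U → (frame n γ x t).det = 1) ∧
  ∃ Z : ℝ → ℝ → Matrix (Fin n) (Fin n) ℝ, IsZ n j U (curv n γ) Z ∧
    ∀ x t, (x, t) ∈ U → ∀ a : Fin n,
      deriv (fun s => γ x s a) t = ((frame n γ x t * Z x t) *ᵥ e1 n) a

/-! ### Bäcklund transformations -/

/-- Auxiliary descending recursion: `starCurvAux n u h r` is the coefficient of `e_{n-r, n}` in
`h ∗ u` (for `r = 0` this is `0`). -/
def starCurvAux (n : ℕ) (u : ℕ → ℝ → ℝ → ℝ) (h : ℝ → ℝ → ℝ) : ℕ → ℝ → ℝ → ℝ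
  | 0 => fun _ _ => 0
  | r + 1 => fun x t =>
      u (n - 2 - r) x t
        + (∑ i ∈ Finset.Ico (n - 1 - r) (n - 1),
            (i.choose (n - 1 - r) : ℝ) * u i x t
              * iteratedDeriv (i - (n - 1 - r)) (fun y => h y t) x)
        - (n.choose (n - 1 - r) : ℝ) * iteratedDeriv (r + 1) (fun y => h y t) x
        - deriv (fun y => starCurvAux n u h r y t) x
        - h x t * starCurvAux n u h r x t

/-- `ũ = h ∗ u`, that is `ũ_i = u_i + s_i(u, h)`. With `L = ∂^n - ∑ u_i ∂^{i-1}` and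
`L̃ = ∂^n - ∑ ũ_i ∂^{i-1}`, the `ũ_i` are determined by comparing the coefficients of
`∂, …, ∂^{n-1}` in `L (∂ + h) = (∂ + h) L̃`; equivalently `f = f_{u,h}` below satisfies
`f_x = f (J + u) - (J + ũ) f` up to the entry in position `(1, n)`. For instance
`ũ_{n-1} = u_{n-1} - n h_x`. -/
def starCurv (n : ℕ) (u : ℕ → ℝ → ℝ → ℝ) (h : ℝ → ℝ → ℝ) (i : ℕ) : ℝ → ℝ → ℝ :=
  starCurvAux n u h (n - 1 - i)

/-- The strictly upper triangular matrix `N(u, h)`. -/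
def nMat (n : ℕ) (u : ℕ → ℝ → ℝ → ℝ) (h : ℝ → ℝ → ℝ) (x t : ℝ) : Matrix (Fin n) (Fin n) ℝ :=
  Matrix.of fun a c =>
    if a < c then
      ((c : ℕ).choose (a : ℕ) : ℝ) * iteratedDeriv ((c : ℕ) - (a : ℕ)) (fun y => h y t) x
        + (if (c : ℕ) + 1 = n then starCurv n u h a x t else 0)
    else 0

/-- `f_{u,h}(x, t, l) = J + h I + N(u, h)`, with `l` the value of the spectral parameter. -/
def fMat (n : ℕ) (u : ℕ → ℝ → ℝ → ℝ) (h : ℝ → ℝ → ℝ) (x t l : ℝ) :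
    Matrix (Fin n) (Fin n) ℝ :=
  l • cornerMat n ℝ + bMat n ℝ + h x t • (1 : Matrix (Fin n) (Fin n) ℝ) + nMat n u h x t

/-- `h` is a smooth solution of `(BT)_{u,k}` on `U`. The equation in `x` is
`det f_{u,h} = (-1)^{n-1} (λ - k)`, an equation for `h_x^{(n-1)}` in terms of `u`, lower
derivatives of `h` and `k`. The equation in `t` is `h_t = η_{n,j}(u, h)`, the `(1,1)` entry of
`f_t = f Z_j(u, ·) - Z_j(h ∗ u, ·) f` at spectral parameter `0`. -/
def IsBT (n j : ℕ) (U : Set (ℝ × ℝ)) (u : ℕ → ℝ → ℝ → ℝ) (k : ℝ) (h : ℝ → ℝ → ℝ) : Prop :=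
  ContDiffOn ℝ ∞ (fun p : ℝ × ℝ => h p.1 p.2) U ∧
  (∀ x t, (x, t) ∈ U → ∀ l : ℝ, (fMat n u h x t l).det = (-1) ^ (n - 1) * (l - k)) ∧
  ∃ Z Z' : ℝ → ℝ → Matrix (Fin n) (Fin n) ℝ,
    IsZ n j U u Z ∧ IsZ n j U (starCurv n u h) Z' ∧
    ∀ x t, (x, t) ∈ U → ∀ a : Fin n, (a : ℕ) = 0 →
      deriv (fun s => h x s) t = (fMat n u h x t 0 * Z x t - Z' x t * fMat n u h x t 0) a a

/-- `d g f_{u,h}(x, t, 0)^{-1}`, for a matrix function `g` and a constant matrix `d`. -/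
def btFrame (n : ℕ) (d : Matrix (Fin n) (Fin n) ℝ) (g : ℝ → ℝ → Matrix (Fin n) (Fin n) ℝ)
    (u : ℕ → ℝ → ℝ → ℝ) (h : ℝ → ℝ → ℝ) (x t : ℝ) : Matrix (Fin n) (Fin n) ℝ :=
  d * g x t * (fMat n u h x t 0)⁻¹

/-- The transformed curve `h ∗ γ = d g f_{u,h}(x, t, 0)^{-1} e_1`, where `g` and `u` are the
central affine moving frame and curvature of `γ`. -/
def btCurve (n : ℕ) (d : Matrix (Fin n) (Fin n) ℝ) (γ : ℝ → ℝ → Fin n → ℝ) (h : ℝ → ℝ → ℝ)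
    (x t : ℝ) : Fin n → ℝ :=
  btFrame n d (frame n γ) (curv n γ) h x t *ᵥ e1 n

/-- `(h₁ - h₂)_x / (h₁ - h₂)`. -/
def permShift (h₁ h₂ : ℝ → ℝ → ℝ) (x t : ℝ) : ℝ :=
  deriv (fun y => h₁ y t - h₂ y t) x / (h₁ x t - h₂ x t)

end CentralAffine

end

/-! The element `∑ u_i e_{in}` is read as the operator `L = ∂^n - ∑ u_i ∂^{i-1}`. If `L(∂ + h) = (∂
+ h)L̃`, right multiplication by `∂ + h` maps operators modulo the left ideal of `L` to operators
modulo the left ideal of `L̃`, and `f_{u,h}` at `λ = 0` is its matrix in the basis `1, ∂, …,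
∂^{n-1}` (`btMat`). Compatibility with left multiplication by `∂` is the gauge equation `f_x = f(b +
u) - (b + h ∗ u)f` (`map_btMat`). The determinant of `f` detects the remainder of `L̃` under right
division by `∂ + h` (`det_btMat`), so the determinant half of `(BT)_{u,k}` is a Darboux
factorization `L - k = (∂ + h)S`, `L̃ - k = S(∂ + h)` (`IsDarboux.of_det`).

The shifted functions `h̃_i` are chosen so that `(∂ + h₁)(∂ + h̃₂) = (∂ + h₂)(∂ + h̃₁)`. As `h₁ -
h₂` is invertible, this product divides every common right multiple of `∂ + h₁` and `∂ + h₂` on the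
left (`Compatible.exists_of_shift_eq`). Hence `h̃₂` gives a Darboux factorization for `h₁ ∗ u` with
parameter `k₂` (`IsDarboux.permute`), both orders lead to the same curvature (`star_star_eq`), and
the two products of matrices `f` coincide, since they represent the same second order operator
(`btMat_mul_btMat`). When `d(k₁)` and `d(k₂)` commute, this gives `γ₁₂ = γ₂₁`.

For the time evolution, the principal gradation shows that `Y(u, λ)` is unique (`IsSeries.unique`)
and that `f` with spectral parameter conjugates `Y(u, λ)` to `Y(h ∗ u, λ)` (`IsSeries.conj`).
Therefore `fZ - Z̃f` has first column proportional to `e_1` (`flow_first_column`), and the scalar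
equation for `h_t` propagates to the whole identity `f_t = fZ - Z̃f` (`map_btMat_of_first_column`).
Then `d g f⁻¹` is again a moving frame of the flow (`IsFlowFrame.transform`). The time equation for
`h̃₂` is not given; comparing the two products shows that its defect `δ` satisfies `(∂ + h₁)δ = (∂ +
h₂)δ`, so `δ = 0` (`map_time_permute`).

All of this is algebra over a commutative `ℝ`-algebra with commuting derivations, reduced where `Y`
is concerned; it is then applied to the smooth functions on `U`. -/

noncomputable section

namespace CentralAffine

/-! ### Ordinary differential operators over a differential ring

A polynomial `∑ p_i X^i` stands for the differential operator `∑ p_i ∂^i`. -/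

namespace DiffOp

open Polynomial

variable {A : Type*} [CommRing A] [Algebra ℝ A] (d : Derivation ℝ A A)

/-- The derivation of `A[X]` acting on coefficients. -/
def coeffDer : Derivation ℝ A[X] A[X] :=
  (PolynomialModule.equivPolynomialSelf (R := A)).compDer d.mapCoeffs

@[simp]
lemma coeff_coeffDer (p : A[X]) (i : ℕ) : (coeffDer d p).coeff i = d (p.coeff i) := rfl

/-- Left composition with `∂ + h`. -/
def shift (h : A) : A[X] →+ A[X] where
  toFun p := X * p + C h * p + coeffDer d p
  map_zero' := by simp
  map_add' p q := by simp only [mul_add, map_add]; abel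

lemma shift_apply (h : A) (p : A[X]) :
    shift d h p = X * p + C h * p + coeffDer d p := rfl

lemma coeff_shift_zero (h : A) (p : A[X]) :
    (shift d h p).coeff 0 = h * p.coeff 0 + d (p.coeff 0) := by
  simp [shift_apply]

lemma coeff_shift_succ (h : A) (p : A[X]) (i : ℕ) :
    (shift d h p).coeff (i + 1) = p.coeff i + h * p.coeff (i + 1) + d (p.coeff (i + 1)) := by
  simp [shift_apply]

/-- Left composition with `∂`. -/
def der : A[X] →+ A[X] := shift d 0

lemma shift_eq_der (h : A) (p : A[X]) : shift d h p = der d p + C h * p := by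
  simp only [der, shift_apply, C_0, zero_mul, add_zero]; ring

lemma coeff_der_zero (p : A[X]) : (der d p).coeff 0 = d (p.coeff 0) := by
  simp [der, coeff_shift_zero]

lemma coeff_der_succ (p : A[X]) (i : ℕ) :
    (der d p).coeff (i + 1) = p.coeff i + d (p.coeff (i + 1)) := by
  simp [der, coeff_shift_succ]

lemma der_C_mul (a : A) (p : A[X]) : der d (C a * p) = C a * der d p + C (d a) * p := by
  ext i
  rcases i with _ | i <;> simp [coeff_der_zero, coeff_der_succ] <;> ring

/-- Composition of differential operators. -/
def comp (p q : A[X]) : A[X] := p.sum fun i a => C a * (der d)^[i] q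

lemma add_comp (p q r : A[X]) : comp d (p + q) r = comp d p r + comp d q r :=
  sum_add_index _ _ _ (by simp) (by intros; simp [add_mul])

lemma C_mul_comp (a : A) (p q : A[X]) : comp d (C a * p) q = C a * comp d p q := by
  induction p using Polynomial.induction_on' with
  | add p r hp hr => rw [mul_add, add_comp, add_comp, hp, hr, mul_add]
  | monomial i b =>
    rw [C_mul_monomial, comp, comp, sum_monomial_index _ _ (by simp),
      sum_monomial_index _ _ (by simp), C_mul, mul_assoc]

lemma X_pow_comp (i : ℕ) (q : A[X]) : comp d (X ^ i) q = (der d)^[i] q := by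
  rw [comp, ← monomial_one_right_eq_X_pow, sum_monomial_index _ _ (by simp)]; simp

lemma zero_comp (q : A[X]) : comp d 0 q = 0 := by simp [comp]

lemma neg_comp (p q : A[X]) : comp d (-p) q = - comp d p q := by
  have := add_comp d (-p) p q
  rw [neg_add_cancel, zero_comp] at this
  exact eq_neg_of_add_eq_zero_left this.symm

lemma sub_comp (p q r : A[X]) : comp d (p - q) r = comp d p r - comp d q r := by
  rw [sub_eq_add_neg, add_comp, neg_comp, sub_eq_add_neg]

lemma C_comp (a : A) (q : A[X]) : comp d (C a) q = C a * q := by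
  have := C_mul_comp d a (X ^ 0) q
  rw [X_pow_comp] at this
  simpa using this

lemma monomial_comp (i : ℕ) (a : A) (q : A[X]) :
    comp d (monomial i a) q = C a * (der d)^[i] q := by
  rw [← C_mul_X_pow_eq_monomial, C_mul_comp, X_pow_comp]

lemma sum_comp {ι : Type*} (s : Finset ι) (p : ι → A[X]) (q : A[X]) :
    comp d (∑ i ∈ s, p i) q = ∑ i ∈ s, comp d (p i) q := by
  classical
  induction s using Finset.induction_on with
  | empty => simp [zero_comp]
  | insert i s hi ih => rw [Finset.sum_insert hi, Finset.sum_insert hi, add_comp, ih]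

lemma der_comp (p q : A[X]) : comp d (der d p) q = der d (comp d p q) := by
  induction p using Polynomial.induction_on' with
  | add p r hp hr => rw [map_add, add_comp, hp, hr, add_comp, map_add]
  | monomial i a =>
    have h : der d (monomial i a) = monomial (i + 1) a + monomial i (d a) := by
      rw [← C_mul_X_pow_eq_monomial, der_C_mul]
      have : der d (X ^ i : A[X]) = X ^ (i + 1) := by
        ext m
        rcases m with _ | m
        · rw [coeff_der_zero]; simp [coeff_X_pow, apply_ite d]
        · rw [coeff_der_succ]; simp [coeff_X_pow, apply_ite d]
      rw [this, C_mul_X_pow_eq_monomial, C_mul_X_pow_eq_monomial]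
    rw [h, add_comp, monomial_comp, monomial_comp, monomial_comp, der_C_mul,
      Function.iterate_succ_apply']

lemma shift_comp (h : A) (p q : A[X]) : comp d (shift d h p) q = shift d h (comp d p q) := by
  rw [shift_eq_der, shift_eq_der, add_comp, der_comp, C_mul_comp]

lemma iterate_der_comp (i : ℕ) (p q : A[X]) :
    comp d ((der d)^[i] p) q = (der d)^[i] (comp d p q) := by
  induction i with
  | zero => rfl
  | succ i ih => rw [Function.iterate_succ_apply', Function.iterate_succ_apply', der_comp, ih]

lemma comp_assoc (p q r : A[X]) : comp d (comp d p q) r = comp d p (comp d q r) := by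
  induction p using Polynomial.induction_on' with
  | add p s hp hs => rw [add_comp, add_comp, add_comp, hp, hs]
  | monomial i a => rw [monomial_comp, monomial_comp, C_mul_comp, iterate_der_comp]

/-- The operator `∂ + h`. -/
def lin (h : A) : A[X] := X + C h

lemma lin_comp (h : A) (p : A[X]) : comp d (lin h) p = shift d h p := by
  rw [lin, add_comp, C_comp, shift_eq_der, ← pow_one X, X_pow_comp]; rfl

lemma comp_shift (p q : A[X]) (h : A) : comp d (comp d p (lin h)) q = comp d p (shift d h q) := by
  rw [comp_assoc, lin_comp]

/-! #### Leading coefficients -/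

/-- The operator `∂ + h` is monic, so left composition with it raises the order by one and keeps the
leading coefficient. Zero divisors in `A` are therefore harmless. The coefficient of index `0` is
left free so that the lemma also applies when the composite is a function. -/
lemma eq_zero_of_shift_coeff (h : A) {p : A[X]} (H : ∀ i, (shift d h p).coeff (i + 1) = 0) :
    p = 0 := by
  by_contra hp
  have h1 := H p.natDegree
  rw [coeff_shift_succ, coeff_eq_zero_of_natDegree_lt (Nat.lt_succ_self _)] at h1
  simp only [mul_zero, map_zero, add_zero, coeff_natDegree, leadingCoeff_eq_zero] at h1
  exact hp h1

lemma shift_injective (h : A) : Function.Injective (shift d h) := by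
  rw [injective_iff_map_eq_zero]
  intro p hp
  exact eq_zero_of_shift_coeff d h (by simp [hp])

lemma eq_zero_of_shift_eq_C {h c : A} {p : A[X]} (H : shift d h p = C c) : p = 0 :=
  eq_zero_of_shift_coeff d h (by intro i; rw [H, coeff_C_succ])

lemma eq_zero_of_shift_shift_coeff (h k : A) {p : A[X]}
    (H : ∀ i, (shift d h (shift d k p)).coeff (i + 2) = 0) : p = 0 := by
  by_contra hp
  have h1 := H p.natDegree
  rw [coeff_shift_succ, coeff_shift_succ, coeff_shift_succ,
    coeff_eq_zero_of_natDegree_lt (Nat.lt_succ_self _),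
    coeff_eq_zero_of_natDegree_lt (show p.natDegree < p.natDegree + 1 + 1 by omega)] at h1
  simp only [mul_zero, map_zero, add_zero, coeff_natDegree, leadingCoeff_eq_zero] at h1
  exact hp h1

lemma coeff_iterate_der_of_lt (i : ℕ) : ∀ (m : ℕ) (q : A[X]), q.natDegree + i < m →
    ((der d)^[i] q).coeff m = 0 := by
  induction i with
  | zero => intro m q h; exact coeff_eq_zero_of_natDegree_lt (by simpa using h)
  | succ i ih =>
    intro m q h
    rw [Function.iterate_succ_apply']
    obtain ⟨m, rfl⟩ : ∃ m', m = m' + 1 := ⟨m - 1, by omega⟩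
    rw [coeff_der_succ, ih m q (by omega), ih (m + 1) q (by omega)]; simp

omit [Algebra ℝ A] in
lemma natDegree_lin_le (h : A) : (lin h).natDegree ≤ 1 := by
  unfold lin; compute_degree

lemma coeff_iterate_der_lin (i : ℕ) (h : A) : ((der d)^[i] (lin h)).coeff (i + 1) = 1 := by
  induction i with
  | zero => simp [lin]
  | succ i ih =>
    rw [Function.iterate_succ_apply', coeff_der_succ, ih,
      coeff_iterate_der_of_lt d i _ _ (by have := natDegree_lin_le h; omega)]
    simp

lemma coeff_iterate_der_lin_of_lt {i m : ℕ} (h : A) (him : i + 1 < m) :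
    ((der d)^[i] (lin h)).coeff m = 0 :=
  coeff_iterate_der_of_lt d i _ _ (by have := natDegree_lin_le h; omega)

lemma coeff_comp (p q : A[X]) (m : ℕ) :
    (comp d p q).coeff m = p.sum fun i a => a * ((der d)^[i] q).coeff m := by
  simp [comp, Polynomial.sum_def]

/-- The mirror image for right composition: only the top term of `p` reaches order `natDegree + 1`.
-/
lemma coeff_comp_lin_natDegree (p : A[X]) (h : A) :
    (comp d p (lin h)).coeff (p.natDegree + 1) = p.leadingCoeff := by
  rw [coeff_comp, sum_over_range _ (by simp), Finset.sum_range_succ, coeff_iterate_der_lin,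
    Finset.sum_eq_zero, zero_add, mul_one, leadingCoeff]
  intro i hi
  rw [coeff_iterate_der_lin_of_lt d h (by have := Finset.mem_range.1 hi; omega), mul_zero]

lemma eq_zero_of_comp_lin_eq_C {p : A[X]} {h c : A} (H : comp d p (lin h) = C c) : p = 0 := by
  have := coeff_comp_lin_natDegree d p h
  rw [H, coeff_C_succ] at this
  exact leadingCoeff_eq_zero.1 this.symm

/-! #### Division by first order operators -/

/-- Left division by a monic operator: subtracting `(∂ + h) a ∂^i` from `a ∂^{i+1}` leaves a term of
order `i` with a new coefficient, which is why the induction is over all `a`. -/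
lemma exists_eq_shift_add_C (h : A) (p : A[X]) : ∃ s a, p = shift d h s + C a := by
  induction p using Polynomial.induction_on' with
  | add p q hp hq =>
    obtain ⟨s, a, hp⟩ := hp
    obtain ⟨s', a', hq⟩ := hq
    exact ⟨s + s', a + a', by rw [map_add, C_add, hp, hq]; abel⟩
  | monomial i a =>
    induction i generalizing a with
    | zero => exact ⟨0, a, by simp⟩
    | succ i ih =>
      obtain ⟨s, c, hs⟩ := ih (h * a + d a)
      refine ⟨monomial i a - s, -c, ?_⟩
      have h1 : shift d h (monomial i a) = monomial (i + 1) a + monomial i (h * a + d a) := by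
        ext m
        rcases m with _ | m
        · rw [coeff_shift_zero]; simp [coeff_monomial, apply_ite d]
        · rw [coeff_shift_succ]; simp [coeff_monomial, apply_ite d, add_assoc]
      rw [map_sub, h1, hs, C_neg]; abel

/-- Right division. Coefficients pull out on the left, so pure powers of `∂` suffice, and the
remainder is carried along by `∂ r = r(∂ + h) + (r' - r h)`. -/
lemma exists_eq_comp_lin_add_C (h : A) (p : A[X]) : ∃ s r, p = comp d s (lin h) + C r := by
  induction p using Polynomial.induction_on' with
  | add p q hp hq =>
    obtain ⟨s, a, hp⟩ := hp
    obtain ⟨s', a', hq⟩ := hq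
    exact ⟨s + s', a + a', by rw [add_comp, C_add, hp, hq]; abel⟩
  | monomial i a =>
    suffices H : ∃ s r, (X ^ i : A[X]) = comp d s (lin h) + C r by
      obtain ⟨s, r, H⟩ := H
      exact ⟨C a * s, a * r, by rw [← C_mul_X_pow_eq_monomial, H, C_mul_comp, C_mul, mul_add]⟩
    clear a
    induction i with
    | zero => exact ⟨0, 1, by simp [zero_comp]⟩
    | succ i ih =>
      obtain ⟨s, r, ih⟩ := ih
      refine ⟨der d s + C r, d r - r * h, ?_⟩
      have h1 : (X ^ (i + 1) : A[X]) = der d (X ^ i) := by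
        rw [← mul_one (X ^ i), ← mul_one (X ^ (i + 1))]
        ext m
        rcases m with _ | m
        · rw [coeff_der_zero]; simp [coeff_X_pow, apply_ite d]
        · rw [coeff_der_succ]; simp [coeff_X_pow, apply_ite d]
      rw [h1, ih, map_add, add_comp, der_comp, C_comp]
      have h2 : der d (C r) = C r * X + C (d r) := by
        ext m
        rcases m with _ | m
        · rw [coeff_der_zero]; simp
        · rw [coeff_der_succ]
          rcases m with _ | m <;> simp [coeff_C]
      rw [h2, lin, C_sub, C_mul]; ring

lemma shift_C (h a : A) : shift d h (C a) = C a * X + C (h * a + d a) := by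
  ext m
  rcases m with _ | m
  · rw [coeff_shift_zero]; simp
  · rw [coeff_shift_succ]
    rcases m with _ | m <;> simp [coeff_C]

/-- The compatibility `(∂ + h₁)(∂ + m₂) = (∂ + h₂)(∂ + m₁)`. -/
structure Compatible (h₁ h₂ m₁ m₂ : A) : Prop where
  add_eq : h₁ + m₂ = h₂ + m₁
  mul_eq : h₁ * m₂ + d m₂ = h₂ * m₁ + d m₁

variable {d}

lemma Compatible.symm {h₁ h₂ m₁ m₂ : A} (H : Compatible d h₁ h₂ m₁ m₂) :
    Compatible d h₂ h₁ m₂ m₁ := ⟨H.1.symm, H.2.symm⟩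

lemma Compatible.shift_shift {h₁ h₂ m₁ m₂ : A} (H : Compatible d h₁ h₂ m₁ m₂) (p : A[X]) :
    shift d h₁ (shift d m₂ p) = shift d h₂ (shift d m₁ p) := by
  have key : ∀ h m : A, shift d h (shift d m p)
      = der d (der d p) + C (h + m) * der d p + C (h * m + d m) * p := by
    intro h m
    simp only [shift_eq_der, map_add, der_C_mul, C_mul]
    ring
  rw [key, key, H.add_eq, H.mul_eq]

/-- The coefficient of `∂` forces `a = b`; the coefficient of `1` then gives `(h₁ - h₂) a = 0`. This
is where `h₁ ≠ h₂` at every point enters. -/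
lemma shift_C_eq_shift_C {h₁ h₂ a b : A} (hu : IsUnit (h₁ - h₂))
    (H : shift d h₁ (C a) = shift d h₂ (C b)) : a = 0 ∧ b = 0 := by
  rw [shift_C, shift_C] at H
  have h1 := congrArg (fun p => coeff p 1) H
  have h0 := congrArg (fun p => coeff p 0) H
  simp only [coeff_add, coeff_C_mul, coeff_X_one, mul_one, coeff_C_succ, add_zero,
    coeff_X_zero, mul_zero, coeff_C_zero, zero_add] at h0 h1
  subst h1
  have : a = 0 := by
    have h2 : (h₁ - h₂) * a = 0 := by linear_combination h0
    exact (hu.mul_right_eq_zero).1 h2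
  exact ⟨this, this⟩

/-- The operator `(∂ + h₁)(∂ + m₂)` is a least common right multiple of `∂ + h₁` and `∂ + h₂`. After
division of `p` by `∂ + m₂` and of `q` by `∂ + m₁`, comparison of orders makes the quotients equal,
and `shift_C_eq_shift_C` kills the remainders. -/
lemma Compatible.exists_of_shift_eq {h₁ h₂ m₁ m₂ : A} (H : Compatible d h₁ h₂ m₁ m₂)
    (hu : IsUnit (h₁ - h₂)) {p q : A[X]} (hpq : shift d h₁ p = shift d h₂ q) :
    ∃ s, p = shift d m₂ s ∧ q = shift d m₁ s := by
  obtain ⟨s, a, rfl⟩ := exists_eq_shift_add_C d m₂ p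
  obtain ⟨s', b, rfl⟩ := exists_eq_shift_add_C d m₁ q
  have h1 : shift d h₁ (shift d m₂ (s - s')) = shift d h₂ (C b) - shift d h₁ (C a) := by
    rw [map_sub, map_sub, H.shift_shift s']
    rw [map_add, map_add] at hpq
    linear_combination hpq
  have h2 : s - s' = 0 := by
    refine eq_zero_of_shift_shift_coeff d h₁ m₂ fun i => ?_
    rw [h1, shift_C, shift_C]
    simp
  rw [h2, map_zero, map_zero] at h1
  obtain ⟨rfl, rfl⟩ := shift_C_eq_shift_C hu (sub_eq_zero.1 h1.symm).symm
  obtain rfl := sub_eq_zero.1 h2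
  exact ⟨s, by simp, by simp⟩

/-! #### Darboux transformations and permutability -/

/-- Substituting `L' = S(∂ + h) + r` and moving the constant `r` across gives `(L - (∂ + h)S - r)(∂
+ h) = c`. A nonzero operator times `∂ + h` has positive order, so both sides vanish. -/
lemma eq_shift_of_factorization {L L' S : A[X]} {h c r : A} (hr : d r = 0)
    (hL' : L' = comp d S (lin h) + C r) (H : comp d L (lin h) = shift d h L' + C c) :
    c = 0 ∧ L = shift d h S + C r := by
  have h1 : comp d (L - shift d h S - C r) (lin h) = C c := by
    rw [sub_comp, sub_comp, shift_comp, C_comp, H, hL', map_add, shift_C, hr, lin, add_zero, C_mul]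
    ring
  have h2 := eq_zero_of_comp_lin_eq_C d h1
  rw [h2, zero_comp] at h1
  refine ⟨C_injective (by rw [← h1, C_0]), ?_⟩
  linear_combination h2

/-- Permutability at the level of operators. -/
lemma Compatible.factorization {h₁ h₂ m₁ m₂ k c : A} (H : Compatible d h₁ h₂ m₁ m₂)
    (hu : IsUnit (h₁ - h₂)) {L L₁ L₁₂ S₂ : A[X]} (hk : d k = 0)
    (h1 : comp d L (lin h₁) = shift d h₁ L₁)
    (h2 : L = shift d h₂ S₂ + C k)
    (h12 : comp d L₁ (lin m₂) = shift d m₂ L₁₂ + C c) :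
    c = 0 ∧ ∃ S, L₁₂ = comp d S (lin m₂) + C k := by
  -- Both sides are `(L - k)(∂ + h₁)`, a common right multiple of `∂ + h₁` and `∂ + h₂`; hence `L₁ -
  -- k = (∂ + m₂)s`.
  have e1 : shift d h₁ (L₁ - C k) = shift d h₂ (comp d S₂ (lin h₁)) := by
    rw [map_sub, ← h1, h2, add_comp, shift_comp, C_comp, shift_C, hk, lin, add_zero, C_mul]; ring
  obtain ⟨s, hs, -⟩ := H.exists_of_shift_eq hu e1
  have e2 : shift d m₂ (comp d s (lin m₂) + C k - L₁₂) = C c := by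
    have : L₁ = shift d m₂ s + C k := by rw [← hs]; ring
    rw [this, add_comp, shift_comp, C_comp] at h12
    rw [map_sub, map_add, shift_C, hk, add_zero, C_mul]
    have hl : lin m₂ = X + C m₂ := rfl
    linear_combination h12 - C k * hl
  have e3 := eq_zero_of_shift_eq_C d e2
  rw [e3, map_zero] at e2
  exact ⟨C_injective (by rw [← e2, C_0]), s, (sub_eq_zero.1 e3).symm⟩

/-- With `Q = (∂ + h₁)(∂ + m₂) = (∂ + h₂)(∂ + m₁)`, both orders give `Q L₁₂ = L Q = Q L₂₁`, and the
monic operator `Q` can be cancelled on the left. -/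
lemma Compatible.eq_of_comp {h₁ h₂ m₁ m₂ : A} (H : Compatible d h₁ h₂ m₁ m₂)
    {L L₁ L₂ L₁₂ L₂₁ : A[X]}
    (h1 : comp d L (lin h₁) = shift d h₁ L₁) (h2 : comp d L (lin h₂) = shift d h₂ L₂)
    (h12 : comp d L₁ (lin m₂) = shift d m₂ L₁₂)
    (h21 : comp d L₂ (lin m₁) = shift d m₁ L₂₁) : L₁₂ = L₂₁ := by
  have key : ∀ {h m : A} {M M' : A[X]}, comp d L (lin h) = shift d h M →
      comp d M (lin m) = shift d m M' →
      shift d h (shift d m M') = comp d L (shift d h (lin m)) := by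
    intro h m M M' e e'
    rw [← e', ← shift_comp, ← e, comp_shift]
  have e := H.shift_shift L₂₁
  have h3 : shift d h₁ (lin m₂) = shift d h₂ (lin m₁) := by
    have := H.shift_shift (1 : A[X])
    have hl : ∀ m : A, shift d m 1 = lin m := by
      intro m; rw [shift_apply, lin]; simp
    rwa [hl, hl] at this
  have e1 := key h1 h12
  rw [h3, ← key h2 h21, ← e] at e1
  exact shift_injective d _ (shift_injective d _ e1)

end DiffOp

end CentralAffine

end

noncomputable section

namespace CentralAffine

/-! ### Companion matrices and Bäcklund matrices over a differential ring -/

section Companion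

variable {A : Type*} [CommRing A]

/-- The element `∑ u_i e_{i n}` of `V_n` over a ring. -/
def curvMat (n : ℕ) (u : ℕ → A) : Matrix (Fin n) (Fin n) A :=
  Matrix.of fun a c => if (c : ℕ) + 1 = n ∧ (a : ℕ) + 1 < n then u a else 0

/-- `b + u`. -/
def compMat (n : ℕ) (u : ℕ → A) : Matrix (Fin n) (Fin n) A := bMat n A + curvMat n u

lemma bMat_mulVec_zero {n : ℕ} (v : Fin n → A) {a : Fin n} (ha : (a : ℕ) = 0) :
    (bMat n A *ᵥ v) a = 0 := by
  simp [Matrix.mulVec, dotProduct, bMat, ha]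

lemma bMat_mulVec_succ {n : ℕ} (v : Fin n → A) {a a' : Fin n} (ha : (a : ℕ) = a' + 1) :
    (bMat n A *ᵥ v) a = v a' := by
  rw [Matrix.mulVec, dotProduct, Finset.sum_eq_single a']
  · simp [bMat, ha]
  · intro k _ hk
    have : ¬ (a : ℕ) = k + 1 := fun h => hk (Fin.ext (by omega))
    simp [bMat, this]
  · simp

lemma curvMat_mulVec {n : ℕ} (u : ℕ → A) (v : Fin n → A) (a l : Fin n) (hl : (l : ℕ) + 1 = n) :
    (curvMat n u *ᵥ v) a = (if (a : ℕ) + 1 < n then u a else 0) * v l := by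
  rw [Matrix.mulVec, dotProduct, Finset.sum_eq_single l]
  · simp [curvMat, hl]
  · intro k _ hk
    have : ¬ (k : ℕ) + 1 = n := fun h => hk (Fin.ext (by omega))
    simp [curvMat, this]
  · simp

lemma mul_compMat_apply {n : ℕ} (M : Matrix (Fin n) (Fin n) A) (u : ℕ → A) (a : Fin n)
    {c c' : Fin n} (hc : (c' : ℕ) = c + 1) : (M * compMat n u) a c = M a c' := by
  rw [Matrix.mul_apply, Finset.sum_eq_single c']
  · have : ¬ (c : ℕ) + 1 = n := by have := c'.2; omega
    simp [compMat, bMat, curvMat, hc, this]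
  · intro k _ hk
    have h1 : ¬ (k : ℕ) = c + 1 := fun h => hk (Fin.ext (by omega))
    have h2 : ¬ (c : ℕ) + 1 = n := by have := c'.2; omega
    simp [compMat, bMat, curvMat, h1, h2]
  · simp

lemma mul_compMat_apply_last {n : ℕ} (M : Matrix (Fin n) (Fin n) A) (u : ℕ → A) (a : Fin n)
    {c : Fin n} (hc : (c : ℕ) + 1 = n) :
    (M * compMat n u) a c = ∑ i, M a i * (if (i : ℕ) + 1 < n then u i else 0) := by
  rw [Matrix.mul_apply]
  refine Finset.sum_congr rfl fun i _ => ?_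
  have : ¬ (i : ℕ) = n := by have := i.2; omega
  simp [compMat, bMat, curvMat, hc, this]

end Companion

open Polynomial DiffOp

variable {A : Type*} [CommRing A] [Algebra ℝ A] (d : Derivation ℝ A A)

/-- The descending recursion of `starCurvAux` over a differential ring. -/
def starAux (n : ℕ) (u : ℕ → A) (h : A) : ℕ → A
  | 0 => 0
  | r + 1 => u (n - 2 - r)
      + (∑ i ∈ Finset.Ico (n - 1 - r) (n - 1),
          (i.choose (n - 1 - r) : A) * u i * d^[i - (n - 1 - r)] h)
      - (n.choose (n - 1 - r) : A) * d^[r + 1] h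
      - d (starAux n u h r) - h * starAux n u h r

/-- `h ∗ u` over a differential ring. -/
def star (n : ℕ) (u : ℕ → A) (h : A) (i : ℕ) : A := starAux d n u h (n - 1 - i)

lemma star_of_le {n : ℕ} (u : ℕ → A) (h : A) {i : ℕ} (hi : n ≤ i + 1) : star d n u h i = 0 := by
  rw [star, show n - 1 - i = 0 by omega]; rfl

lemma star_of_lt {n : ℕ} (u : ℕ → A) (h : A) {i : ℕ} (hi : i + 1 < n) :
    star d n u h i = u i
      + (∑ k ∈ Finset.Ico (i + 1) (n - 1), (k.choose (i + 1) : A) * u k * d^[k - (i + 1)] h)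
      - (n.choose (i + 1) : A) * d^[n - (i + 1)] h
      - d (star d n u h (i + 1)) - h * star d n u h (i + 1) := by
  obtain ⟨r, hr⟩ : ∃ r, n = r + i + 2 := ⟨n - i - 2, by omega⟩
  have h1 : n - 1 - i = r + 1 := by omega
  have h2 : n - 1 - (i + 1) = r := by omega
  rw [star, star, h1, h2, starAux, show n - 1 - r = i + 1 by omega, show n - 2 - r = i by omega,
    show n - (i + 1) = r + 1 by omega]

/-- The operator `∂^n - ∑ u_i ∂^i`. -/
def opOf (n : ℕ) (u : ℕ → A) : A[X] := X ^ n - ∑ i ∈ Finset.range (n - 1), C (u i) * X ^ i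

omit [Algebra ℝ A] in
lemma coeff_opOf (n : ℕ) (u : ℕ → A) (m : ℕ) :
    (opOf n u).coeff m = (if m = n then 1 else 0) - if m + 1 < n then u m else 0 := by
  have : (m < n - 1) ↔ m + 1 < n := by omega
  simp [opOf, coeff_X_pow, this]

/-- Leibniz rule for `∂^i ∘ (∂ + h)`: the first summand is `∂^{i+1}`, the second comes from `∂^i ∘
h`. For `m > i` the binomial coefficient makes the truncated exponent `i - m` irrelevant. -/
lemma coeff_iterate_der_lin_eq (h : A) (i m : ℕ) :
    ((der d)^[i] (lin h)).coeff m
      = (if m = i + 1 then 1 else 0) + (i.choose m : A) * d^[i - m] h := by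
  induction i generalizing m with
  | zero => rcases m with _ | _ | m <;> simp [lin, coeff_X, coeff_C]
  | succ i ih =>
    rw [Function.iterate_succ_apply']
    rcases m with _ | m
    · rw [coeff_der_zero, ih]
      simp [← Function.iterate_succ_apply' (f := d)]
    · rw [coeff_der_succ, ih, ih]
      have h0 : d (if m + 1 = i + 1 then (1 : A) else 0) = 0 := by split_ifs <;> simp
      have h1 : ∀ (N : ℕ) (x : A), d ((N : A) * x) = N * d x := by
        intro N x; rw [d.leibniz]; simp
      rw [map_add, h0, h1, zero_add, add_assoc, Nat.choose_succ_succ, Nat.add_sub_add_right]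
      simp only [add_left_inj, Nat.cast_add, add_mul]
      congr 2
      rcases lt_or_ge i (m + 1) with hlt | hge
      · simp [Nat.choose_eq_zero_of_lt hlt]
      · rw [← Function.iterate_succ_apply' (f := d), show (i - (m + 1)).succ = i - m by omega]

/-- The operators `∂^n - ∑ u_i ∂^i` and `∂^n - ∑ (h ∗ u)_i ∂^i` are intertwined by `∂ + h` up to
a function. -/
lemma exists_comp_opOf (n : ℕ) (hn : 2 ≤ n) (u : ℕ → A) (h : A) :
    ∃ c, comp d (opOf n u) (lin h) = shift d h (opOf n (star d n u h)) + C c := by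
  refine ⟨(comp d (opOf n u) (lin h) - shift d h (opOf n (star d n u h))).coeff 0, ?_⟩
  rw [← sub_eq_iff_eq_add']
  ext m
  rcases m with _ | m
  · simp
  rw [coeff_C_succ, coeff_sub, sub_eq_zero, coeff_shift_succ, opOf, DiffOp.sub_comp, DiffOp.X_pow_comp, DiffOp.sum_comp]
  simp only [DiffOp.C_mul_comp, DiffOp.X_pow_comp, coeff_sub, finsetSum_coeff, coeff_C_mul,
    coeff_iterate_der_lin_eq, coeff_opOf]
  have hs : ∀ m, (if m + 1 < n then star d n u h m else 0) = star d n u h m := by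
    intro m
    split_ifs with hm
    · rfl
    · rw [star_of_le d u h (by omega)]
  have hd : d (if m + 1 = n then (1 : A) else 0) = 0 := by split_ifs <;> simp
  rw [hs, hs, map_sub, hd]
  simp only [mul_add, Finset.sum_add_distrib, add_left_inj]
  have e1 : ∑ i ∈ Finset.range (n - 1), u i * (if m = i then (1 : A) else 0)
      = if m + 1 < n then u m else 0 := by
    have : (m < n - 1) ↔ m + 1 < n := by omega
    simp [this]
  have e2 : ∑ i ∈ Finset.range (n - 1), u i * ((i.choose (m + 1) : A) * d^[i - (m + 1)] h)
      = ∑ k ∈ Finset.Ico (m + 1) (n - 1), (k.choose (m + 1) : A) * u k * d^[k - (m + 1)] h := by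
    symm
    refine Finset.sum_subset_zero_on_sdiff ?_ ?_ ?_
    · intro i hi; simp at hi ⊢; omega
    · intro i hi
      simp only [Finset.mem_sdiff, Finset.mem_range, Finset.mem_Ico, not_and_or] at hi
      rw [Nat.choose_eq_zero_of_lt (by omega)]; simp
    · intros; ring
  rw [e1, e2]
  -- The coefficients of `∂, …, ∂^{n-1}` are exactly what the recursion for `h ∗ u` prescribes; from
  -- `∂^n` upwards the two sides agree automatically.
  rcases lt_trichotomy (m + 1) n with hm | hm | hm
  · have := star_of_lt d u h hm
    rw [if_pos hm, if_neg (show ¬ m + 1 = n by omega), if_neg (show ¬ m = n by omega)]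
    rw [this]; ring
  · subst hm
    simp [star_of_le]
  · have h2 : Finset.Ico (m + 1) (n - 1) = ∅ := Finset.Ico_eq_empty (by omega)
    rw [star_of_le d u h (by omega), star_of_le d u h (by omega),
      Nat.choose_eq_zero_of_lt hm, if_neg (show ¬ m + 1 < n by omega),
      if_neg (show ¬ m + 1 = n by omega), h2]
    simp

/-- The matrix `f_{u,h}` at spectral parameter `0`. -/
def btMat (n : ℕ) (u : ℕ → A) (h : A) : Matrix (Fin n) (Fin n) A :=
  Matrix.of fun a c => ((der d)^[(c : ℕ)] (lin h)).coeff a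
    + if (c : ℕ) + 1 = n then star d n u h a else 0

lemma btMat_apply_of_lt {n : ℕ} (u : ℕ → A) (h : A) {a c : Fin n} (hac : (c : ℕ) + 1 < a) :
    btMat d n u h a c = 0 := by
  have : ¬ (c : ℕ) + 1 = n := by have := a.2; omega
  simp [btMat, coeff_iterate_der_lin_of_lt d h hac, this]

lemma btMat_apply_succ {n : ℕ} (u : ℕ → A) (h : A) {a c : Fin n} (hac : (a : ℕ) = c + 1) :
    btMat d n u h a c = 1 := by
  have : ¬ (c : ℕ) + 1 = n := by have := a.2; omega
  simp [btMat, hac, coeff_iterate_der_lin, this]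

lemma btMat_apply_diag {n : ℕ} (u : ℕ → A) (h : A) (a : Fin n) :
    btMat d n u h a a = h := by
  have : (if (a : ℕ) + 1 = n then star d n u h a else 0) = 0 := by
    split_ifs with h1
    · exact star_of_le d u h h1.ge
    · rfl
  simp [btMat, coeff_iterate_der_lin_eq, this]

/-- `f_x = f (b + u) - (b + h ∗ u) f` at spectral parameter `0`. -/
lemma map_btMat {n : ℕ} (hn : 2 ≤ n) (u : ℕ → A) (h : A)
    (H : comp d (opOf n u) (lin h) = shift d h (opOf n (star d n u h))) :
    (btMat d n u h).map d
      = btMat d n u h * compMat n u - compMat n (star d n u h) * btMat d n u h := by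
  rw [eq_sub_iff_add_eq]
  ext a c
  obtain ⟨l, hl⟩ : ∃ l : Fin n, (l : ℕ) + 1 = n := ⟨⟨n - 1, by omega⟩, by simp; omega⟩
  have hs : ∀ m, (if m + 1 < n then star d n u h m else 0) = star d n u h m := by
    intro m
    split_ifs with hm
    · rfl
    · rw [star_of_le d u h (by omega)]
  have hcm : (compMat n (star d n u h) * btMat d n u h) a c
      = (bMat n A *ᵥ fun k => btMat d n u h k c) a + star d n u h a * btMat d n u h l c := by
    have := curvMat_mulVec (star d n u h) (fun k => btMat d n u h k c) a l hl
    rw [hs] at this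
    rw [← this, compMat, add_mul]; rfl
  rw [Matrix.add_apply, hcm, Matrix.map_apply]
  -- In the last column the identity is `H` read coefficient by coefficient. In the others it says
  -- that column `c + 1` is `∂` applied to column `c`; the entries of `h ∗ u` appear when column `c
  -- + 1` is the last, where `∂^n` is reduced modulo the new operator.
  by_cases hc : (c : ℕ) + 1 = n
  · have hcl : c = l := Fin.ext (by omega)
    subst hcl
    rw [mul_compMat_apply_last _ _ _ hc, btMat_apply_diag]
    have h1 : ∑ i : Fin n, btMat d n u h a i * (if (i : ℕ) + 1 < n then u i else 0)
        = ∑ i ∈ Finset.range (n - 1), u i * ((der d)^[i] (lin h)).coeff a := by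
      rw [Finset.sum_range, ← Finset.sum_subset
        (Finset.subset_univ (Finset.univ.filter fun i : Fin n => (i : ℕ) + 1 < n))]
      · symm
        refine Finset.sum_bij (fun i _ => ⟨i, by omega⟩) ?_ ?_ ?_ ?_
        · intro i _
          have := i.2
          simp; omega
        · intro i _ i' _ hii; simpa [Fin.ext_iff] using hii
        · intro i hi
          simp at hi
          exact ⟨⟨i, by omega⟩, by simp, rfl⟩
        · intro i _
          have h1 := i.2
          have h2 : ¬ (i : ℕ) + 1 = n := by omega
          have h3 : (i : ℕ) + 1 < n := by omega
          simp [btMat, h2, h3, mul_comm]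
      · intro i _ hi
        simp at hi
        simp [Nat.not_lt.2 hi]
    rw [h1]
    have H' := congrArg (fun p => p.coeff (a : ℕ)) H
    rw [opOf, DiffOp.sub_comp, DiffOp.X_pow_comp, DiffOp.sum_comp] at H'
    simp only [DiffOp.C_mul_comp, DiffOp.X_pow_comp, coeff_sub, finsetSum_coeff, coeff_C_mul] at H'
    have hn1 : n = c + 1 := hc.symm
    have hda : (btMat d n u h a c) = ((der d)^[(c : ℕ)] (lin h)).coeff a + star d n u h a := by
      simp [btMat, hc]
    rw [hda, map_add]
    have hn' : (der d)^[n] (lin h) = der d ((der d)^[(c : ℕ)] (lin h)) := by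
      rw [← Function.iterate_succ_apply' (f := der d), Nat.succ_eq_add_one, hc]
    rw [hn'] at H'
    have han : ¬ (a : ℕ) = n := by have := a.2; omega
    rcases Nat.eq_zero_or_pos (a : ℕ) with ha | ha
    · rw [bMat_mulVec_zero _ ha]
      rw [ha] at H' ⊢
      rw [coeff_shift_zero, coeff_der_zero, coeff_opOf, hs, if_neg (by omega), zero_sub, map_neg]
        at H'
      linear_combination H'
    · obtain ⟨a', ha'⟩ : ∃ a' : Fin n, (a : ℕ) = a' + 1 :=
        ⟨⟨a - 1, by omega⟩, by simp; omega⟩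
      have hda' : btMat d n u h a' c
          = ((der d)^[(c : ℕ)] (lin h)).coeff a' + star d n u h a' := by
        simp [btMat, hc]
      rw [bMat_mulVec_succ _ ha', hda']
      rw [ha'] at H' han ⊢
      rw [coeff_shift_succ, coeff_der_succ, coeff_opOf, coeff_opOf, hs, hs, if_neg han,
        if_neg (by omega), zero_sub, zero_sub, map_neg] at H'
      linear_combination H'
  · obtain ⟨c', hc'⟩ : ∃ c' : Fin n, (c' : ℕ) = c + 1 := ⟨⟨c + 1, by omega⟩, rfl⟩
    rw [mul_compMat_apply _ _ _ hc']
    have hda : ∀ k : Fin n, btMat d n u h k c = ((der d)^[(c : ℕ)] (lin h)).coeff k := by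
      simp [btMat, hc]
    have hlc : star d n u h a * btMat d n u h l c
        = if (c' : ℕ) + 1 = n then star d n u h a else 0 := by
      split_ifs with h1
      · rw [btMat_apply_succ d u h (by omega), mul_one]
      · rw [btMat_apply_of_lt d u h (by omega), mul_zero]
    have hda' : btMat d n u h a c' = (der d ((der d)^[(c : ℕ)] (lin h))).coeff a
        + if (c' : ℕ) + 1 = n then star d n u h a else 0 := by
      rw [← Function.iterate_succ_apply' (f := der d), Nat.succ_eq_add_one, ← hc']; rfl
    rw [hlc, hda', hda, ← add_assoc]
    congr 1
    rcases Nat.eq_zero_or_pos (a : ℕ) with ha | ha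
    · rw [bMat_mulVec_zero _ ha, ha, coeff_der_zero, add_zero]
    · obtain ⟨a', ha'⟩ : ∃ a' : Fin n, (a : ℕ) = a' + 1 :=
        ⟨⟨a - 1, by omega⟩, by simp; omega⟩
      rw [bMat_mulVec_succ _ ha', hda, ha', coeff_der_succ, add_comm]

omit [Algebra ℝ A] in
-- Deleting the first row and the last column leaves an upper triangular matrix with ones on the
-- diagonal, so only the cofactor sign survives.
lemma adjugate_last_zero {m : ℕ} (M : Matrix (Fin (m + 1)) (Fin (m + 1)) A)
    (h0 : ∀ a c : Fin (m + 1), (c : ℕ) + 1 < a → M a c = 0)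
    (h1 : ∀ a c : Fin (m + 1), (a : ℕ) = c + 1 → M a c = 1) :
    M.adjugate (Fin.last m) 0 = (-1) ^ m := by
  rw [Matrix.adjugate_fin_succ_eq_det_submatrix, Matrix.det_of_isUpperTriangular]
  · simp [h1]
  · intro a c hac
    refine h0 _ _ ?_
    simpa using hac

/-- The determinant of `f_{u,h}` in terms of the remainder of right division by `∂ + h`. -/
lemma det_btMat {n : ℕ} (hn : 2 ≤ n) (u : ℕ → A) (h : A) {S : A[X]} {r : A}
    (H : opOf n (star d n u h) = comp d S (lin h) + C r) (l : A) :
    (l • cornerMat n A + btMat d n u h).det = (-1) ^ (n - 1) * (l - r) := by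
  obtain ⟨m, rfl⟩ : ∃ m, n = m + 1 := ⟨n - 1, by omega⟩
  set f := l • cornerMat (m + 1) A + btMat d (m + 1) u h with hf
  have hS : ∀ p, S.natDegree + 1 = p → m + 1 < p → S = 0 := by
    intro p hp hmp
    have := coeff_comp_lin_natDegree d S h
    rw [← add_sub_cancel_right (comp d S (lin h)) (C r), ← H, coeff_sub, coeff_opOf,
      coeff_C_succ, if_neg (by omega), if_neg (by omega)] at this
    exact leadingCoeff_eq_zero.1 (by simpa using this.symm)
  have hdeg : S.natDegree < m + 1 := by
    by_contra hlt
    have := hS _ rfl (by omega)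
    rw [this] at hlt
    simp at hlt
  have hcomp : ∀ k, (comp d S (lin h)).coeff k
      = ∑ i ∈ Finset.range (m + 1), S.coeff i * ((der d)^[i] (lin h)).coeff k := by
    intro k
    rw [coeff_comp, sum_over_range' _ (by simp) _ hdeg]
  have htop : S.coeff m = 1 := by
    have h1 := hcomp (m + 1)
    rw [Finset.sum_range_succ, coeff_iterate_der_lin, Finset.sum_eq_zero, zero_add, mul_one] at h1
    · rw [← h1, ← add_sub_cancel_right (comp d S (lin h)) (C r), ← H, coeff_sub, coeff_opOf]
      simp
    · intro i hi
      rw [coeff_iterate_der_lin_of_lt d h (by have := Finset.mem_range.1 hi; omega), mul_zero]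
  -- `f` represents right multiplication by `∂ + h`, and `S(∂ + h)` equals `-r` modulo the operator
  -- of `h ∗ u`. The corner entry adds `l`, because `S` is monic of order `m = n - 1`.
  have hfs : f *ᵥ (fun c => S.coeff c) = Pi.single 0 (l - r) := by
    ext a
    have h1 : (f *ᵥ (fun c => S.coeff c)) a = ∑ c : Fin (m + 1),
        (S.coeff c * ((der d)^[(c : ℕ)] (lin h)).coeff a
          + if c = Fin.last m then
            (star d (m + 1) u h a + if (a : ℕ) = 0 then l else 0) else 0) := by
      rw [Matrix.mulVec, dotProduct]
      refine Finset.sum_congr rfl fun c _ => ?_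
      have hcl : c = Fin.last m ↔ (c : ℕ) + 1 = m + 1 := by
        rw [Fin.ext_iff]; simp
      by_cases hc : c = Fin.last m
      · subst hc
        by_cases ha : a = 0
        · simp [hf, btMat, cornerMat, ha, htop]; ring
        · simp [hf, btMat, cornerMat, ha, htop]
      · have hc' : ¬ (c : ℕ) = m := fun h => hc (hcl.2 (by omega))
        simp [hf, btMat, cornerMat, hc', hc, mul_comm]
    rw [h1, Finset.sum_add_distrib, ← Finset.sum_range (fun i => S.coeff i *
      ((der d)^[i] (lin h)).coeff a), ← hcomp,
      ← add_sub_cancel_right (comp d S (lin h)) (C r), ← H, coeff_sub, coeff_opOf]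
    have ha := a.2
    have hs : (if (a : ℕ) + 1 < m + 1 then star d (m + 1) u h a else 0)
        = star d (m + 1) u h a := by
      split_ifs with h2
      · rfl
      · rw [star_of_le d u h (by omega)]
    rw [hs, if_neg (by omega)]
    by_cases ha : a = 0
    · subst ha; simp; ring
    · simp [ha, coeff_C]
  have hadj := adjugate_last_zero f
    (by
      intro a c hac
      have : ¬ a = 0 := fun h => by simp [h] at hac
      simp [hf, btMat_apply_of_lt d u h hac, cornerMat, this])
    (by
      intro a c hac
      have : ¬ a = 0 := fun h => by simp [h] at hac
      simp [hf, btMat_apply_succ d u h hac, cornerMat, this])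
  -- Applying the adjugate and reading the last entry turns the left side into `det f`, since the
  -- last coefficient of `S` is `1`, and the right side into `l - r` times a known cofactor.
  have h2 := congrArg (fun v => (f.adjugate *ᵥ v) (Fin.last m)) hfs
  simp only [Matrix.mulVec_mulVec, Matrix.adjugate_mul, Matrix.smul_mulVec, Matrix.one_mulVec,
    Pi.smul_apply, Fin.val_last, htop, smul_eq_mul, mul_one, Matrix.mulVec_single,
    MulOpposite.smul_eq_mul_unop] at h2
  rw [h2]
  simp [hadj]

end CentralAffine

end

noncomputable section

namespace CentralAffine

/-! ### The principal gradation -/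

section Principal

variable {A : Type*} [CommRing A] {n : ℕ}

/-- The coefficient matrix of `λ^i`. -/
def laurentCoeff (i : ℤ) (M : Matrix (Fin n) (Fin n) (LaurentSeries A)) :
    Matrix (Fin n) (Fin n) A :=
  Matrix.of fun a c => HahnSeries.coeff (M a c) (-i)

/-- `M` has principal degree at most `m`, where `λ^i e_{ac}` has degree `n i + a - c`. -/
def PDeg (m : ℤ) (M : Matrix (Fin n) (Fin n) (LaurentSeries A)) : Prop :=
  ∀ (a c : Fin n) (i : ℤ), m < n * i + a - c → HahnSeries.coeff (M a c) (-i) = 0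

/-- The component of principal degree `m`, with `λ` specialised to `1`. -/
def lead (m : ℤ) (M : Matrix (Fin n) (Fin n) (LaurentSeries A)) : Matrix (Fin n) (Fin n) A :=
  Matrix.of fun a c =>
    if (n : ℤ) ∣ m - a + c then HahnSeries.coeff (M a c) (-((m - a + c) / n)) else 0

lemma lead_apply_of_eq (hn : 0 < n) {m i : ℤ} {M : Matrix (Fin n) (Fin n) (LaurentSeries A)}
    {a c : Fin n} (h : m = n * i + a - c) : lead m M a c = HahnSeries.coeff (M a c) (-i) := by
  have h1 : m - a + c = n * i := by omega
  have h2 : (n : ℤ) ≠ 0 := by omega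
  rw [lead, Matrix.of_apply, h1, if_pos (dvd_mul_right _ _), Int.mul_ediv_cancel_left _ h2]

lemma PDeg.mono {m m' : ℤ} {M : Matrix (Fin n) (Fin n) (LaurentSeries A)} (h : PDeg m M)
    (hm : m ≤ m') : PDeg m' M := fun a c i hi => h a c i (by omega)

lemma PDeg.lead_eq_zero {m m' : ℤ} {M : Matrix (Fin n) (Fin n) (LaurentSeries A)} (h : PDeg m M)
    (hm : m < m') : lead m' M = 0 := by
  ext a c
  rw [lead, Matrix.of_apply]
  split_ifs with h1
  · have := Int.mul_ediv_cancel' h1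
    exact h a c _ (by omega)
  · rfl

lemma PDeg.sub_one (hn : 0 < n) {m : ℤ} {M : Matrix (Fin n) (Fin n) (LaurentSeries A)}
    (h : PDeg m M) (h0 : lead m M = 0) : PDeg (m - 1) M := by
  intro a c i hi
  rcases eq_or_ne m (n * i + a - c) with h1 | h1
  · rw [← lead_apply_of_eq hn h1, h0]; rfl
  · exact h a c i (by omega)

/-- Degree estimates below all have this form: some bound exists (`exists_pDeg`), and it can be
lowered as long as the top component is shown to vanish. -/
lemma PDeg.descend (hn : 0 < n) {k m : ℤ} {M : Matrix (Fin n) (Fin n) (LaurentSeries A)}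
    (h : PDeg m M) (hs : ∀ m, k < m → PDeg m M → lead m M = 0) : PDeg k M := by
  have : ∀ r : ℕ, ∀ m, m ≤ k + r → PDeg m M → PDeg k M := by
    intro r
    induction r with
    | zero => intro m hm h; exact h.mono (by simpa using hm)
    | succ r ih =>
      intro m hm h
      by_cases hk : k < m
      · exact ih (m - 1) (by push_cast at hm; omega) (h.sub_one hn (hs m hk h))
      · exact h.mono (by omega)
  exact this (m - k).toNat m (by omega) h

lemma exists_pDeg (M : Matrix (Fin n) (Fin n) (LaurentSeries A)) : ∃ m, PDeg m M := by
  refine ⟨n * (∑ a, ∑ c, |(M a c).order|) + n, fun a c i hi => ?_⟩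
  refine HahnSeries.coeff_eq_zero_of_lt_order ?_
  have h1 : |(M a c).order| ≤ ∑ a, ∑ c, |(M a c).order| :=
    (Finset.single_le_sum (f := fun c => |(M a c).order|) (fun _ _ => abs_nonneg _)
      (Finset.mem_univ c)).trans
    (Finset.single_le_sum (f := fun a => ∑ c, |(M a c).order|)
      (fun _ _ => Finset.sum_nonneg fun _ _ => abs_nonneg _) (Finset.mem_univ a))
  have h2 := neg_abs_le (M a c).order
  have h3 : (n : ℤ) * (∑ a, ∑ c, |(M a c).order|) < n * i := by have := a.2; omega
  have h4 := lt_of_mul_lt_mul_left h3 (by omega)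
  omega

lemma eq_zero_of_pDeg {M : Matrix (Fin n) (Fin n) (LaurentSeries A)} (h : ∀ m, PDeg m M) :
    M = 0 := by
  ext a c i
  have := h (n * (-i) + a - c - 1) a c (-i) (by omega)
  simpa using this

lemma PDeg.add {m : ℤ} {M N : Matrix (Fin n) (Fin n) (LaurentSeries A)} (hM : PDeg m M)
    (hN : PDeg m N) : PDeg m (M + N) := fun a c i hi => by
  simp [hM a c i hi, hN a c i hi]

lemma PDeg.sub {m : ℤ} {M N : Matrix (Fin n) (Fin n) (LaurentSeries A)} (hM : PDeg m M)
    (hN : PDeg m N) : PDeg m (M - N) := fun a c i hi => by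
  simp [hM a c i hi, hN a c i hi]

lemma lead_add (m : ℤ) (M N : Matrix (Fin n) (Fin n) (LaurentSeries A)) :
    lead m (M + N) = lead m M + lead m N := by
  ext a c; simp only [lead, Matrix.of_apply, Matrix.add_apply]; split_ifs <;> simp

lemma lead_sub (m : ℤ) (M N : Matrix (Fin n) (Fin n) (LaurentSeries A)) :
    lead m (M - N) = lead m M - lead m N := by
  ext a c; simp only [lead, Matrix.of_apply, Matrix.sub_apply]; split_ifs <;> simp

lemma coeff_matrix_mul (M N : Matrix (Fin n) (Fin n) (LaurentSeries A)) (a c : Fin n) (i : ℤ) :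
    HahnSeries.coeff ((M * N) a c) i = ∑ b, HahnSeries.coeff (M a b * N b c) i := by
  rw [Matrix.mul_apply, HahnSeries.coeff_sum]

lemma PDeg.mul {m m' : ℤ} {M N : Matrix (Fin n) (Fin n) (LaurentSeries A)} (hM : PDeg m M)
    (hN : PDeg m' N) : PDeg (m + m') (M * N) := by
  intro a c i hi
  rw [coeff_matrix_mul]
  refine Finset.sum_eq_zero fun b _ => ?_
  rw [HahnSeries.coeff_mul]
  refine Finset.sum_eq_zero fun p hp => ?_
  have hp := (Finset.mem_antidiagonal.1 hp).2.2
  have hi' : i = -p.1 + -p.2 := by omega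
  subst hi'
  by_cases h : m < n * (-p.1) + a - b
  · have := hM a b _ h
    rw [neg_neg] at this
    rw [this, zero_mul]
  · have := hN b c (-p.2) (by rw [mul_add] at hi; omega)
    rw [neg_neg] at this
    rw [this, mul_zero]

lemma PDeg.lead_mul (hn : 0 < n) {m m' : ℤ} {M N : Matrix (Fin n) (Fin n) (LaurentSeries A)}
    (hM : PDeg m M) (hN : PDeg m' N) : lead (m + m') (M * N) = lead m M * lead m' N := by
  have hn0 : (n : ℤ) ≠ 0 := by omega
  ext a c
  rw [Matrix.mul_apply]
  by_cases hd : (n : ℤ) ∣ m + m' - a + c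
  · obtain ⟨i, hi⟩ := hd
    rw [lead_apply_of_eq hn (i := i) (by omega), coeff_matrix_mul]
    refine Finset.sum_congr rfl fun b _ => ?_
    -- In top degree only products of two top components survive: if one factor lies below its
    -- maximal degree, the other lies above its own and is zero. For each `b` at most one power of
    -- `λ` remains.
    have hterm : ∀ p : ℤ × ℤ, p.1 + p.2 = -i → ¬ (n : ℤ) * (-p.1) = m - a + b →
        (M a b).coeff p.1 * (N b c).coeff p.2 = 0 := by
      intro p hp hne
      have hi' : i = -p.1 + -p.2 := by omega
      subst hi'
      rw [mul_add] at hi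
      by_cases h : m < n * (-p.1) + a - b
      · have := hM a b _ h
        rw [neg_neg] at this
        rw [this, zero_mul]
      · have := hN b c (-p.2) (by omega)
        rw [neg_neg] at this
        rw [this, mul_zero]
    rw [HahnSeries.coeff_mul]
    by_cases hb : (n : ℤ) ∣ m - a + b
    · obtain ⟨k, hk⟩ := hb
      rw [lead_apply_of_eq hn (i := k) (by omega),
        lead_apply_of_eq hn (i := i - k) (by rw [mul_sub]; omega)]
      rw [Finset.sum_eq_single (-k, -(i - k))]
      · intro p hp hne
        have hp := (Finset.mem_antidiagonal.1 hp).2.2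
        refine hterm p hp fun h => hne ?_
        have : -p.1 = k := mul_left_cancel₀ hn0 (by rw [h, hk])
        ext <;> simp <;> omega
      · intro hp
        rw [Finset.mem_antidiagonal] at hp
        by_contra hne
        refine hp ⟨?_, ?_, ?_⟩
        · exact fun h => hne (by simp [h])
        · exact fun h => hne (by rw [h, mul_zero])
        · simp only; ring
    · have : lead m M a b = 0 := by simp [lead, hb]
      rw [this, zero_mul]
      refine Finset.sum_eq_zero fun p hp => ?_
      have hp := (Finset.mem_antidiagonal.1 hp).2.2
      exact hterm p hp fun h => hb ⟨_, h.symm⟩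
  · have h0 : lead (m + m') (M * N) a c = 0 := by
      rw [lead, Matrix.of_apply, if_neg hd]
    rw [h0]
    symm
    refine Finset.sum_eq_zero fun b _ => ?_
    simp only [lead, Matrix.of_apply]
    by_cases h1 : (n : ℤ) ∣ m - a + b
    · by_cases h2 : (n : ℤ) ∣ m' - b + c
      · refine absurd ?_ hd
        have := dvd_add h1 h2
        rwa [show m - a + b + (m' - b + c) = m + m' - a + c by ring] at this
      · rw [if_neg h2, mul_zero]
    · rw [if_neg h1, zero_mul]

lemma eq_of_dvd_sub {a c : Fin n} (h : (n : ℤ) ∣ (c : ℤ) - a) : a = c := by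
  have := Int.eq_zero_of_abs_lt_dvd h (by rw [abs_lt]; have := a.2; have := c.2; omega)
  exact Fin.ext (by omega)

lemma pDeg_one : PDeg 0 (1 : Matrix (Fin n) (Fin n) (LaurentSeries A)) := by
  intro a c i hi
  rw [Matrix.one_apply]
  split_ifs with h
  · subst h
    rw [HahnSeries.coeff_one, if_neg]
    rintro h
    obtain rfl : i = 0 := by omega
    simp at hi
  · rfl

lemma lead_one : lead 0 (1 : Matrix (Fin n) (Fin n) (LaurentSeries A)) = 1 := by
  ext a c
  rw [lead, Matrix.of_apply, Matrix.one_apply, Matrix.one_apply]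
  by_cases h : a = c
  · subst h
    simp
  · rw [if_neg h, if_neg h]; simp

lemma PDeg.pow (hn : 0 < n) {m : ℤ} {M : Matrix (Fin n) (Fin n) (LaurentSeries A)}
    (hM : PDeg m M) (k : ℕ) : PDeg (k * m) (M ^ k) ∧ lead (k * m) (M ^ k) = lead m M ^ k := by
  induction k with
  | zero => simpa using ⟨pDeg_one, lead_one⟩
  | succ k ih =>
    rw [pow_succ, pow_succ, show ((k + 1 : ℕ) : ℤ) * m = k * m + m by push_cast; ring]
    exact ⟨ih.1.mul hM, by rw [ih.1.lead_mul hn hM, ih.2]⟩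

/-- The homogeneous matrix of principal degree `m` with constant entry `x`. -/
def homMat (n : ℕ) (m : ℤ) (x : A) : Matrix (Fin n) (Fin n) A :=
  Matrix.of fun a c => if (n : ℤ) ∣ m - a + c then x else 0

lemma homMat_mul (hn : 0 < n) (m m' : ℤ) (x y : A) :
    homMat n m x * homMat n m' y = homMat n (m + m') (x * y) := by
  ext a c
  have hn0 : (n : ℤ) ≠ 0 := by omega
  have hb0 := Int.emod_nonneg (a - m) hn0
  have hb1 := Int.emod_lt_of_pos (a - m) (show (0 : ℤ) < n by omega)
  obtain ⟨b, hb⟩ : ∃ b : Fin n, (n : ℤ) ∣ m - a + b := by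
    refine ⟨⟨((a - m) % n).toNat, by omega⟩, ?_⟩
    simp only [Int.toNat_of_nonneg hb0]
    have := Int.emod_add_mul_ediv (a - m) n
    exact ⟨-((a - m) / n), by rw [mul_neg]; omega⟩
  rw [Matrix.mul_apply, Finset.sum_eq_single b]
  · have : ((n : ℤ) ∣ m' - b + c) ↔ (n : ℤ) ∣ m + m' - a + c := by
      rw [show m + m' - a + c = (m' - b + c) + (m - a + b) by ring]
      exact (dvd_add_left hb).symm
    simp only [homMat, Matrix.of_apply, if_pos hb, this, mul_ite, mul_zero]
  · intro b' _ hne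
    have : ¬ (n : ℤ) ∣ m - a + b' := fun h => hne (eq_of_dvd_sub (by
      have := dvd_sub hb h
      rwa [show m - a + b - (m - a + b') = (b : ℤ) - b' by ring] at this))
    simp [homMat, this]
  · simp

lemma homMat_zero_one : homMat n 0 (1 : A) = 1 := by
  ext a c
  rw [homMat, Matrix.of_apply, Matrix.one_apply]
  congr 1
  refine propext ⟨fun h => eq_of_dvd_sub (by rwa [show (0 : ℤ) - a + c = c - a by ring] at h), ?_⟩
  rintro rfl
  simp

lemma homMat_pow (hn : 0 < n) (m : ℤ) (x : A) (k : ℕ) :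
    homMat n m x ^ k = homMat n (k * m) (x ^ k) := by
  induction k with
  | zero => simp [homMat_zero_one]
  | succ k ih =>
    rw [pow_succ, ih, homMat_mul hn, pow_succ]
    congr 1
    push_cast; ring

lemma homMat_mul_neg (hn : 0 < n) (m : ℤ) : homMat n m (1 : A) * homMat n (-m) 1 = 1 := by
  rw [homMat_mul hn, add_neg_cancel, mul_one, homMat_zero_one]

/-- A homogeneous matrix commuting with the cyclic permutation matrix is a multiple of one of its
powers. -/
lemma eq_homMat_of_commute (hn : 0 < n) {m : ℤ} {l : Matrix (Fin n) (Fin n) A}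
    (hl : ∀ a c : Fin n, ¬ (n : ℤ) ∣ m - a + c → l a c = 0)
    (hc : homMat n 1 1 * l = l * homMat n 1 1) : ∃ x, l = homMat n m x := by
  -- Dividing by the `m`-th power of the cyclic matrix reduces to degree zero, where homogeneous
  -- means diagonal. Commuting with the cyclic matrix then equates neighbouring diagonal entries.
  set D := homMat n (-m) 1 * l with hD
  have hDc : homMat n 1 1 * D = D * homMat n 1 1 := by
    rw [hD, ← mul_assoc, homMat_mul hn, add_comm, ← homMat_mul hn, mul_assoc, hc, mul_assoc]
  have hDd : ∀ a c, a ≠ c → D a c = 0 := by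
    intro a c hac
    rw [hD, Matrix.mul_apply]
    refine Finset.sum_eq_zero fun b _ => ?_
    by_cases h1 : (n : ℤ) ∣ -m - a + b
    · rw [hl b c, mul_zero]
      intro h2
      refine hac (eq_of_dvd_sub ?_)
      have := dvd_add h1 h2
      rwa [show -m - a + b + (m - b + c) = (c : ℤ) - a by ring] at this
    · simp [homMat, h1]
  have hstep : ∀ a c : Fin n, (a : ℕ) = c + 1 → D a a = D c c := by
    intro a c hac
    have h1 := congrFun (congrFun hDc a) c
    have h2 : homMat n 1 (1 : A) a c = 1 := by
      simp [homMat, hac]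
    rw [Matrix.mul_apply, Matrix.mul_apply, Finset.sum_eq_single c, Finset.sum_eq_single a, h2,
      one_mul, mul_one] at h1
    · exact h1.symm
    · intro b _ hb; rw [hDd a b hb.symm, zero_mul]
    · simp
    · intro b _ hb; rw [hDd b c hb, mul_zero]
    · simp
  have hconst : ∀ (k : ℕ) (hk : k < n), D ⟨k, hk⟩ ⟨k, hk⟩ = D ⟨0, hn⟩ ⟨0, hn⟩ := by
    intro k
    induction k with
    | zero => intro _; rfl
    | succ k ih => intro hk; rw [hstep ⟨k + 1, hk⟩ ⟨k, by omega⟩ rfl, ih]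
  refine ⟨D ⟨0, hn⟩ ⟨0, hn⟩, ?_⟩
  have hDx : D = homMat n 0 (D ⟨0, hn⟩ ⟨0, hn⟩) := by
    ext a c
    by_cases hac : a = c
    · subst hac
      rw [hconst a a.2]; simp [homMat]
    · rw [hDd a c hac, homMat, Matrix.of_apply, if_neg]
      intro h
      exact hac (eq_of_dvd_sub (by rwa [show (0 : ℤ) - a + c = c - a by ring] at h))
  have : l = homMat n m 1 * D := by
    rw [hD, ← mul_assoc, homMat_mul_neg hn, one_mul]
  rw [this, hDx, homMat_mul hn, add_zero, one_mul]
  simp [homMat]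

lemma lead_eq_homMat_of_commute (hn : 0 < n) {m : ℤ}
    {M : Matrix (Fin n) (Fin n) (LaurentSeries A)}
    (hc : homMat n 1 1 * lead m M = lead m M * homMat n 1 1) : ∃ x, lead m M = homMat n m x :=
  eq_homMat_of_commute hn (fun a c h => by rw [lead, Matrix.of_apply, if_neg h]) hc

/-- The spectral parameter over a general ring. -/
def lamOf (A : Type*) [CommRing A] : LaurentSeries A := HahnSeries.single (-1 : ℤ) (1 : A)

/-- `λ e_{1n} + M`. -/
def withLam (M : Matrix (Fin n) (Fin n) A) : Matrix (Fin n) (Fin n) (LaurentSeries A) :=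
  lamOf A • cornerMat n (LaurentSeries A) + M.map (fun r => (HahnSeries.C r : LaurentSeries A))

lemma coeff_withLam (M : Matrix (Fin n) (Fin n) A) (a c : Fin n) (i : ℤ) :
    HahnSeries.coeff (withLam M a c) (-i)
      = (if i = 1 ∧ (a : ℕ) = 0 ∧ (c : ℕ) + 1 = n then 1 else 0) + if i = 0 then M a c else 0 := by
  have h1 : (-i = -1) ↔ i = 1 := by omega
  simp only [withLam, cornerMat, lamOf, Matrix.add_apply, Matrix.smul_apply, Matrix.of_apply,
    Matrix.map_apply, HahnSeries.coeff_add, HahnSeries.C_apply, HahnSeries.coeff_single,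
    neg_eq_zero, smul_eq_mul]
  congr 1
  by_cases h : (a : ℕ) = 0 ∧ (c : ℕ) + 1 = n
  · simp [h, HahnSeries.coeff_single, h1]
  · rw [if_neg h, mul_zero, if_neg (fun h' => h h'.2)]; rfl

lemma pDeg_withLam {M : Matrix (Fin n) (Fin n) A}
    (h0 : ∀ a c : Fin n, (c : ℕ) + 1 < a → M a c = 0) : PDeg 1 (withLam M) := by
  intro a c i hi
  rw [coeff_withLam, if_neg, zero_add]
  · split_ifs with h
    · subst h
      exact h0 a c (by omega)
    · rfl
  · rintro ⟨rfl, h1, h2⟩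
    omega

lemma lead_withLam (hn : 2 ≤ n) {M : Matrix (Fin n) (Fin n) A}
    (h1 : ∀ a c : Fin n, (a : ℕ) = c + 1 → M a c = 1) : lead 1 (withLam M) = homMat n 1 1 := by
  ext a c
  by_cases h : (n : ℤ) ∣ 1 - a + c
  · have hh : homMat n 1 (1 : A) a c = 1 := by rw [homMat, Matrix.of_apply, if_pos h]
    obtain ⟨i, hi⟩ := h
    rw [lead_apply_of_eq (by omega) (i := i) (by omega), coeff_withLam, hh]
    have ha := a.2
    have hc := c.2
    have hi1 : i < 2 := by
      by_contra hlt
      have : (n : ℤ) * 2 ≤ n * i := mul_le_mul_of_nonneg_left (by omega) (by omega)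
      omega
    have hi0 : -1 < i := by
      by_contra hlt
      have : (n : ℤ) * i ≤ n * (-1) := mul_le_mul_of_nonneg_left (by omega) (by omega)
      omega
    obtain rfl | rfl : i = 0 ∨ i = 1 := by omega
    · rw [if_neg (by simp), h1 a c (by omega)]; simp
    · rw [if_pos (by omega)]; simp
  · rw [lead, homMat, Matrix.of_apply, Matrix.of_apply, if_neg h, if_neg h]

lemma lead_lam_eq_zero {m : ℤ} (hm : (n : ℤ) < m) :
    lead m (lamOf A • (1 : Matrix (Fin n) (Fin n) (LaurentSeries A))) = 0 := by
  refine PDeg.lead_eq_zero (m := n) ?_ hm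
  intro a c i hi
  rw [Matrix.smul_apply, Matrix.one_apply]
  split_ifs with h
  · subst h
    rw [smul_eq_mul, mul_one, lamOf, HahnSeries.coeff_single, if_neg]
    intro h
    obtain rfl : i = 1 := by omega
    simp at hi
  · simp

end Principal

/-! ### The Drinfeld–Sokolov series over a differential ring -/

section Derivations

variable {A : Type*} [CommRing A] [Algebra ℝ A]

lemma map_matrix_mul_of_leibniz {B : Type*} [CommRing B] (δ : B →+ B)
    (hδ : ∀ x y, δ (x * y) = δ x * y + x * δ y)
    {l m n : Type*} [Fintype m] (M : Matrix l m B) (N : Matrix m n B) :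
    (M * N).map δ = M.map δ * N + M * N.map δ := by
  ext a c
  simp only [Matrix.map_apply, Matrix.mul_apply, map_sum, hδ, Matrix.add_apply,
    ← Finset.sum_add_distrib]

variable (d : Derivation ℝ A A)

lemma map_matrix_mul {l m n : Type*} [Fintype m] (M : Matrix l m A) (N : Matrix m n A) :
    (M * N).map d = M.map d * N + M * N.map d :=
  map_matrix_mul_of_leibniz (d : A →ₗ[ℝ] A).toAddMonoidHom
    (fun x y => by
      change d (x * y) = d x * y + x * d y
      rw [d.leibniz, smul_eq_mul, smul_eq_mul]; ring) M N

lemma map_matrix_one {m : Type*} [DecidableEq m] : (1 : Matrix m m A).map d = 0 := by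
  ext a c
  rw [Matrix.map_apply, Matrix.one_apply]
  split_ifs <;> simp

/-- The coefficientwise extension of a derivation to Laurent series. -/
def laurentDer : LaurentSeries A →+ LaurentSeries A where
  toFun x := HahnSeries.map x d
  map_zero' := by ext i; simp
  map_add' x y := by ext i; simp

@[simp]
lemma coeff_laurentDer (x : LaurentSeries A) (i : ℤ) :
    HahnSeries.coeff (laurentDer d x) i = d (HahnSeries.coeff x i) := rfl

lemma laurentDer_mul (x y : LaurentSeries A) :
    laurentDer d (x * y) = laurentDer d x * y + x * laurentDer d y := by
  ext i
  -- The supports only shrink, so all three products can be summed over the same finite set of index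
  -- pairs.
  have hs : ∀ x, (laurentDer d x).support ⊆ x.support := fun x k hk h => hk (by
    rw [coeff_laurentDer, h, map_zero])
  rw [coeff_laurentDer, HahnSeries.coeff_add, HahnSeries.coeff_mul,
    HahnSeries.coeff_mul_right' y.isPWO_support (hs y),
    HahnSeries.coeff_mul_left' x.isPWO_support (hs x), map_sum, ← Finset.sum_add_distrib]
  refine Finset.sum_congr rfl fun p _ => ?_
  simp only [Derivation.leibniz, smul_eq_mul, coeff_laurentDer]
  ring

lemma map_laurentDer_mul {l m n : Type*} [Fintype m] (M : Matrix l m (LaurentSeries A))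
    (N : Matrix m n (LaurentSeries A)) :
    (M * N).map (laurentDer d) = M.map (laurentDer d) * N + M * N.map (laurentDer d) :=
  map_matrix_mul_of_leibniz _ (laurentDer_mul d) M N

lemma map_laurentDer_one {m : Type*} [DecidableEq m] :
    (1 : Matrix m m (LaurentSeries A)).map (laurentDer d) = 0 := by
  ext a c i
  rw [Matrix.map_apply, coeff_laurentDer, Matrix.one_apply]
  split_ifs
  · rw [HahnSeries.coeff_one]; split_ifs <;> simp
  · simp

variable {n : ℕ}

lemma PDeg.laurentDer {m : ℤ} {M : Matrix (Fin n) (Fin n) (LaurentSeries A)} (h : PDeg m M) :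
    PDeg m (M.map (laurentDer d)) := fun a c i hi => by
  rw [Matrix.map_apply, coeff_laurentDer, h a c i hi, map_zero]

omit [Algebra ℝ A] in
lemma lead_compMat (hn : 2 ≤ n) (u : ℕ → A) :
    PDeg 1 (withLam (compMat n u)) ∧ lead 1 (withLam (compMat n u)) = homMat n 1 1 := by
  refine ⟨pDeg_withLam fun a c h => ?_, lead_withLam hn fun a c h => ?_⟩
  · have h1 : ¬ (a : ℕ) = c + 1 := by omega
    have h2 : ¬ (c : ℕ) + 1 = n := by have := a.2; omega
    simp [compMat, bMat, curvMat, h1, h2]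
  · have h2 : ¬ (c : ℕ) + 1 = n := by have := a.2; omega
    simp [compMat, bMat, curvMat, h, h2]

lemma lead_btMat (hn : 2 ≤ n) (u : ℕ → A) (h : A) :
    PDeg 1 (withLam (btMat d n u h)) ∧ lead 1 (withLam (btMat d n u h)) = homMat n 1 1 :=
  ⟨pDeg_withLam fun _ _ => btMat_apply_of_lt d u h,
    lead_withLam hn fun _ _ => btMat_apply_succ d u h⟩

/-- `Y` is the series `Y(u, λ)` over the differential ring `A`. -/
structure IsSeries (u : ℕ → A) (Y : Matrix (Fin n) (Fin n) (LaurentSeries A)) : Prop where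
  trace_zero : Y.trace = 0
  degree_le : ∀ i : ℤ, 1 < i → laurentCoeff i Y = 0
  leading : laurentCoeff 1 Y = cornerMat n A
  commute : Y.map (laurentDer d) + withLam (compMat n u) * Y - Y * withLam (compMat n u) = 0
  pow_eq : Y ^ n = lamOf A • 1

variable {d}

/-- The top component of a solution of the linearised equation commutes with the cyclic matrix. -/
lemma lead_commute_of_commute (hn : 2 ≤ n) {u : ℕ → A} {m : ℤ}
    {E : Matrix (Fin n) (Fin n) (LaurentSeries A)}
    (hE : E.map (laurentDer d) + withLam (compMat n u) * E - E * withLam (compMat n u) = 0)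
    (hm : PDeg m E) : homMat n 1 1 * lead m E = lead m E * homMat n 1 1 := by
  obtain ⟨h1, h2⟩ := lead_compMat hn u
  have h3 := congrArg (lead (m + 1)) hE
  have h0 : lead (1 + m) (0 : Matrix (Fin n) (Fin n) (LaurentSeries A)) = 0 := by
    ext a c; simp [lead]
  rw [lead_sub, lead_add, (hm.laurentDer d).lead_eq_zero (by omega), zero_add,
    hm.lead_mul (by omega) h1, add_comm m 1, h1.lead_mul (by omega) hm, h2, h0] at h3
  exact sub_eq_zero.1 h3

/-- `Y(u, λ) = J + ` terms of lower principal degree. -/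
lemma IsSeries.principal [IsReduced A] (hn : 2 ≤ n) {u : ℕ → A}
    {Y : Matrix (Fin n) (Fin n) (LaurentSeries A)} (hY : IsSeries d u Y) :
    PDeg 1 Y ∧ lead 1 Y = homMat n 1 1 := by
  have hn0 : 0 < n := by omega
  have key : ∀ m, PDeg m Y → ∃ x, lead m Y = homMat n m x := fun m hm =>
    lead_eq_homMat_of_commute hn0 (lead_commute_of_commute hn hY.commute hm)
  have h1 : PDeg 1 Y := by
    obtain ⟨m, hm⟩ := exists_pDeg Y
    -- A top component `x` times the `m`-th power of the cyclic matrix with `m > 1` would give `Y^n`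
    -- the top coefficient `x^n` in degree `n m > n`. But `λ I` has degree `n`, so `x^n = 0`, and
    -- reducedness gives `x = 0`.
    refine hm.descend hn0 fun m hm1 hm => ?_
    obtain ⟨x, hx⟩ := key m hm
    have h2 := (hm.pow hn0 n).2
    have h3 : (n : ℤ) < n * m := by
      have : (n : ℤ) * 1 < n * m := mul_lt_mul_of_pos_left hm1 (by omega)
      omega
    rw [hY.pow_eq, lead_lam_eq_zero h3, hx, homMat_pow hn0] at h2
    have h4 := congrFun (congrFun h2 ⟨0, hn0⟩) ⟨0, hn0⟩
    have h5 : x ^ n = 0 := by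
      simpa [homMat] using h4.symm
    rw [hx, eq_zero_of_pow_eq_zero h5]
    ext a c; simp [homMat]
  refine ⟨h1, ?_⟩
  obtain ⟨x, hx⟩ := key 1 h1
  have h2 := congrFun (congrFun hY.leading ⟨0, hn0⟩) ⟨n - 1, by omega⟩
  have h3 : lead 1 Y ⟨0, hn0⟩ ⟨n - 1, by omega⟩ = HahnSeries.coeff (Y ⟨0, hn0⟩ ⟨n - 1, by omega⟩)
      (-1) := lead_apply_of_eq hn0 (by simp; omega)
  rw [laurentCoeff, Matrix.of_apply, ← h3, hx] at h2
  have h4 : (n : ℤ) ∣ 1 + ((n - 1 : ℕ) : ℤ) := ⟨1, by omega⟩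
  have h5 : n - 1 + 1 = n := by omega
  have h6 : x = 1 := by simpa [homMat, cornerMat, h4, h5] using h2
  rw [hx, h6]

omit [Algebra ℝ A] in
-- The differential of the power map at `P`: since `l` commutes with `P`, the terms `P^i l P^{k-i}`
-- coincide and there are `k + 1` of them. It serves to linearise `Y^n = λ I`.
lemma PDeg.lead_pow_sub_pow (hn : 0 < n) {m : ℤ}
    {Y Y' : Matrix (Fin n) (Fin n) (LaurentSeries A)} {P l : Matrix (Fin n) (Fin n) A}
    (hY : PDeg 1 Y) (hY' : PDeg 1 Y') (hP : lead 1 Y = P) (hP' : lead 1 Y' = P)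
    (hE : PDeg m (Y - Y')) (hl : lead m (Y - Y') = l) (hc : P * l = l * P) (k : ℕ) :
    PDeg (k + m) (Y ^ (k + 1) - Y' ^ (k + 1)) ∧
      lead (k + m) (Y ^ (k + 1) - Y' ^ (k + 1)) = (k + 1 : ℕ) • (l * P ^ k) := by
  induction k with
  | zero => simpa using ⟨hE, hl⟩
  | succ k ih =>
    have h1 : Y ^ (k + 1 + 1) - Y' ^ (k + 1 + 1)
        = Y ^ (k + 1) * (Y - Y') + (Y ^ (k + 1) - Y' ^ (k + 1)) * Y' := by
      rw [pow_succ Y (k + 1), pow_succ Y' (k + 1)]; noncomm_ring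
    obtain ⟨h2, h3⟩ := hY.pow hn (k + 1)
    have e1 : (((k + 1 : ℕ) : ℤ)) * 1 + m = (k + 1 : ℕ) + m := by ring
    have e2 : ((k : ℤ) + m) + 1 = (k + 1 : ℕ) + m := by push_cast; ring
    have h4 := h2.mul hE
    have h5 := ih.1.mul hY'
    have h6 := h2.lead_mul hn hE
    have h7 := ih.1.lead_mul hn hY'
    rw [e1] at h4 h6
    rw [e2] at h5 h7
    have hcp : P ^ (k + 1) * l = l * P ^ (k + 1) := (Commute.pow_left hc (k + 1))
    rw [h1]
    refine ⟨h4.add h5, ?_⟩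
    rw [lead_add, h6, h7, h3, ih.2, hP, hP', hl, hcp, smul_mul_assoc, mul_assoc, ← pow_succ,
      succ_nsmul _ (k + 1), add_comm]

/-- Uniqueness of `Y(u, λ)`. -/
lemma IsSeries.unique [IsReduced A] (hn : 2 ≤ n) {u : ℕ → A}
    {Y Y' : Matrix (Fin n) (Fin n) (LaurentSeries A)} (hY : IsSeries d u Y)
    (hY' : IsSeries d u Y') : Y = Y' := by
  have hn0 : 0 < n := by omega
  obtain ⟨h1, h2⟩ := hY.principal hn
  obtain ⟨h1', h2'⟩ := hY'.principal hn
  have hE : (Y - Y').map (laurentDer d) + withLam (compMat n u) * (Y - Y')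
      - (Y - Y') * withLam (compMat n u) = 0 := by
    have e : (Y - Y').map (laurentDer d) = Y.map (laurentDer d) - Y'.map (laurentDer d) := by
      ext a c; simp
    have := congrArg₂ (· - ·) hY.commute hY'.commute
    simp only [sub_zero] at this
    rw [e, mul_sub, sub_mul, ← this]
    abel
  refine sub_eq_zero.1 (eq_zero_of_pDeg fun k => ?_)
  rcases le_or_gt 1 k with hk | hk
  · exact (h1.sub h1').mono hk
  refine (h1.sub h1').descend hn0 (k := k) fun m hkm hm => ?_
  rcases lt_or_ge 1 m with hm1 | hm1
  · exact (h1.sub h1').lead_eq_zero hm1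
  have hc := lead_commute_of_commute hn hE hm
  obtain ⟨n', rfl⟩ : ∃ n', n = n' + 1 := ⟨n - 1, by omega⟩
  -- The equal `n`-th powers give `n · l P^{n-1} = 0` for the top component `l` of `Y - Y'`. The
  -- cyclic matrix `P` and the integer `n` are invertible, so `l = 0`; this repeats in every degree.
  have h3 := (PDeg.lead_pow_sub_pow hn0 h1 h1' h2 h2' hm rfl hc n').2
  have h0 : ∀ m, lead m (0 : Matrix (Fin (n' + 1)) (Fin (n' + 1)) (LaurentSeries A)) = 0 := by
    intro m; ext a c; simp [lead]
  rw [hY.pow_eq, hY'.pow_eq, sub_self, h0, homMat_pow hn0] at h3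
  have h4 := congrArg (fun M => M * homMat (n' + 1) (-(n' * 1)) (1 : A)) h3
  simp only [zero_mul, smul_mul_assoc, mul_assoc, one_pow, homMat_mul_neg hn0, mul_one] at h4
  have h5 : ((n' + 1 : ℕ) : ℝ) ≠ 0 := by positivity
  ext a c
  have h6 := congrFun (congrFun h4 a) c
  rw [Matrix.smul_apply, ← Nat.cast_smul_eq_nsmul ℝ] at h6
  have h7 := congrArg (fun x => ((n' + 1 : ℕ) : ℝ)⁻¹ • x) h6
  simp only [smul_smul, inv_mul_cancel₀ h5, one_smul, Matrix.zero_apply, smul_zero] at h7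
  exact h7.symm

/-- Gauge transformations by matrices with leading term `J` preserve the defining properties of
`Y(u, λ)`. -/
lemma IsSeries.conj [IsReduced A] (hn : 2 ≤ n) {u v : ℕ → A}
    {Y F G : Matrix (Fin n) (Fin n) (LaurentSeries A)} (hY : IsSeries d u Y)
    (hF : PDeg 1 F) (hF' : lead 1 F = homMat n 1 1) (hFG : F * G = 1)
    (hFd : F.map (laurentDer d)
      = F * withLam (compMat n u) - withLam (compMat n v) * F) :
    IsSeries d v (F * Y * G) := by
  have hn0 : 0 < n := by omega
  have hGF : G * F = 1 := mul_eq_one_comm.1 hFG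
  obtain ⟨h1, h2⟩ := hY.principal hn
  have hPI : ∀ M : Matrix (Fin n) (Fin n) A, M * homMat n 1 1 * homMat n (-1) 1 = M := by
    intro M; rw [mul_assoc, homMat_mul_neg hn0, mul_one]
  have hYF : F * Y * G * F = F * Y := by rw [mul_assoc, hGF, mul_one]
  -- The degree of `G` is never needed: multiplying by `F` on the right turns `F Y G` into `F Y`, of
  -- degree at most `2`, and the leading term of `F` is invertible.
  have hdeg : PDeg 1 (F * Y * G) := by
    obtain ⟨m, hm⟩ := exists_pDeg (F * Y * G)
    refine hm.descend hn0 fun m hm1 hm => ?_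
    have h3 := hm.lead_mul hn0 hF
    rw [hYF, (hF.mul h1).lead_eq_zero (by omega), hF'] at h3
    rw [← hPI (lead m (F * Y * G)), ← h3, zero_mul]
  have hlead : lead 1 (F * Y * G) = homMat n 1 1 := by
    have h3 := hdeg.lead_mul hn0 hF
    rw [hYF, hF.lead_mul hn0 h1, hF', h2] at h3
    rw [← hPI (lead 1 (F * Y * G)), ← h3, hPI]
  refine ⟨?_, ?_, ?_, ?_, ?_⟩
  · rw [mul_assoc, Matrix.trace_mul_comm, mul_assoc, hGF, mul_one, hY.trace_zero]
  · intro i hi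
    ext a c
    refine hdeg a c i ?_
    have : (n : ℤ) * 2 ≤ n * i := mul_le_mul_of_nonneg_left (by omega) (by omega)
    have := a.2
    have := c.2
    omega
  · ext a c
    rw [laurentCoeff, Matrix.of_apply, cornerMat, Matrix.of_apply]
    have ha := a.2
    have hc := c.2
    split_ifs with h
    · have h3 : lead 1 (F * Y * G) a c = HahnSeries.coeff ((F * Y * G) a c) (-1) :=
        lead_apply_of_eq hn0 (by omega)
      rw [← h3, hlead, homMat, Matrix.of_apply, if_pos ⟨1, by omega⟩]
    · exact hdeg a c 1 (by omega)
  · have hG : G.map (laurentDer d) = - (G * F.map (laurentDer d) * G) := by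
      have h3 := map_laurentDer_mul d G F
      rw [hGF, map_laurentDer_one] at h3
      have h4 := congrArg (fun M => M * G) h3
      simp only [zero_mul, add_mul, mul_assoc, hFG, mul_one] at h4
      rw [eq_neg_iff_add_eq_zero, mul_assoc, ← h4]
    have hc := hY.commute
    have hYd : Y.map (laurentDer d)
        = Y * withLam (compMat n u) - withLam (compMat n u) * Y := by
      rw [← sub_eq_zero, ← hc]; abel
    rw [map_laurentDer_mul, map_laurentDer_mul, hG, hFd, hYd]
    have e1 : ∀ M, G * (F * M) = M := fun M => by rw [← mul_assoc, hGF, one_mul]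
    simp only [mul_sub, sub_mul, mul_neg, add_mul, mul_assoc, hFG, e1, mul_one]
    abel
  · have h3 : ∀ k, (F * Y * G) ^ k = F * Y ^ k * G := by
      intro k
      induction k with
      | zero => simp [hFG]
      | succ k ih =>
        rw [pow_succ, ih, pow_succ]
        have e1 : ∀ M, G * (F * M) = M := fun M => by rw [← mul_assoc, hGF, one_mul]
        simp only [mul_assoc, e1]
    rw [h3, hY.pow_eq, mul_smul_comm, smul_mul_assoc, mul_one, hFG]

end Derivations

end CentralAffine

end

noncomputable section

namespace CentralAffine

/-! ### The flow matrices and zero curvature -/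

section Corner

variable {A : Type*} [CommRing A] {n : ℕ}

lemma cornerMat_mul_apply (M : Matrix (Fin n) (Fin n) A) (a c : Fin n) {l : Fin n}
    (hl : (l : ℕ) + 1 = n) : (cornerMat n A * M) a c = if (a : ℕ) = 0 then M l c else 0 := by
  rw [Matrix.mul_apply, Finset.sum_eq_single l]
  · simp [cornerMat, hl]
  · intro k _ hk
    have : ¬ (k : ℕ) + 1 = n := fun h => hk (Fin.ext (by omega))
    simp [cornerMat, this]
  · simp

lemma mul_cornerMat_apply (M : Matrix (Fin n) (Fin n) A) (a c : Fin n) {z : Fin n}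
    (hz : (z : ℕ) = 0) : (M * cornerMat n A) a c = if (c : ℕ) + 1 = n then M a z else 0 := by
  rw [Matrix.mul_apply, Finset.sum_eq_single z]
  · simp [cornerMat, hz]
  · intro k _ hk
    have : ¬ (k : ℕ) = 0 := fun h => hk (Fin.ext (by omega))
    simp [cornerMat, this]
  · simp

lemma map_cornerMat {R S : Type*} [CommRing R] [CommRing S] (φ : R →+* S) :
    (cornerMat n R).map φ = cornerMat n S := by
  ext a c; simp only [cornerMat, Matrix.map_apply, Matrix.of_apply]; split_ifs <;> simp

lemma withLam_eq (M : Matrix (Fin n) (Fin n) A) :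
    withLam M = lamOf A • (cornerMat n A).map (HahnSeries.C : A →+* LaurentSeries A)
      + M.map (HahnSeries.C : A →+* LaurentSeries A) := by
  rw [map_cornerMat]; rfl

lemma laurentCoeff_withLam_mul (M : Matrix (Fin n) (Fin n) A)
    (X : Matrix (Fin n) (Fin n) (LaurentSeries A)) (i : ℤ) :
    laurentCoeff i (withLam M * X)
      = cornerMat n A * laurentCoeff (i - 1) X + M * laurentCoeff i X := by
  ext a c
  rw [laurentCoeff, Matrix.of_apply, coeff_matrix_mul, Matrix.add_apply, Matrix.mul_apply,
    Matrix.mul_apply, ← Finset.sum_add_distrib]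
  refine Finset.sum_congr rfl fun b _ => ?_
  rw [withLam_eq, Matrix.add_apply, Matrix.smul_apply, Matrix.map_apply, Matrix.map_apply,
    smul_eq_mul, add_mul, HahnSeries.coeff_add, lamOf, HahnSeries.C_apply, HahnSeries.C_apply,
    mul_assoc, HahnSeries.coeff_single_zero_mul, HahnSeries.coeff_single_mul, one_mul,
    HahnSeries.coeff_single_zero_mul, laurentCoeff, laurentCoeff, Matrix.of_apply,
    Matrix.of_apply, show -i - -1 = -(i - 1) by ring]

lemma laurentCoeff_mul_withLam (M : Matrix (Fin n) (Fin n) A)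
    (X : Matrix (Fin n) (Fin n) (LaurentSeries A)) (i : ℤ) :
    laurentCoeff i (X * withLam M)
      = laurentCoeff (i - 1) X * cornerMat n A + laurentCoeff i X * M := by
  ext a c
  rw [laurentCoeff, Matrix.of_apply, coeff_matrix_mul, Matrix.add_apply, Matrix.mul_apply,
    Matrix.mul_apply, ← Finset.sum_add_distrib]
  refine Finset.sum_congr rfl fun b _ => ?_
  rw [mul_comm (X a b), withLam_eq, Matrix.add_apply, Matrix.smul_apply, Matrix.map_apply,
    Matrix.map_apply,
    smul_eq_mul, add_mul, HahnSeries.coeff_add, lamOf, HahnSeries.C_apply, HahnSeries.C_apply,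
    mul_assoc, HahnSeries.coeff_single_zero_mul, HahnSeries.coeff_single_mul, one_mul,
    HahnSeries.coeff_single_zero_mul, laurentCoeff, laurentCoeff, Matrix.of_apply,
    Matrix.of_apply, show -i - -1 = -(i - 1) by ring, mul_comm (M b c), mul_comm (cornerMat n A b c)]

lemma compMat_mul_apply_succ {u : ℕ → A} (M : Matrix (Fin n) (Fin n) A) {a a' l : Fin n}
    (c : Fin n) (ha : (a : ℕ) = a' + 1) (hl : (l : ℕ) + 1 = n) :
    (compMat n u * M) a c = M a' c + (if (a : ℕ) + 1 < n then u a else 0) * M l c := by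
  have h1 := curvMat_mulVec u (fun k => M k c) a l hl
  have h2 := bMat_mulVec_succ (fun k => M k c) ha
  rw [← h1, ← h2, compMat, add_mul]; rfl

lemma compMat_apply_of_lt {u : ℕ → A} {a c : Fin n} (h : (c : ℕ) + 1 < n) :
    compMat n u a c = if (a : ℕ) = c + 1 then 1 else 0 := by
  have h2 : ¬ (c : ℕ) + 1 = n := by omega
  simp [compMat, bMat, curvMat, h2]

/-- The determinant is affine in the spectral parameter. -/
lemma det_smul_cornerMat_add {m : ℕ} (l : A) (M : Matrix (Fin (m + 1)) (Fin (m + 1)) A) :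
    (l • cornerMat (m + 1) A + M).det = l * M.adjugate (Fin.last m) 0 + M.det := by
  have : l • cornerMat (m + 1) A + M
      = M.updateRow 0 (l • Pi.single (Fin.last m) 1 + M 0) := by
    ext a c
    rw [Matrix.updateRow_apply]
    by_cases ha : a = 0
    · subst ha
      have : (c : ℕ) = m ↔ c = Fin.last m := by rw [Fin.ext_iff]; simp
      simp [cornerMat, this, Pi.single_apply]
    · simp [cornerMat, ha]
  rw [this, Matrix.det_updateRow_add, Matrix.det_updateRow_smul, Matrix.updateRow_eq_self,
    Matrix.adjugate_apply]

/-- Since `λ - r = λ(1 - r λ⁻¹)`, the second factor is a power series in `λ⁻¹` with constant term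
`1`. Thus `f` is invertible over Laurent series whatever the value of `k`. -/
lemma isUnit_lamOf_sub_C (r : A) : IsUnit (lamOf A - HahnSeries.C r) := by
  have h1 : lamOf A - HahnSeries.C r
      = lamOf A * HahnSeries.ofPowerSeries ℤ A (1 - PowerSeries.C r * PowerSeries.X) := by
    rw [map_sub, map_one, map_mul, HahnSeries.ofPowerSeries_C, HahnSeries.ofPowerSeries_X, mul_sub,
      mul_one, mul_left_comm, lamOf, HahnSeries.single_mul_single]
    simp
  rw [h1]
  refine IsUnit.mul ?_ (IsUnit.map _ ?_)
  · refine IsUnit.of_mul_eq_one (HahnSeries.single 1 1) ?_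
    rw [lamOf, HahnSeries.single_mul_single]; simp
  · rw [PowerSeries.isUnit_iff_constantCoeff]; simp

end Corner

variable {A : Type*} [CommRing A] [Algebra ℝ A] {d : Derivation ℝ A A} {n : ℕ}

/-- The gauge equation for `f_{u,h}` extends to arbitrary spectral parameter. -/
lemma map_withLam_btMat (hn : 2 ≤ n) {u : ℕ → A} {h : A}
    (H : (btMat d n u h).map d
      = btMat d n u h * compMat n u - compMat n (star d n u h) * btMat d n u h) :
    (withLam (btMat d n u h)).map (laurentDer d)
      = withLam (btMat d n u h) * withLam (compMat n u)
        - withLam (compMat n (star d n u h)) * withLam (btMat d n u h) := by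
  obtain ⟨l, hl⟩ : ∃ l : Fin n, (l : ℕ) + 1 = n := ⟨⟨n - 1, by omega⟩, by simp; omega⟩
  obtain ⟨z, hz⟩ : ∃ z : Fin n, (z : ℕ) = 0 := ⟨⟨0, by omega⟩, rfl⟩
  set f := btMat d n u h with hf
  set B := compMat n u with hB
  set B' := compMat n (star d n u h) with hB'
  set E := cornerMat n A with hE
  -- This is the coefficient of `λ` in the gauge equation. The last rows of `f` and `B`, and the
  -- first columns of `f` and `B'`, differ only by the diagonal entry `h`, so both sides are `h
  -- e_{1n}`.
  have h1 : E * f - E * B = f * E - B' * E := by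
    ext a c
    rw [Matrix.sub_apply, Matrix.sub_apply, hE, cornerMat_mul_apply _ _ _ hl,
      cornerMat_mul_apply _ _ _ hl, mul_cornerMat_apply _ _ _ hz, mul_cornerMat_apply _ _ _ hz]
    have e1 : f l c - B l c = if (c : ℕ) + 1 = n then h else 0 := by
      split_ifs with hc
      · have hcl : c = l := Fin.ext (by omega)
        subst hcl
        have : ¬ (c : ℕ) = n := by omega
        rw [hf, btMat_apply_diag]; simp [hB, compMat, bMat, curvMat, hl, this]
      · rw [hB, compMat_apply_of_lt (by omega)]
        split_ifs with h2
        · rw [hf, btMat_apply_succ d u h h2, sub_self]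
        · rw [hf, btMat_apply_of_lt d u h (by omega), sub_self]
    have e2 : f a z - B' a z = if (a : ℕ) = 0 then h else 0 := by
      rw [hB', compMat_apply_of_lt (by omega)]
      split_ifs with h2 h3 h3
      · omega
      · rw [hf, btMat_apply_succ d u h h2, sub_self]
      · have : a = z := Fin.ext (by omega)
        rw [this, hf, btMat_apply_diag, sub_zero]
      · rw [hf, btMat_apply_of_lt d u h (by omega), sub_self]
    have e3 : (if (a : ℕ) = 0 then f l c else 0) - (if (a : ℕ) = 0 then B l c else 0)
        = if (a : ℕ) = 0 then f l c - B l c else 0 := by split_ifs <;> simp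
    have e4 : (if (c : ℕ) + 1 = n then f a z else 0) - (if (c : ℕ) + 1 = n then B' a z else 0)
        = if (c : ℕ) + 1 = n then f a z - B' a z else 0 := by split_ifs <;> simp
    rw [e3, e4, e1, e2]
    split_ifs <;> rfl
  have h2 : (withLam f).map (laurentDer d)
      = (f.map d).map (HahnSeries.C : A →+* LaurentSeries A) := by
    ext a c i
    rw [Matrix.map_apply, coeff_laurentDer, ← neg_neg i, coeff_withLam, Matrix.map_apply,
      Matrix.map_apply, HahnSeries.C_apply, HahnSeries.coeff_single, map_add]
    have e0 : d (if -i = 1 ∧ (a : ℕ) = 0 ∧ (c : ℕ) + 1 = n then (1 : A) else 0) = 0 := by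
      split_ifs <;> simp
    rw [e0, zero_add, neg_neg]
    by_cases hi : i = 0
    · simp [hi]
    · simp [hi]
  have h3 : E * B + f * E = E * f + B' * E := by
    rw [← sub_eq_zero] at h1 ⊢
    rw [← neg_eq_zero, ← h1]; abel
  have hm : ∀ M N : Matrix (Fin n) (Fin n) A,
      M.map (HahnSeries.C : A →+* LaurentSeries A) * N.map (HahnSeries.C : A →+* LaurentSeries A)
        = (M * N).map (HahnSeries.C : A →+* LaurentSeries A) :=
    fun M N => (Matrix.map_mul).symm
  have hadd : ∀ M N : Matrix (Fin n) (Fin n) A,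
      M.map (HahnSeries.C : A →+* LaurentSeries A) + N.map (HahnSeries.C : A →+* LaurentSeries A)
        = (M + N).map (HahnSeries.C : A →+* LaurentSeries A) :=
    fun M N => (Matrix.map_add _ (map_add _) _ _).symm
  have hsub : ∀ M N : Matrix (Fin n) (Fin n) A,
      M.map (HahnSeries.C : A →+* LaurentSeries A) - N.map (HahnSeries.C : A →+* LaurentSeries A)
        = (M - N).map (HahnSeries.C : A →+* LaurentSeries A) :=
    fun M N => (Matrix.map_sub _ (map_sub _) _ _).symm
  have key : ∀ M N : Matrix (Fin n) (Fin n) A, withLam M * withLam N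
      = (lamOf A * lamOf A) • (E * E).map (HahnSeries.C : A →+* LaurentSeries A)
        + lamOf A • (E * N + M * E).map (HahnSeries.C : A →+* LaurentSeries A)
        + (M * N).map (HahnSeries.C : A →+* LaurentSeries A) := by
    intro M N
    rw [withLam_eq, withLam_eq, add_mul, mul_add, mul_add, smul_mul_smul_comm, smul_mul_assoc,
      mul_smul_comm, hm, hm, hm, hm, ← hadd, smul_add]
    abel
  rw [h2, key, key, h3, H, ← hsub]
  abel

variable (d) in
/-- `Z = W - ζ` with `ζ` strictly upper triangular and `[∂_x + b + u, Z] ∈ V_n`. -/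
structure IsFlowMatrix (u : ℕ → A) (W Z : Matrix (Fin n) (Fin n) A) : Prop where
  lower : ∀ a c : Fin n, c ≤ a → Z a c = W a c
  memV : ∀ a c : Fin n, ¬ ((c : ℕ) + 1 = n ∧ (a : ℕ) + 1 < n) →
    (Z.map d + compMat n u * Z - Z * compMat n u) a c = 0

/-- Each column of `Z` is `∂_x + b + u` applied to the preceding one. Hence `Z` is determined by its
first column, which is that of `W`. -/
lemma IsFlowMatrix.succ {u : ℕ → A} {W Z : Matrix (Fin n) (Fin n) A} (hZ : IsFlowMatrix d u W Z)
    (a : Fin n) {c c' : Fin n} (hc : (c' : ℕ) = c + 1) :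
    Z a c' = (Z.map d + compMat n u * Z) a c := by
  have h1 : ¬ ((c : ℕ) + 1 = n ∧ (a : ℕ) + 1 < n) := by have := c'.2; omega
  have := hZ.memV a c h1
  rw [Matrix.sub_apply, mul_compMat_apply _ _ _ hc, sub_eq_zero] at this
  exact this.symm

lemma IsFlowMatrix.unique {u : ℕ → A} {W Z Z' : Matrix (Fin n) (Fin n) A}
    (hZ : IsFlowMatrix d u W Z) (hZ' : IsFlowMatrix d u W Z') : Z = Z' := by
  have key : ∀ (c : ℕ) (hc : c < n) (a : Fin n), Z a ⟨c, hc⟩ = Z' a ⟨c, hc⟩ := by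
    intro c
    induction c with
    | zero =>
      intro hc a
      have h0 : (⟨0, hc⟩ : Fin n) ≤ a := Nat.zero_le _
      rw [hZ.lower _ _ h0, hZ'.lower _ _ h0]
    | succ c ih =>
      intro hc a
      rw [hZ.succ a (c := ⟨c, by omega⟩) rfl, hZ'.succ a (c := ⟨c, by omega⟩) rfl]
      simp only [Matrix.add_apply, Matrix.map_apply, Matrix.mul_apply, ih]
  ext a c
  exact key c c.2 a

lemma IsSeries.pow_commute {u : ℕ → A} {Y : Matrix (Fin n) (Fin n) (LaurentSeries A)}
    (hY : IsSeries d u Y) (j : ℕ) :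
    (Y ^ j).map (laurentDer d) + withLam (compMat n u) * Y ^ j
      - Y ^ j * withLam (compMat n u) = 0 := by
  induction j with
  | zero => rw [pow_zero, map_laurentDer_one]; simp
  | succ j ih =>
    have h := hY.commute
    rw [pow_succ, map_laurentDer_mul]
    have e := congrArg₂ (· + ·) (congrArg (fun M => M * Y) ih) (congrArg (fun M => Y ^ j * M) h)
    simp only [zero_mul, mul_zero, add_zero] at e
    rw [← e]
    noncomm_ring

/-- Existence of `Z_{j,0}(u)`. -/
lemma IsSeries.exists_isFlowMatrix (hn : 2 ≤ n) {u : ℕ → A}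
    {Y : Matrix (Fin n) (Fin n) (LaurentSeries A)} (hY : IsSeries d u Y) (j : ℕ) :
    ∃ Z, IsFlowMatrix d u (laurentCoeff 0 (Y ^ j)) Z := by
  obtain ⟨l, hl⟩ : ∃ l : Fin n, (l : ℕ) + 1 = n := ⟨⟨n - 1, by omega⟩, by simp; omega⟩
  obtain ⟨z, hz⟩ : ∃ z : Fin n, (z : ℕ) = 0 := ⟨⟨0, by omega⟩, rfl⟩
  set W := laurentCoeff 0 (Y ^ j) with hW
  set W1 := laurentCoeff (-1) (Y ^ j) with hW1
  set B := compMat n u with hB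
  have hcomm : W.map d + (cornerMat n A * W1 + B * W) - (W1 * cornerMat n A + W * B) = 0 := by
    have h1 := congrArg (laurentCoeff 0) (hY.pow_commute j)
    have h2 : ∀ M N : Matrix (Fin n) (Fin n) (LaurentSeries A),
        laurentCoeff 0 (M + N) = laurentCoeff 0 M + laurentCoeff 0 N := by
      intro M N; ext a c; simp [laurentCoeff]
    have h3 : ∀ M N : Matrix (Fin n) (Fin n) (LaurentSeries A),
        laurentCoeff 0 (M - N) = laurentCoeff 0 M - laurentCoeff 0 N := by
      intro M N; ext a c; simp [laurentCoeff]
    rw [h3, h2, laurentCoeff_withLam_mul, laurentCoeff_mul_withLam] at h1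
    have h4 : laurentCoeff 0 (0 : Matrix (Fin n) (Fin n) (LaurentSeries A)) = 0 := by
      ext a c; simp [laurentCoeff]
    rw [h4] at h1
    exact h1
  have htr : d W.trace = 0 := by
    have h1 := congrArg Matrix.trace hcomm
    simp only [Matrix.trace_sub, Matrix.trace_add, Matrix.trace_zero] at h1
    rw [Matrix.trace_mul_comm (cornerMat n A) W1, Matrix.trace_mul_comm B W] at h1
    have h2 : (W.map d).trace = d W.trace := by simp [Matrix.trace]
    rw [← h2]
    linear_combination h1
  -- `Z` is built from the first column of `W` by the recursion of `IsFlowMatrix.succ`. The corner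
  -- terms in `hcomm` only touch the first row and the last column, so `W` satisfies the same
  -- recursion on and below the diagonal.
  let col : ℕ → Fin n → A := fun c =>
    Nat.rec (fun a => W a z) (fun _ v a => d (v a) + (B *ᵥ v) a) c
  have hcol : ∀ c a, col (c + 1) a = d (col c a) + (B *ᵥ col c) a := fun c a => rfl
  let Z : Matrix (Fin n) (Fin n) A := Matrix.of fun a c => col c a
  have hlow : ∀ (c : ℕ) (hc : c < n) (a : Fin n), c ≤ a → col c a = W a ⟨c, hc⟩ := by
    intro c
    induction c with
    | zero =>
      intro hc a _
      have : z = ⟨0, hc⟩ := Fin.ext hz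
      rw [← this]
      rfl
    | succ c ih =>
      intro hc a hca
      obtain ⟨a', ha'⟩ : ∃ a' : Fin n, (a : ℕ) = a' + 1 := ⟨⟨a - 1, by omega⟩, by simp; omega⟩
      have h1 := congrFun (congrFun hcomm a) ⟨c, by omega⟩
      rw [Matrix.sub_apply, Matrix.add_apply, Matrix.add_apply, Matrix.add_apply,
        cornerMat_mul_apply _ _ _ hl, mul_cornerMat_apply _ _ _ hz, if_neg (by omega),
        if_neg (by simp; omega), zero_add, zero_add,
        mul_compMat_apply W u a (c := ⟨c, by omega⟩) (c' := ⟨c + 1, hc⟩) rfl,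
        compMat_mul_apply_succ _ _ ha' hl, Matrix.map_apply, Matrix.zero_apply] at h1
      have h2 : (B *ᵥ col c) a = col c a' + (if (a : ℕ) + 1 < n then u a else 0) * col c l := by
        rw [hB, compMat, Matrix.add_mulVec, Pi.add_apply, bMat_mulVec_succ _ ha',
          curvMat_mulVec _ _ _ _ hl]
      rw [hcol, h2, ih (by omega) a (by omega), ih (by omega) a' (by omega),
        ih (by omega) l (by omega)]
      linear_combination h1
  have hsucc : ∀ (a c : Fin n), (c : ℕ) + 1 < n → (Z.map d + B * Z - Z * B) a c = 0 := by
    intro a c hc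
    rw [Matrix.sub_apply, mul_compMat_apply Z u a (c := c) (c' := ⟨c + 1, hc⟩) rfl]
    exact sub_eq_zero.2 (hcol c a).symm
  refine ⟨Z, fun a c hca => hlow c c.2 a hca, fun a c hac => ?_⟩
  by_cases hc : (c : ℕ) + 1 = n
  · have hcl : c = l := Fin.ext (by omega)
    have hal : a = l := Fin.ext (by have := a.2; omega)
    rw [hcl, hal]
    -- The recursion does not control the entry in the last row and column. It vanishes because the
    -- trace does: `Z` and `W` share their diagonal, `d (tr W) = 0`, and the other diagonal entries
    -- are already zero.
    have h1 : (Z.map d + B * Z - Z * B).trace = 0 := by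
      rw [Matrix.trace_sub, Matrix.trace_add, Matrix.trace_mul_comm B Z, add_sub_cancel_right]
      have h2 : (Z.map d).trace = d W.trace := by
        rw [Matrix.trace, Matrix.trace, map_sum]
        refine Finset.sum_congr rfl fun a _ => ?_
        have : Z a a = W a a := hlow a a.2 a le_rfl
        rw [Matrix.diag_apply, Matrix.map_apply, this, Matrix.diag_apply]
      rw [h2, htr]
    rw [Matrix.trace, Finset.sum_eq_single l] at h1
    · exact h1
    · intro b _ hb
      exact hsucc b b (by have := b.2; have : (b : ℕ) ≠ l := fun h => hb (Fin.ext h); omega)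
    · simp
  · exact hsucc a c (by have := c.2; omega)

/-- The first column of `f Z - Z̃ f` is a multiple of `e_1`. -/
lemma flow_first_column (hn : 2 ≤ n) {u v : ℕ → A} {h : A} {j : ℕ}
    {Y Y' : Matrix (Fin n) (Fin n) (LaurentSeries A)}
    (hYY : Y' * withLam (btMat d n u h) = withLam (btMat d n u h) * Y)
    {Z Z' : Matrix (Fin n) (Fin n) A}
    (hZ : IsFlowMatrix d u (laurentCoeff 0 (Y ^ j)) Z)
    (hZ' : IsFlowMatrix d v (laurentCoeff 0 (Y' ^ j)) Z') {a z : Fin n} (hz : (z : ℕ) = 0)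
    (ha : a ≠ z) : (btMat d n u h * Z - Z' * btMat d n u h) a z = 0 := by
  obtain ⟨l, hl⟩ : ∃ l : Fin n, (l : ℕ) + 1 = n := ⟨⟨n - 1, by omega⟩, by simp; omega⟩
  set f := btMat d n u h with hf
  have ha0 : ¬ (a : ℕ) = 0 := fun h => ha (Fin.ext (by omega))
  -- Off the first row and the last column, the coefficient of `λ^0` here has no corner
  -- contribution. The first column of `f` has only two nonzero entries, so in the rows below the
  -- first only parts of `Z` and `Z'` on or below the diagonal are met, where they equal the
  -- coefficients of `λ^0`.
  have hp : Y' ^ j * withLam f = withLam f * Y ^ j :=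
    (SemiconjBy.pow_right (show SemiconjBy (withLam f) Y Y' from hYY.symm) j).symm
  have h1 := congrFun (congrFun (congrArg (laurentCoeff 0) hp) a) z
  rw [laurentCoeff_withLam_mul, laurentCoeff_mul_withLam, Matrix.add_apply, Matrix.add_apply,
    cornerMat_mul_apply _ _ _ hl, mul_cornerMat_apply _ _ _ hz, if_neg (by omega),
    if_neg ha0, zero_add, zero_add] at h1
  have h2 : (f * Z) a z = (f * laurentCoeff 0 (Y ^ j)) a z := by
    rw [Matrix.mul_apply, Matrix.mul_apply]
    refine Finset.sum_congr rfl fun k _ => ?_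
    rw [hZ.lower k z (by rw [Fin.le_def]; omega)]
  have h3 : (Z' * f) a z = (laurentCoeff 0 (Y' ^ j) * f) a z := by
    rw [Matrix.mul_apply, Matrix.mul_apply]
    refine Finset.sum_congr rfl fun k _ => ?_
    by_cases hk : (z : ℕ) + 1 < k
    · rw [hf, btMat_apply_of_lt d u h hk, mul_zero, mul_zero]
    · rw [hZ'.lower a k (by rw [Fin.le_def]; omega)]
  rw [Matrix.sub_apply, h2, h3, h1, sub_self]

/-- If the first column of `f_{u,h}` evolves by `f_t = f Z - Z̃ f`, then the whole matrix does. -/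
lemma map_btMat_of_first_column (hn : 2 ≤ n) {e : Derivation ℝ A A}
    (hde : ∀ x, d (e x) = e (d x)) {u : ℕ → A} {h : A}
    (hf : (btMat d n u h).map d
      = btMat d n u h * compMat n u - compMat n (star d n u h) * btMat d n u h)
    {Z Z' : Matrix (Fin n) (Fin n) A}
    (hZ : (compMat n u).map e = Z.map d + compMat n u * Z - Z * compMat n u)
    (hZ' : ∀ a c : Fin n, ¬ ((c : ℕ) + 1 = n ∧ (a : ℕ) + 1 < n) →
      (Z'.map d + compMat n (star d n u h) * Z' - Z' * compMat n (star d n u h)) a c = 0)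
    {z : Fin n} (hz : (z : ℕ) = 0)
    (h0 : ∀ a, (btMat d n u h).map e a z = (btMat d n u h * Z - Z' * btMat d n u h) a z) :
    (btMat d n u h).map e = btMat d n u h * Z - Z' * btMat d n u h := by
  obtain ⟨l, hl⟩ : ∃ l : Fin n, (l : ℕ) + 1 = n := ⟨⟨n - 1, by omega⟩, by simp; omega⟩
  set f := btMat d n u h with hfdef
  set B := compMat n u with hB
  set B' := compMat n (star d n u h) with hB'
  set G := f.map e - (f * Z - Z' * f) with hG
  set Δ := B'.map e - (Z'.map d + B' * Z' - Z' * B') with hΔ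
  have hdsub : ∀ M N : Matrix (Fin n) (Fin n) A, (M - N).map d = M.map d - N.map d := by
    intro M N; ext a c; simp
  have hesub : ∀ M N : Matrix (Fin n) (Fin n) A, (M - N).map e = M.map e - N.map e := by
    intro M N; ext a c; simp
  -- The defect `G` of the time equation obeys a linear equation driven by the curvature defect `Δ`,
  -- which lives in `V_n`. Reading it column by column propagates `G = 0` from the first column up
  -- to the one before last.
  have hGx : G.map d = G * B - B' * G - Δ * f := by
    have h1 : (f.map e).map d = (f.map d).map e := by
      ext a c; simp [hde]
    have h2 : Z.map d = B.map e - B * Z + Z * B := by rw [hZ]; abel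
    rw [hG, hΔ, hdsub, hdsub, h1, map_matrix_mul, map_matrix_mul, hf, hesub, map_matrix_mul,
      map_matrix_mul, h2]
    noncomm_ring
  have hΔ0 : ∀ a c : Fin n, ¬ ((c : ℕ) + 1 = n ∧ (a : ℕ) + 1 < n) → Δ a c = 0 := by
    intro a c hac
    rw [hΔ, Matrix.sub_apply, hZ' a c hac, sub_zero, Matrix.map_apply, hB', compMat]
    simp only [bMat, curvMat, Matrix.add_apply, Matrix.of_apply, if_neg hac, add_zero]
    split_ifs <;> simp
  have hΔf : ∀ a c, (Δ * f) a c = Δ a l * f l c := by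
    intro a c
    rw [Matrix.mul_apply, Finset.sum_eq_single l]
    · intro k _ hk
      have : ¬ (k : ℕ) + 1 = n := fun h => hk (Fin.ext (by omega))
      rw [hΔ0 a k (fun h => this h.1), zero_mul]
    · simp
  have hstep : ∀ (a : Fin n) {c c' : Fin n}, (c' : ℕ) = c + 1 →
      (∀ k, G k c = 0) → G a c' = Δ a l * f l c := by
    intro a c c' hc h1
    have h2 := congrFun (congrFun hGx a) c
    rw [Matrix.map_apply, h1 a, map_zero, Matrix.sub_apply, Matrix.sub_apply, hΔf,
      mul_compMat_apply _ _ _ hc, Matrix.mul_apply] at h2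
    simp only [h1, mul_zero, Finset.sum_const_zero, sub_zero] at h2
    exact (sub_eq_zero.1 h2.symm)
  have hG0 : ∀ (c : ℕ) (hc : c + 1 < n) (a : Fin n), G a ⟨c, by omega⟩ = 0 := by
    intro c
    induction c with
    | zero =>
      intro hc a
      have : z = ⟨0, by omega⟩ := Fin.ext hz
      rw [← this, hG, Matrix.sub_apply, h0, sub_self]
    | succ c ih =>
      intro hc a
      rw [hstep a (c := ⟨c, by omega⟩) rfl (ih (by omega)), hfdef,
        btMat_apply_of_lt d u h (by simp; omega), mul_zero]
  have hGl : ∀ a, G a l = Δ a l := by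
    intro a
    obtain ⟨c, hc⟩ : ∃ c : Fin n, (l : ℕ) = c + 1 := ⟨⟨l - 1, by omega⟩, by simp; omega⟩
    rw [hstep a hc (hG0 c (by omega)), hfdef, btMat_apply_succ d u h hc, mul_one]
  -- The last column of `G` equals that of `Δ`, whose bottom entry is zero. The equation for the
  -- last column then pushes this vanishing upwards one row at a time, so `Δ` vanishes as well.
  have hlast : ∀ a a' : Fin n, (a : ℕ) = a' + 1 → Δ a l = 0 → Δ a' l = 0 := by
    intro a a' ha h1
    have h2 := congrFun (congrFun hGx a) l
    rw [Matrix.map_apply, hGl, h1, map_zero, Matrix.sub_apply, Matrix.sub_apply, hΔf, h1,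
      zero_mul, sub_zero, mul_compMat_apply_last _ _ _ hl, compMat_mul_apply_succ _ _ ha hl, hGl,
      hGl, hΔ0 l l (by omega), mul_zero, add_zero, Finset.sum_eq_zero] at h2
    · simpa using h2.symm
    · intro i _
      split_ifs with hi
      · rw [hG0 i hi, zero_mul]
      · rw [mul_zero]
  have hΔl : ∀ (r : ℕ) (a : Fin n), (a : ℕ) + r + 1 = n → Δ a l = 0 := by
    intro r
    induction r with
    | zero => intro a ha; exact hΔ0 a l (by omega)
    | succ r ih =>
      intro a ha
      exact hlast ⟨a + 1, by omega⟩ a rfl (ih _ (by simp; omega))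
  rw [← sub_eq_zero]
  ext a c
  change G a c = 0
  by_cases hc : (c : ℕ) + 1 = n
  · have : c = l := Fin.ext (by omega)
    rw [this, hGl]
    exact hΔl (n - 1 - a) a (by have := a.2; omega)
  · exact hG0 c (by have := c.2; omega) a

/-! ### Moving frames -/

/-- `g_x = g P` and `f_x = f P - Q f` imply `g̃_x = g̃ Q` for `g̃ = D g f⁻¹`, `D` constant. -/
lemma map_gauge {m : ℕ} (δ : Derivation ℝ A A) {D g f F P Q : Matrix (Fin m) (Fin m) A}
    (hD : D.map δ = 0) (hg : g.map δ = g * P) (hF : f * F = 1) (hf : f.map δ = f * P - Q * f) :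
    (D * g * F).map δ = D * g * F * Q := by
  have hF' : F * f = 1 := mul_eq_one_comm.1 hF
  have h1 : F.map δ = - (P * F) + F * Q := by
    have h3 := map_matrix_mul δ F f
    rw [hF', map_matrix_one] at h3
    have h4 := congrArg (fun M => M * F) h3
    simp only [zero_mul, add_mul, mul_assoc, hF, mul_one, hf, sub_mul, mul_sub] at h4
    rw [← mul_assoc F f, hF', one_mul] at h4
    rw [← sub_eq_zero, h4]; abel
  rw [map_matrix_mul, map_matrix_mul, hD, hg, h1]
  noncomm_ring

/-- Zero curvature. -/
lemma zero_curvature {m : ℕ} {d e : Derivation ℝ A A} (hde : ∀ x, d (e x) = e (d x))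
    {g B Z : Matrix (Fin m) (Fin m) A} (hg : IsUnit g.det) (hd : g.map d = g * B)
    (he : g.map e = g * Z) : B.map e = Z.map d + B * Z - Z * B := by
  have h1 : (g.map e).map d = (g.map d).map e := by ext a c; simp [hde]
  rw [hd, he, map_matrix_mul, map_matrix_mul, hd, he] at h1
  have h2 : g * (Z.map d + B * Z - Z * B) = g * B.map e := by
    rw [mul_sub, mul_add, ← mul_assoc, ← mul_assoc, add_comm (g * Z.map d), h1]; abel
  have h3 := congrArg (fun M => g⁻¹ * M) h2
  simp only [← mul_assoc, Matrix.nonsing_inv_mul _ hg, one_mul] at h3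
  exact h3.symm

end CentralAffine

end

noncomputable section

namespace CentralAffine

/-! ### Bäcklund transformations and permutability over a differential ring -/

open Polynomial DiffOp

variable {A : Type*} [CommRing A] [Algebra ℝ A] {d : Derivation ℝ A A} {n : ℕ}

variable (d n) in
/-- `∂ + h` intertwines the operators of `u` and `h ∗ u`, and the operator of `h ∗ u` minus `k` is
divisible by `∂ + h`. -/
structure IsDarboux (u : ℕ → A) (h k : A) : Prop where
  comm : comp d (opOf n u) (lin h) = shift d h (opOf n (star d n u h))
  factor : ∃ S, opOf n (star d n u h) = comp d S (lin h) + C k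

lemma IsDarboux.det (hn : 2 ≤ n) {u : ℕ → A} {h k : A} (H : IsDarboux d n u h k) :
    (btMat d n u h).det = (-1) ^ n * k := by
  obtain ⟨S, hS⟩ := H.factor
  have := det_btMat d hn u h hS 0
  rw [zero_smul, zero_add] at this
  obtain ⟨m, rfl⟩ : ∃ m, n = m + 1 := ⟨n - 1, by omega⟩
  rw [this, Nat.add_sub_cancel, pow_succ]; ring

/-- The determinant identifies the remainder of right division by `∂ + h` with the constant `k`.
Constancy of the remainder then kills the function left over in `exists_comp_opOf`, so the
intertwining is exact. -/
lemma IsDarboux.of_det (hn : 2 ≤ n) {u : ℕ → A} {h k : A} (hk : d k = 0)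
    (H : (btMat d n u h).det = (-1) ^ n * k) : IsDarboux d n u h k := by
  obtain ⟨S, r, hS⟩ := exists_eq_comp_lin_add_C d h (opOf n (star d n u h))
  have h1 := det_btMat d hn u h hS 0
  rw [zero_smul, zero_add, H] at h1
  obtain ⟨m, rfl⟩ : ∃ m, n = m + 1 := ⟨n - 1, by omega⟩
  have h2 : r = k := by
    have h3 : ((-1) ^ m * (-1) ^ m : A) = 1 := by rw [← mul_pow]; simp
    rw [Nat.add_sub_cancel, pow_succ] at h1
    linear_combination (-1) ^ m * h1 + (k - r) * h3
  rw [h2] at hS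
  obtain ⟨c, hc⟩ := exists_comp_opOf d (m + 1) hn u h
  obtain ⟨rfl, -⟩ := eq_shift_of_factorization hk hS hc
  exact ⟨by rw [hc, C_0, add_zero], S, hS⟩

lemma IsDarboux.exists_eq_shift {u : ℕ → A} {h k : A} (hk : d k = 0)
    (H : IsDarboux d n u h k) : ∃ S, opOf n u = shift d h S + C k := by
  obtain ⟨S, hS⟩ := H.factor
  exact ⟨S, (eq_shift_of_factorization (c := 0) hk hS (by rw [H.comm, C_0, add_zero])).2⟩

lemma IsDarboux.map_btMat (hn : 2 ≤ n) {u : ℕ → A} {h k : A} (H : IsDarboux d n u h k) :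
    (btMat d n u h).map d
      = btMat d n u h * compMat n u - compMat n (star d n u h) * btMat d n u h :=
  CentralAffine.map_btMat d hn u h H.comm

lemma IsDarboux.isUnit_det_withLam (hn : 2 ≤ n) {u : ℕ → A} {h k : A}
    (H : IsDarboux d n u h k) : IsUnit (withLam (btMat d n u h)).det := by
  obtain ⟨m, rfl⟩ : ∃ m, n = m + 1 := ⟨n - 1, by omega⟩
  set f := btMat d (m + 1) u h with hf
  have h0 := adjugate_last_zero (f.map (HahnSeries.C : A →+* LaurentSeries A))
    (fun a c hac => by rw [Matrix.map_apply, hf, btMat_apply_of_lt d u h hac, map_zero])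
    (fun a c hac => by rw [Matrix.map_apply, hf, btMat_apply_succ d u h hac, map_one])
  have h1 : (f.map (HahnSeries.C : A →+* LaurentSeries A)).det
      = HahnSeries.C ((-1) ^ (m + 1) * k) := by
    rw [← H.det hn, RingHom.map_det]; rfl
  rw [withLam_eq, map_cornerMat, det_smul_cornerMat_add, h0, h1]
  have h2 : lamOf A * (-1) ^ m + (HahnSeries.C ((-1) ^ (m + 1) * k) : LaurentSeries A)
      = (-1) ^ m * (lamOf A - HahnSeries.C k) := by
    rw [map_mul, map_pow, map_neg, map_one, pow_succ]; ring
  rw [h2]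
  exact IsUnit.mul (IsUnit.pow _ isUnit_one.neg) (isUnit_lamOf_sub_C k)

/-- The series of `h ∗ u` is conjugate to the series of `u`. -/
lemma IsDarboux.exists_isSeries [IsReduced A] (hn : 2 ≤ n) {u : ℕ → A} {h k : A}
    (H : IsDarboux d n u h k) {Y : Matrix (Fin n) (Fin n) (LaurentSeries A)}
    (hY : IsSeries d u Y) :
    ∃ Y', IsSeries d (star d n u h) Y' ∧
      Y' * withLam (btMat d n u h) = withLam (btMat d n u h) * Y := by
  have hu := H.isUnit_det_withLam hn
  obtain ⟨h1, h2⟩ := lead_btMat d hn u h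
  refine ⟨_, hY.conj hn h1 h2 (Matrix.mul_nonsing_inv _ hu)
    (map_withLam_btMat hn (H.map_btMat hn)), ?_⟩
  rw [mul_assoc, Matrix.nonsing_inv_mul _ hu, mul_one]

/-- Uniqueness of the series upgrades the conjugation relation from the constructed series to any
given one. -/
lemma IsDarboux.intertwine [IsReduced A] (hn : 2 ≤ n) {u : ℕ → A} {h k : A}
    (H : IsDarboux d n u h k) {Y Y' : Matrix (Fin n) (Fin n) (LaurentSeries A)}
    (hY : IsSeries d u Y) (hY' : IsSeries d (star d n u h) Y') :
    Y' * withLam (btMat d n u h) = withLam (btMat d n u h) * Y := by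
  obtain ⟨Y'', h1, h2⟩ := H.exists_isSeries hn hY
  rw [hY'.unique hn h1, h2]

lemma star_eq_of_opOf_eq {u v : ℕ → A} {h m : A}
    (H : opOf n (star d n u h) = opOf n (star d n v m)) : star d n u h = star d n v m := by
  funext i
  by_cases hi : i + 1 < n
  · have := congrArg (fun p => p.coeff i) H
    simp only [coeff_opOf, if_pos hi, if_neg (show ¬ i = n by omega)] at this
    linear_combination -this
  · rw [star_of_le d u h (by omega), star_of_le d v m (by omega)]

/-- Permutability for the `x`-part. -/
lemma IsDarboux.permute (hn : 2 ≤ n) {u : ℕ → A} {h₁ h₂ m₁ m₂ k₁ k₂ : A}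
    (hc : Compatible d h₁ h₂ m₁ m₂) (hu : IsUnit (h₁ - h₂)) (hk₂ : d k₂ = 0)
    (H₁ : IsDarboux d n u h₁ k₁) (H₂ : IsDarboux d n u h₂ k₂) :
    IsDarboux d n (star d n u h₁) m₂ k₂ := by
  obtain ⟨S, hS⟩ := H₂.exists_eq_shift hk₂
  obtain ⟨c, hc12⟩ := exists_comp_opOf d n hn (star d n u h₁) m₂
  obtain ⟨rfl, S', hS'⟩ := hc.factorization hu hk₂ H₁.comm hS hc12
  exact ⟨by rw [hc12, C_0, add_zero], S', hS'⟩

lemma star_star_eq {u : ℕ → A} {h₁ h₂ m₁ m₂ k₁ k₂ : A}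
    (hc : Compatible d h₁ h₂ m₁ m₂)
    (H₁ : IsDarboux d n u h₁ k₁) (H₂ : IsDarboux d n u h₂ k₂)
    (H₁₂ : IsDarboux d n (star d n u h₁) m₂ k₂) (H₂₁ : IsDarboux d n (star d n u h₂) m₁ k₁) :
    star d n (star d n u h₁) m₂ = star d n (star d n u h₂) m₁ :=
  star_eq_of_opOf_eq (hc.eq_of_comp H₁.comm H₂.comm H₁₂.comm H₂₁.comm)

lemma mul_btMat_first {u : ℕ → A} {h : A} (M : Matrix (Fin n) (Fin n) A)
    (a : Fin n) {z o : Fin n} (hz : (z : ℕ) = 0) (ho : (o : ℕ) = 1) :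
    (M * btMat d n u h) a z = M a z * h + M a o := by
  have hzo : z ≠ o := fun h => by rw [h] at hz; omega
  rw [Matrix.mul_apply, ← Finset.sum_subset (Finset.subset_univ {z, o}), Finset.sum_pair hzo,
    btMat_apply_diag, btMat_apply_succ d u h (by omega), mul_one]
  intro k _ hk
  simp only [Finset.mem_insert, Finset.mem_singleton, not_or, Fin.ext_iff] at hk
  rw [btMat_apply_of_lt d u h (by omega), mul_zero]

lemma btMat_first {u : ℕ → A} {h : A} (a : Fin n) {z : Fin n} (hz : (z : ℕ) = 0) :
    btMat d n u h a z = if (a : ℕ) = 0 then h else if (a : ℕ) = 1 then 1 else 0 := by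
  split_ifs with h0 h1
  · have : a = z := Fin.ext (by omega)
    rw [this, btMat_apply_diag]
  · exact btMat_apply_succ d u h (by omega)
  · exact btMat_apply_of_lt d u h (by omega)

/-- The two products of Bäcklund matrices agree. -/
lemma btMat_mul_btMat (hn : 2 ≤ n) {u : ℕ → A} {h₁ h₂ m₁ m₂ k₁ k₂ : A}
    (hc : Compatible d h₁ h₂ m₁ m₂)
    (H₁ : IsDarboux d n u h₁ k₁) (H₂ : IsDarboux d n u h₂ k₂)
    (H₁₂ : IsDarboux d n (star d n u h₁) m₂ k₂) (H₂₁ : IsDarboux d n (star d n u h₂) m₁ k₁) :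
    btMat d n (star d n u h₁) m₂ * btMat d n u h₁
      = btMat d n (star d n u h₂) m₁ * btMat d n u h₂ := by
  obtain ⟨z, hz⟩ : ∃ z : Fin n, (z : ℕ) = 0 := ⟨⟨0, by omega⟩, rfl⟩
  obtain ⟨o, ho⟩ : ∃ o : Fin n, (o : ℕ) = 1 := ⟨⟨1, by omega⟩, rfl⟩
  have hs := star_star_eq hc H₁ H₂ H₁₂ H₂₁
  set B := compMat n (star d n (star d n u h₁) m₂) with hB
  have e12 := H₁₂.map_btMat hn
  have e21 := H₂₁.map_btMat hn
  rw [← hs] at e21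
  rw [← hB] at e12 e21
  have hprod : ∀ {f f' P : Matrix (Fin n) (Fin n) A}, f'.map d = f' * P - B * f' →
      f.map d = f * compMat n u - P * f →
      (f' * f).map d = f' * f * compMat n u - B * (f' * f) := by
    intro f f' P h1 h2
    rw [map_matrix_mul, h1, h2]; noncomm_ring
  have p12 := hprod e12 (H₁.map_btMat hn)
  have p21 := hprod e21 (H₂.map_btMat hn)
  have hcol : ∀ {M P : Matrix (Fin n) (Fin n) A} {v : ℕ → A}, M.map d = M * compMat n v - B * M →
      ∀ a {c c' : Fin n}, (c' : ℕ) = c + 1 → M a c' = d (M a c) + (B * M) a c := by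
    intro M P v h1 a c c' hcc
    have := congrFun (congrFun h1 a) c
    rw [Matrix.map_apply, Matrix.sub_apply, mul_compMat_apply _ _ _ hcc] at this
    rw [this]; ring
  have hfirst : ∀ {v : ℕ → A} {h m : A},
      (btMat d n v m).map d = btMat d n v m * compMat n v - B * btMat d n v m →
      ∀ a, btMat d n v m a o = (if (a : ℕ) = 0 then d m else 0)
        + (if (a : ℕ) = 1 then m else 0) + B a o := by
    intro v h m h1 a
    rw [hcol (P := B) h1 a (c := z) (by omega), mul_btMat_first B a hz ho,
      btMat_first a hz, hB, compMat_apply_of_lt (by omega), hz, zero_add]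
    split_ifs <;> simp [add_assoc]
  -- Both products solve `M_x = M(b + u) - B M` with the same `B`, so each column determines the
  -- next. The first columns represent `(∂ + h₁)(∂ + m₂)` and `(∂ + h₂)(∂ + m₁)` and agree by
  -- compatibility.
  have key : ∀ (c : ℕ) (hcn : c < n) (a : Fin n),
      (btMat d n (star d n u h₁) m₂ * btMat d n u h₁) a ⟨c, hcn⟩
        = (btMat d n (star d n u h₂) m₁ * btMat d n u h₂) a ⟨c, hcn⟩ := by
    intro c
    induction c with
    | zero =>
      intro hcn a
      have : (⟨0, hcn⟩ : Fin n) = z := Fin.ext hz.symm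
      rw [this, mul_btMat_first _ a hz ho, mul_btMat_first _ a hz ho,
        hfirst (h := 0) e12, hfirst (h := 0) e21, btMat_first a hz, btMat_first a hz]
      have h1 := hc.add_eq
      have h2 := hc.mul_eq
      split_ifs with ha0 ha1
      · omega
      · linear_combination h2
      · linear_combination h1
      · ring
    | succ c ih =>
      intro hcn a
      rw [hcol (P := B) p12 a (c := ⟨c, by omega⟩) rfl,
        hcol (P := B) p21 a (c := ⟨c, by omega⟩) rfl, ih]
      congr 1
      rw [Matrix.mul_apply, Matrix.mul_apply]
      exact Finset.sum_congr rfl fun k _ => by rw [ih]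
  ext a c
  exact key c c.2 a

/-- Permutability for the `t`-part. -/
lemma map_time_permute (hn : 2 ≤ n) {e : Derivation ℝ A A} (hde : ∀ x, d (e x) = e (d x))
    {u : ℕ → A} {h₁ h₂ m₁ m₂ k₁ k₂ : A}
    (hc : Compatible d h₁ h₂ m₁ m₂) (hu : IsUnit (h₁ - h₂))
    (H₁ : IsDarboux d n u h₁ k₁) (H₂ : IsDarboux d n u h₂ k₂)
    (H₁₂ : IsDarboux d n (star d n u h₁) m₂ k₂) (H₂₁ : IsDarboux d n (star d n u h₂) m₁ k₁)
    {Z Z₁ Z₂ Z₁₂ W₁ W₂ W₁₂ : Matrix (Fin n) (Fin n) A}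
    (hZ₁ : IsFlowMatrix d (star d n u h₁) W₁ Z₁) (hZ₂ : IsFlowMatrix d (star d n u h₂) W₂ Z₂)
    (hZ₁₂ : IsFlowMatrix d (star d n (star d n u h₁) m₂) W₁₂ Z₁₂)
    (e₁ : (btMat d n u h₁).map e = btMat d n u h₁ * Z - Z₁ * btMat d n u h₁)
    (e₂ : (btMat d n u h₂).map e = btMat d n u h₂ * Z - Z₂ * btMat d n u h₂)
    {z : Fin n} (hz : (z : ℕ) = 0)
    (h₁₂ : ∀ a, a ≠ z → (btMat d n (star d n u h₁) m₂ * Z₁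
      - Z₁₂ * btMat d n (star d n u h₁) m₂) a z = 0)
    (h₂₁ : ∀ a, a ≠ z → (btMat d n (star d n u h₂) m₁ * Z₂
      - Z₁₂ * btMat d n (star d n u h₂) m₁) a z = 0) :
    e m₂ = (btMat d n (star d n u h₁) m₂ * Z₁ - Z₁₂ * btMat d n (star d n u h₁) m₂) z z := by
  obtain ⟨o, ho⟩ : ∃ o : Fin n, (o : ℕ) = 1 := ⟨⟨1, by omega⟩, rfl⟩
  have hs := star_star_eq hc H₁ H₂ H₁₂ H₂₁
  have hprod := btMat_mul_btMat hn hc H₁ H₂ H₁₂ H₂₁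
  set B := compMat n (star d n (star d n u h₁) m₂) with hB
  have x12 := H₁₂.map_btMat hn
  have x21 := H₂₁.map_btMat hn
  rw [← hs] at x21
  rw [← hB] at x12 x21
  set f₁₂ := btMat d n (star d n u h₁) m₂ with hf₁₂
  set f₂₁ := btMat d n (star d n u h₂) m₁ with hf₂₁
  set F₁₂ := f₁₂ * Z₁ - Z₁₂ * f₁₂ with hF₁₂
  set F₂₁ := f₂₁ * Z₂ - Z₁₂ * f₂₁ with hF₂₁
  -- `F₁₂` is what the time derivative of `f₁₂` should be; with it in that place, the product rule
  -- gives the same value for both factorizations.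
  have hsum : f₁₂ * (btMat d n u h₁).map e + F₁₂ * btMat d n u h₁
      = f₂₁ * (btMat d n u h₂).map e + F₂₁ * btMat d n u h₂ := by
    have l1 : f₁₂ * (btMat d n u h₁).map e + F₁₂ * btMat d n u h₁
        = f₁₂ * btMat d n u h₁ * Z - Z₁₂ * (f₁₂ * btMat d n u h₁) := by
      rw [e₁, hF₁₂]; noncomm_ring
    have l2 : f₂₁ * (btMat d n u h₂).map e + F₂₁ * btMat d n u h₂
        = f₂₁ * btMat d n u h₂ * Z - Z₁₂ * (f₂₁ * btMat d n u h₂) := by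
      rw [e₂, hF₂₁]; noncomm_ring
    rw [l1, l2, hprod]
  have hmapz : ∀ (f' : Matrix (Fin n) (Fin n) A) (h : A) (a : Fin n),
      (f' * (btMat d n u h).map e) a z = f' a z * e h := by
    intro f' h a
    rw [Matrix.mul_apply, Finset.sum_eq_single z]
    · rw [Matrix.map_apply, btMat_apply_diag]
    · intro k _ hk
      have : ¬ (k : ℕ) = 0 := fun h => hk (Fin.ext (by omega))
      rw [Matrix.map_apply, btMat_first k hz, if_neg this]
      split_ifs <;> simp
    · simp
  set V := Z₁₂.map d + B * Z₁₂ - Z₁₂ * B with hV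
  have hVz : ∀ a, V a z = 0 := fun a => hZ₁₂.memV a z (by omega)
  -- The second column of `F` follows from the first through the `x`-equation. The term `V` depends
  -- only on the doubly transformed data and cancels when the two orders are compared.
  have hFo : ∀ {v : ℕ → A} {m : A} {Z' W' : Matrix (Fin n) (Fin n) A},
      IsFlowMatrix d v W' Z' →
      (btMat d n v m).map d = btMat d n v m * compMat n v - B * btMat d n v m →
      (∀ a, a ≠ z → (btMat d n v m * Z' - Z₁₂ * btMat d n v m) a z = 0) →
      ∀ a, (btMat d n v m * Z' - Z₁₂ * btMat d n v m) a o
        = d ((btMat d n v m * Z' - Z₁₂ * btMat d n v m) a z)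
          + (if (a : ℕ) = 1 then (btMat d n v m * Z' - Z₁₂ * btMat d n v m) z z else 0)
          + V a o := by
    intro v m Z' W' hZ' hx h0 a
    set f := btMat d n v m with hf
    set F := f * Z' - Z₁₂ * f with hF
    set V' := Z'.map d + compMat n v * Z' - Z' * compMat n v with hV'
    have h1 : F.map d = F * compMat n v - B * F + f * V' - V * f := by
      have hdsub : ∀ M N : Matrix (Fin n) (Fin n) A, (M - N).map d = M.map d - N.map d := by
        intro M N; ext a c; simp
      rw [hF, hdsub, map_matrix_mul, map_matrix_mul, hx, hV, hV']
      noncomm_ring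
    have h2 := congrFun (congrFun h1 a) z
    have h3 : (f * V') a z = 0 := by
      rw [Matrix.mul_apply]
      refine Finset.sum_eq_zero fun k _ => ?_
      rw [hV', hZ'.memV k z (by omega), mul_zero]
    have h4 : (V * f) a z = V a o := by
      rw [hf, mul_btMat_first V a hz ho, hVz, zero_mul, zero_add]
    have h5 : (B * F) a z = if (a : ℕ) = 1 then F z z else 0 := by
      rw [Matrix.mul_apply, Finset.sum_eq_single z]
      · rw [hB, compMat_apply_of_lt (by omega), hz, zero_add]; split_ifs <;> simp
      · intro k _ hk; rw [h0 k hk, mul_zero]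
      · simp
    rw [Matrix.map_apply, Matrix.sub_apply, Matrix.add_apply, Matrix.sub_apply,
      mul_compMat_apply F v a (c := z) (c' := o) (by omega), h3, h4, h5] at h2
    rw [h2]; ring
  have g12 := hFo hZ₁ x12 h₁₂
  have g21 := hFo hZ₂ x21 h₂₁
  rw [← hf₁₂, ← hF₁₂] at g12
  rw [← hf₂₁, ← hF₂₁] at g21
  have hzo : o ≠ z := fun h => by rw [h] at ho; omega
  have qz := congrFun (congrFun hsum z) z
  have qo := congrFun (congrFun hsum o) z
  rw [Matrix.add_apply, Matrix.add_apply, hmapz, hmapz, mul_btMat_first _ _ hz ho,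
    mul_btMat_first _ _ hz ho, g12, g21, hf₁₂, hf₂₁, btMat_first _ hz,
    btMat_first _ hz] at qz qo
  have hz1 : ¬ (z : ℕ) = 1 := by omega
  have ho0 : ¬ (o : ℕ) = 0 := by omega
  simp only [if_pos hz, if_neg hz1] at qz
  simp only [h₁₂ o hzo, h₂₁ o hzo, if_neg ho0, if_pos ho, map_zero] at qo
  have c1 := congrArg e hc.add_eq
  have c2 := congrArg e hc.mul_eq
  rw [map_add, map_add] at c1
  simp only [map_add, Derivation.leibniz, smul_eq_mul, ← hde] at c2
  -- The second row shows that both orders have the same defect `δ`; the first row then reduces to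
  -- `(h₁ - h₂) δ = 0`.
  have hδ : F₁₂ z z - e m₂ = F₂₁ z z - e m₁ := by linear_combination qo - c1
  have hδd : d (F₁₂ z z) - d (e m₂) = d (F₂₁ z z) - d (e m₁) := by
    rw [← map_sub, ← map_sub, hδ]
  have hfin : (h₁ - h₂) * (F₁₂ z z - e m₂) = 0 := by
    linear_combination qz - c2 - hδd - h₂ * hδ
  exact (sub_eq_zero.1 (hu.mul_right_eq_zero.1 hfin)).symm

variable (d n) in
/-- `g` is the moving frame of a solution of the `j`-th flow with curvature `u`. -/
structure IsFlowFrame (e : Derivation ℝ A A) (j : ℕ) (u : ℕ → A)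
    (Y : Matrix (Fin n) (Fin n) (LaurentSeries A)) (Z g : Matrix (Fin n) (Fin n) A) : Prop where
  series : IsSeries d u Y
  flow : IsFlowMatrix d u (laurentCoeff 0 (Y ^ j)) Z
  map_x : g.map d = g * compMat n u
  map_t : g.map e = g * Z
  det : g.det = 1

/-- Bäcklund transformation of a moving frame. -/
lemma IsFlowFrame.transform [IsReduced A] (hn : 2 ≤ n) {e : Derivation ℝ A A}
    (hde : ∀ x, d (e x) = e (d x)) {j : ℕ} {u : ℕ → A} {h k : A}
    {Y Y' : Matrix (Fin n) (Fin n) (LaurentSeries A)} {Z Z' g D : Matrix (Fin n) (Fin n) A}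
    (hg : IsFlowFrame d n e j u Y Z g) (H : IsDarboux d n u h k) (hk : IsUnit k)
    (hY' : IsSeries d (star d n u h) Y')
    (hZ' : IsFlowMatrix d (star d n u h) (laurentCoeff 0 (Y' ^ j)) Z')
    {z : Fin n} (hz : (z : ℕ) = 0)
    (ht : e h = (btMat d n u h * Z - Z' * btMat d n u h) z z)
    (hDd : D.map d = 0) (hDe : D.map e = 0) (hD : D.det = (-1) ^ n * k) :
    IsFlowFrame d n e j (star d n u h) Y' Z' (D * g * (btMat d n u h)⁻¹) ∧
      (btMat d n u h).map e = btMat d n u h * Z - Z' * btMat d n u h := by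
  have hdu : IsUnit (btMat d n u h).det := by
    rw [H.det hn]; exact IsUnit.mul (IsUnit.pow _ isUnit_one.neg) hk
  have hgu : IsUnit g.det := by rw [hg.det]; exact isUnit_one
  have hfe : (btMat d n u h).map e = btMat d n u h * Z - Z' * btMat d n u h := by
    refine map_btMat_of_first_column hn hde (H.map_btMat hn)
      (zero_curvature hde hgu hg.map_x hg.map_t) hZ'.memV hz fun a => ?_
    by_cases ha : a = z
    · rw [ha, ← ht, Matrix.map_apply, btMat_apply_diag]
    · rw [flow_first_column hn (H.intertwine hn hg.series hY') hg.flow hZ' hz ha,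
        Matrix.map_apply, btMat_first a hz, if_neg (fun h => ha (Fin.ext (by omega)))]
      split_ifs <;> simp
  refine ⟨⟨hY', hZ', ?_, ?_, ?_⟩, hfe⟩
  · exact map_gauge d hDd hg.map_x (Matrix.mul_nonsing_inv _ hdu) (H.map_btMat hn)
  · exact map_gauge e hDe hg.map_t (Matrix.mul_nonsing_inv _ hdu) hfe
  · have h1 : (btMat d n u h).det * (btMat d n u h)⁻¹.det = 1 := by
      rw [← Matrix.det_mul, Matrix.mul_nonsing_inv _ hdu, Matrix.det_one]
    rw [Matrix.det_mul, Matrix.det_mul, hg.det, mul_one, hD, ← H.det hn, h1]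

end CentralAffine

end

noncomputable section

namespace CentralAffine

/-! ### The differential algebra of smooth functions on an open set -/

open TopologicalSpace

/-- The smooth functions on an open subset of the plane, as a subalgebra of all functions. -/
def smoothSubalgebra (U : Opens (ℝ × ℝ)) : Subalgebra ℝ (U → ℝ) where
  carrier := {f | ∃ F : ℝ × ℝ → ℝ, ContDiffOn ℝ ∞ F U ∧ ∀ p : U, F p = f p}
  mul_mem' := by
    rintro f g ⟨F, hF, hFf⟩ ⟨G, hG, hGg⟩
    exact ⟨F * G, hF.mul hG, fun p => by simp [hFf, hGg]⟩
  add_mem' := by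
    rintro f g ⟨F, hF, hFf⟩ ⟨G, hG, hGg⟩
    exact ⟨F + G, hF.add hG, fun p => by simp [hFf, hGg]⟩
  algebraMap_mem' r := ⟨fun _ => r, contDiffOn_const, fun p => rfl⟩

/-- The algebra of smooth functions on an open subset of the plane. -/
def SmoothFn (U : Opens (ℝ × ℝ)) : Type := smoothSubalgebra U

namespace SmoothFn

variable {U : Opens (ℝ × ℝ)}

instance : CommRing (SmoothFn U) := inferInstanceAs (CommRing (smoothSubalgebra U))

instance : Algebra ℝ (SmoothFn U) := inferInstanceAs (Algebra ℝ (smoothSubalgebra U))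

/-- A smooth function on `U`. -/
def mk (F : ℝ × ℝ → ℝ) (hF : ContDiffOn ℝ ∞ F U) : SmoothFn U := ⟨fun p => F p, F, hF, fun _ => rfl⟩

/-- Extension by zero. -/
def ext (a : SmoothFn U) (p : ℝ × ℝ) : ℝ := by
  classical exact if h : p ∈ U then a.1 ⟨p, h⟩ else 0

lemma ext_of_mem (a : SmoothFn U) {p : ℝ × ℝ} (h : p ∈ U) : ext a p = a.1 ⟨p, h⟩ := dif_pos h

lemma contDiffOn_ext (a : SmoothFn U) : ContDiffOn ℝ ∞ (ext a) U := by
  obtain ⟨F, hF, h⟩ := a.2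
  exact hF.congr fun p hp => by rw [ext_of_mem a hp, ← h ⟨p, hp⟩]

lemma contDiffAt_ext (a : SmoothFn U) {p : ℝ × ℝ} (h : p ∈ U) : ContDiffAt ℝ ∞ (ext a) p :=
  (contDiffOn_ext a).contDiffAt (U.isOpen.mem_nhds h)

lemma differentiableAt_ext (a : SmoothFn U) {p : ℝ × ℝ} (h : p ∈ U) :
    DifferentiableAt ℝ (ext a) p := (contDiffAt_ext a h).differentiableAt (by simp)

/-- Evaluation at a point. -/
def ev (p : ℝ × ℝ) (h : p ∈ U) : SmoothFn U →+* ℝ :=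
  (Pi.evalRingHom (fun _ : U => ℝ) ⟨p, h⟩).comp (smoothSubalgebra U).val.toRingHom

lemma ext_eq_ev (a : SmoothFn U) {p : ℝ × ℝ} (h : p ∈ U) : ext a p = ev p h a := ext_of_mem a h

@[simp]
lemma ev_mk {F : ℝ × ℝ → ℝ} (hF : ContDiffOn ℝ ∞ F U) {p : ℝ × ℝ} (h : p ∈ U) :
    ev p h (mk F hF) = F p := rfl

@[simp]
lemma ev_algebraMap (r : ℝ) {p : ℝ × ℝ} (h : p ∈ U) :
    ev p h (algebraMap ℝ (SmoothFn U) r) = r := rfl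

lemma eq_of_ev {a b : SmoothFn U} (H : ∀ p (h : p ∈ U), ev p h a = ev p h b) : a = b :=
  Subtype.ext (funext fun p => H p p.2)

/-- Smooth functions may have zero divisors but no nilpotents, which is all that the uniqueness of
`Y` requires. -/
instance : IsReduced (SmoothFn U) where
  eq_zero a := by
    rintro ⟨k, hk⟩
    refine eq_of_ev fun p h => ?_
    have := congrArg (ev p h) hk
    rw [map_pow, map_zero] at this
    rw [map_zero]
    exact eq_zero_of_pow_eq_zero this

lemma isUnit_of_ev {a : SmoothFn U} (H : ∀ p (h : p ∈ U), ev p h a ≠ 0) : IsUnit a := by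
  have h1 : ContDiffOn ℝ ∞ (fun p => (ext a p)⁻¹) U :=
    (contDiffOn_ext a).inv fun p hp => by rw [ext_eq_ev a hp]; exact H p hp
  refine IsUnit.of_mul_eq_one (mk _ h1) (eq_of_ev fun p hp => ?_)
  rw [map_mul, ev_mk, ext_eq_ev a hp, map_one, mul_inv_cancel₀ (H p hp)]

/-- The directional derivative. -/
def dir (v : ℝ × ℝ) : Derivation ℝ (SmoothFn U) (SmoothFn U) :=
  Derivation.mk'
    { toFun := fun a => mk (fun p => fderiv ℝ (ext a) p v)
        (((contDiffOn_ext a).fderiv_of_isOpen U.isOpen (by simp)).clm_apply contDiffOn_const)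
      map_add' := fun a b => eq_of_ev fun p hp => by
        have h1 : ext (a + b) = ext a + ext b := by
          funext q
          by_cases hq : q ∈ U
          · simp only [ext, hq, dif_pos, Pi.add_apply]; rfl
          · simp [ext, hq]
        rw [map_add, ev_mk, ev_mk, ev_mk, h1,
          fderiv_add (differentiableAt_ext a hp) (differentiableAt_ext b hp)]
        rfl
      map_smul' := fun r a => eq_of_ev fun p hp => by
        have h1 : ext (r • a) = r • ext a := by
          funext q
          by_cases hq : q ∈ U
          · simp only [ext, hq, dif_pos, Pi.smul_apply]; rfl
          · simp [ext, hq]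
        have h2 : ∀ b : SmoothFn U, ev p hp (r • b) = r * ev p hp b := fun b => rfl
        rw [RingHom.id_apply, h2, ev_mk, ev_mk, h1,
          fderiv_const_smul (differentiableAt_ext a hp)]
        rfl }
    (fun a b => eq_of_ev fun p hp => by
      have h1 : ext (a * b) = ext a * ext b := by
        funext q
        by_cases hq : q ∈ U
        · simp only [ext, hq, dif_pos, Pi.mul_apply]; rfl
        · simp [ext, hq]
      simp only [LinearMap.coe_mk, AddHom.coe_mk, smul_eq_mul, map_add, map_mul, ev_mk]
      rw [h1, fderiv_mul (differentiableAt_ext a hp) (differentiableAt_ext b hp), ← ext_eq_ev,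
        ← ext_eq_ev]
      rfl)

lemma ev_dir (v : ℝ × ℝ) (a : SmoothFn U) {p : ℝ × ℝ} (h : p ∈ U) :
    ev p h (dir v a) = fderiv ℝ (ext a) p v := rfl

lemma dir_comm (v w : ℝ × ℝ) (a : SmoothFn U) : dir v (dir w a) = dir w (dir v a) := by
  have key : ∀ v w : ℝ × ℝ, ∀ p (h : p ∈ U),
      ev p h (dir v (dir w a)) = fderiv ℝ (fderiv ℝ (ext a)) p v w := by
    intro v w p h
    rw [ev_dir]
    have h1 : ext (dir w a) =ᶠ[nhds p] fun q => fderiv ℝ (ext a) q w := by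
      filter_upwards [U.isOpen.mem_nhds h] with q hq
      rw [ext_eq_ev _ hq, ev_dir]
    have h2 : DifferentiableAt ℝ (fderiv ℝ (ext a)) p :=
      ((contDiffAt_ext a h).fderiv_right (m := 1) (by norm_cast)).differentiableAt (by simp)
    rw [h1.fderiv_eq, fderiv_clm_apply h2 (differentiableAt_const w)]
    simp
  refine eq_of_ev fun p h => ?_
  rw [key, key]
  have h3 : minSmoothness ℝ 2 ≤ (∞ : WithTop ℕ∞) := by
    rw [minSmoothness_of_isRCLikeNormedField]; exact WithTop.coe_le_coe.2 (le_top (a := (2 : ℕ∞)))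
  exact (contDiffAt_ext a h).isSymmSndFDerivAt h3 v w

/-- The function `F` agrees with `a` on `U`. -/
def Rep (F : ℝ → ℝ → ℝ) (a : SmoothFn U) : Prop :=
  ∀ x t (h : (x, t) ∈ U), F x t = ev (x, t) h a

lemma exists_rep {F : ℝ → ℝ → ℝ} (hF : ContDiffOn ℝ ∞ (fun p : ℝ × ℝ => F p.1 p.2) U) :
    ∃ a : SmoothFn U, Rep F a := ⟨mk _ hF, fun _ _ _ => rfl⟩

lemma Rep.contDiffOn {F : ℝ → ℝ → ℝ} {a : SmoothFn U} (h : Rep F a) :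
    ContDiffOn ℝ ∞ (fun p : ℝ × ℝ => F p.1 p.2) U :=
  (contDiffOn_ext a).congr fun p hp => by rw [ext_eq_ev a hp]; exact h p.1 p.2 hp

lemma Rep.deriv_x {F : ℝ → ℝ → ℝ} {a : SmoothFn U} (h : Rep F a) :
    Rep (fun x t => deriv (fun y => F y t) x) (dir (1, 0) a) := by
  intro x t hxt
  have h1 : (fun y => F y t) =ᶠ[nhds x] fun y => ext a (y, t) := by
    have : Filter.Tendsto (fun y : ℝ => (y, t)) (nhds x) (nhds (x, t)) :=
      (Continuous.prodMk continuous_id continuous_const).tendsto x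
    filter_upwards [this (U.isOpen.mem_nhds hxt)] with y hy
    rw [ext_eq_ev a hy]; exact h y t hy
  have h2 : HasDerivAt (fun y : ℝ => (y, t)) ((1 : ℝ), (0 : ℝ)) x :=
    (hasDerivAt_id x).prodMk (hasDerivAt_const x t)
  have h3 := (differentiableAt_ext a hxt).hasFDerivAt.comp_hasDerivAt x h2
  change deriv _ _ = _
  rw [h1.deriv_eq]
  exact h3.deriv

lemma Rep.deriv_t {F : ℝ → ℝ → ℝ} {a : SmoothFn U} (h : Rep F a) :
    Rep (fun x t => deriv (fun s => F x s) t) (dir (0, 1) a) := by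
  intro x t hxt
  have h1 : (fun s => F x s) =ᶠ[nhds t] fun s => ext a (x, s) := by
    have : Filter.Tendsto (fun s : ℝ => (x, s)) (nhds t) (nhds (x, t)) :=
      (Continuous.prodMk continuous_const continuous_id).tendsto t
    filter_upwards [this (U.isOpen.mem_nhds hxt)] with s hs
    rw [ext_eq_ev a hs]; exact h x s hs
  have h2 : HasDerivAt (fun s : ℝ => (x, s)) ((0 : ℝ), (1 : ℝ)) t :=
    (hasDerivAt_const t x).prodMk (hasDerivAt_id t)
  have h3 := (differentiableAt_ext a hxt).hasFDerivAt.comp_hasDerivAt t h2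
  change deriv _ _ = _
  rw [h1.deriv_eq]
  exact h3.deriv

lemma Rep.iteratedDeriv_x {F : ℝ → ℝ → ℝ} {a : SmoothFn U} (h : Rep F a) (k : ℕ) :
    Rep (fun x t => iteratedDeriv k (fun y => F y t) x) ((dir (1, 0))^[k] a) := by
  induction k with
  | zero => simpa using h
  | succ k ih =>
    simp only [iteratedDeriv_succ, Function.iterate_succ_apply']
    exact ih.deriv_x

/-- The matrix function `M` agrees with `N` on `U`. -/
def RepMat {m : ℕ} (M : ℝ → ℝ → Matrix (Fin m) (Fin m) ℝ) (N : Matrix (Fin m) (Fin m) (SmoothFn U)) :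
    Prop := ∀ x t (h : (x, t) ∈ U), M x t = N.map (ev (x, t) h)

lemma RepMat.apply {m : ℕ} {M : ℝ → ℝ → Matrix (Fin m) (Fin m) ℝ}
    {N : Matrix (Fin m) (Fin m) (SmoothFn U)} (h : RepMat M N) (a c : Fin m) :
    Rep (fun x t => M x t a c) (N a c) := fun x t hxt => by
  change M x t a c = _
  rw [h x t hxt]; rfl

lemma map_inv_of_isUnit {m : ℕ} {R S : Type*} [CommRing R] [CommRing S] (φ : R →+* S)
    {M : Matrix (Fin m) (Fin m) R} (h : IsUnit M.det) : M⁻¹.map φ = (M.map φ)⁻¹ := by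
  symm
  apply Matrix.inv_eq_right_inv
  rw [← Matrix.map_mul, Matrix.mul_nonsing_inv _ h, Matrix.map_one _ (map_zero φ) (map_one φ)]

end SmoothFn

end CentralAffine

end

noncomputable section

namespace CentralAffine

/-! ### Central affine frames over a differential ring -/

section Frames

variable {A : Type*} [CommRing A] [Algebra ℝ A] (d : Derivation ℝ A A) {n : ℕ}

lemma der_prod {ι : Type*} [DecidableEq ι] (s : Finset ι) (f : ι → A) :
    d (∏ i ∈ s, f i) = ∑ c ∈ s, d (f c) * ∏ i ∈ s.erase c, f i := by
  induction s using Finset.induction_on with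
  | empty => simp
  | insert k s hk ih =>
    rw [Finset.prod_insert hk, d.leibniz, ih, Finset.sum_insert hk, Finset.erase_insert hk,
      smul_eq_mul, smul_eq_mul, add_comm, Finset.mul_sum, mul_comm]
    congr 1
    refine Finset.sum_congr rfl fun c hc => ?_
    have hck : k ≠ c := fun h => hk (h ▸ hc)
    rw [Finset.erase_insert_of_ne hck, Finset.prod_insert (fun h => hk (Finset.mem_of_mem_erase h))]
    ring

/-- The derivative of a determinant. -/
lemma der_det (M : Matrix (Fin n) (Fin n) A) :
    d M.det = ∑ c, (M.updateCol c fun a => d (M a c)).det := by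
  simp only [Matrix.det_apply', map_sum]
  rw [Finset.sum_comm]
  refine Finset.sum_congr rfl fun σ _ => ?_
  have h1 : d ((Equiv.Perm.sign σ : ℤ) : A) = 0 := by simp
  rw [d.leibniz, h1, smul_zero, add_zero, der_prod, Finset.smul_sum]
  refine Finset.sum_congr rfl fun c _ => ?_
  rw [← Finset.mul_prod_erase _ _ (Finset.mem_univ c), smul_eq_mul]
  congr 2
  · simp
  · refine Finset.prod_congr rfl fun i hi => ?_
    rw [Matrix.updateCol_ne (Finset.ne_of_mem_erase hi)]

/-- The matrix `(γ, γ_x, …, γ_x^{(n-1)})`. -/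
def frameOf (γ : Fin n → A) : Matrix (Fin n) (Fin n) A := Matrix.of fun a c => d^[(c : ℕ)] (γ a)

/-- The central affine curvatures. -/
def curvOf (γ : Fin n → A) (i : ℕ) : A :=
  if hi : i + 1 < n then
    ((frameOf d γ).updateCol ⟨i, Nat.lt_of_succ_lt hi⟩ fun a => d^[n] (γ a)).det
  else 0

/-- Cramer's rule expands `γ_x^{(n)}` in the frame with the curvatures as coefficients. The
coefficient of `γ_x^{(n-1)}` is the derivative of `det g = 1`, since every other term in that
derivative has a repeated column. -/
lemma map_frameOf {γ : Fin n → A} (hdet : (frameOf d γ).det = 1) :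
    (frameOf d γ).map d = frameOf d γ * compMat n (curvOf d γ) := by
  set g := frameOf d γ with hg
  set w : Fin n → A := fun a => d^[n] (γ a) with hw
  have hgd : ∀ (a c : Fin n), d (g a c) = d^[(c : ℕ) + 1] (γ a) := fun a c => by
    rw [Function.iterate_succ_apply']; rfl
  have hcr : g *ᵥ Matrix.cramer g w = w := by rw [Matrix.mulVec_cramer, hdet, one_smul]
  ext a c
  rw [Matrix.map_apply, hgd]
  by_cases hc : (c : ℕ) + 1 = n
  · rw [mul_compMat_apply_last _ _ _ hc, hc]
    have h0 : Matrix.cramer g w c = 0 := by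
      have h1 := der_det d g
      rw [hdet, Derivation.map_one_eq_zero, Finset.sum_eq_single c] at h1
      · rw [Matrix.cramer_apply, h1]
        simp only [hgd, hc, hw]
      · intro k _ hk
        have hk1 : (k : ℕ) + 1 < n := by
          have := k.2
          have : (k : ℕ) ≠ c := fun h => hk (Fin.ext h)
          omega
        refine Matrix.det_zero_of_column_eq (i := k) (j := ⟨k + 1, hk1⟩)
          (by simp [Fin.ext_iff]) fun b => ?_
        rw [Matrix.updateCol_self, Matrix.updateCol_ne (by simp [Fin.ext_iff]), hgd]
        rfl
      · simp
    have h2 := congrFun hcr a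
    change _ = d^[n] (γ a) at h2
    rw [← h2, Matrix.mulVec, dotProduct]
    refine Finset.sum_congr rfl fun i _ => ?_
    congr 1
    split_ifs with hi
    · rw [Matrix.cramer_apply, curvOf, dif_pos hi]
    · have : i = c := Fin.ext (by have := i.2; omega)
      rw [this, h0]
  · rw [mul_compMat_apply g _ a (c := c) (c' := ⟨c + 1, by have := c.2; omega⟩) rfl]
    rfl

variable {d}

lemma iterate_eq_of_map {u : ℕ → A} {g : Matrix (Fin n) (Fin n) A}
    (hg : g.map d = g * compMat n u) {z : Fin n} (hz : (z : ℕ) = 0) :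
    frameOf d (fun a => g a z) = g := by
  have key : ∀ (c : ℕ) (hc : c < n) (a : Fin n), d^[c] (g a z) = g a ⟨c, hc⟩ := by
    intro c
    induction c with
    | zero => intro hc a; have : z = ⟨0, hc⟩ := Fin.ext hz
              rw [← this]; rfl
    | succ c ih =>
      intro hc a
      have h1 := congrFun (congrFun hg a) ⟨c, by omega⟩
      rw [mul_compMat_apply g u a (c := ⟨c, by omega⟩) (c' := ⟨c + 1, hc⟩) rfl] at h1
      rw [Function.iterate_succ_apply', ih (by omega), ← h1]; rfl
  ext a c
  exact key c c.2 a

/-- The converse use of Cramer's rule: any unimodular solution of `g_x = g(b + u)` is the moving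
frame of its first column, with curvature `u`. This identifies the frame and curvature of a
transformed curve. -/
lemma curvOf_eq_of_map {u : ℕ → A} {g : Matrix (Fin n) (Fin n) A}
    (hg : g.map d = g * compMat n u) (hdet : g.det = 1) {z : Fin n} (hz : (z : ℕ) = 0) {i : ℕ}
    (hi : i + 1 < n) : curvOf d (fun a => g a z) i = u i := by
  obtain ⟨l, hl⟩ : ∃ l : Fin n, (l : ℕ) + 1 = n := ⟨⟨n - 1, by omega⟩, by simp; omega⟩
  have hf := iterate_eq_of_map hg hz
  have hw : (fun a => d^[n] (g a z))
      = g *ᵥ fun k : Fin n => if (k : ℕ) + 1 < n then u k else 0 := by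
    funext a
    have h1 : d^[(l : ℕ)] (g a z) = g a l := congrFun (congrFun hf a) l
    have h2 := congrFun (congrFun hg a) l
    rw [mul_compMat_apply_last _ _ _ hl, Matrix.map_apply, ← h1,
      ← Function.iterate_succ_apply' (f := d), Nat.succ_eq_add_one, hl] at h2
    rw [h2]; rfl
  rw [curvOf, dif_pos hi, hf, hw, ← Matrix.cramer_apply, Matrix.cramer_eq_adjugate_mulVec,
    Matrix.mulVec_mulVec, Matrix.adjugate_mul, hdet, one_smul, Matrix.one_mulVec]
  simp [hi]

/-- The whole frame evolves by `g_t = g Z` if its first column does. -/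
lemma map_time_of_first_column {e : Derivation ℝ A A} (hde : ∀ x, d (e x) = e (d x)) {u : ℕ → A}
    {g Z W : Matrix (Fin n) (Fin n) A} (hg : g.map d = g * compMat n u)
    (hZ : IsFlowMatrix d u W Z) {z : Fin n} (hz : (z : ℕ) = 0)
    (h0 : ∀ a, e (g a z) = (g * Z) a z) : g.map e = g * Z := by
  have key : ∀ (c : ℕ) (hc : c < n) (a : Fin n), e (g a ⟨c, hc⟩) = (g * Z) a ⟨c, hc⟩ := by
    intro c
    induction c with
    | zero => intro hc a; have : z = ⟨0, hc⟩ := Fin.ext hz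
              rw [← this]; exact h0 a
    | succ c ih =>
      intro hc a
      have h1 := congrFun (congrFun hg a) ⟨c, by omega⟩
      rw [mul_compMat_apply g u a (c := ⟨c, by omega⟩) (c' := ⟨c + 1, hc⟩) rfl,
        Matrix.map_apply] at h1
      rw [← h1, ← hde, ih (by omega)]
      have h2 : (g * Z).map d = g * (Z.map d + compMat n u * Z) := by
        rw [map_matrix_mul, hg]; noncomm_ring
      have h3 := congrFun (congrFun h2 a) ⟨c, by omega⟩
      rw [Matrix.map_apply] at h3
      rw [h3, Matrix.mul_apply, Matrix.mul_apply]
      refine Finset.sum_congr rfl fun k _ => ?_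
      rw [hZ.succ k (c := ⟨c, by omega⟩) (c' := ⟨c + 1, hc⟩) rfl]
  ext a c
  exact key c c.2 a

end Frames

/-! ### Transfer between functions and the differential algebra -/

open SmoothFn TopologicalSpace

variable {U : Opens (ℝ × ℝ)} {n : ℕ}

/-- `∂_x` on smooth functions. -/
abbrev dx (U : Opens (ℝ × ℝ)) : Derivation ℝ (SmoothFn U) (SmoothFn U) := dir (1, 0)

/-- `∂_t` on smooth functions. -/
abbrev dt (U : Opens (ℝ × ℝ)) : Derivation ℝ (SmoothFn U) (SmoothFn U) := dir (0, 1)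

lemma rep_starCurvAux {u : ℕ → ℝ → ℝ → ℝ} {v : ℕ → SmoothFn U} {h : ℝ → ℝ → ℝ} {k : SmoothFn U}
    (hu : ∀ i, i + 1 < n → Rep (u i) (v i)) (hh : Rep h k) (r : ℕ) (hr : r < n) :
    Rep (starCurvAux n u h r) (starAux (dx U) n v k r) := by
  induction r with
  | zero => intro x t hxt; simp [starCurvAux, starAux]
  | succ r ih =>
    intro x t hxt
    have h1 := ih (by omega)
    have e1 := hu (n - 2 - r) (by omega) x t hxt
    have e2 := h1.deriv_x x t hxt
    have e3 := h1 x t hxt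
    have e4 := fun m => hh.iteratedDeriv_x m x t hxt
    have e5 := hh x t hxt
    simp only [starCurvAux, starAux, map_sub, map_add, map_mul, map_sum,
      map_natCast]
    rw [e1, ← e4, ← e2, ← e3, ← e5]
    congr 4
    refine Finset.sum_congr rfl fun i hi => ?_
    have := Finset.mem_Ico.1 hi
    rw [← e4, hu i (by omega) x t hxt]

lemma rep_starCurv {u : ℕ → ℝ → ℝ → ℝ} {v : ℕ → SmoothFn U} {h : ℝ → ℝ → ℝ} {k : SmoothFn U}
    (hu : ∀ i, i + 1 < n → Rep (u i) (v i)) (hh : Rep h k) (hn : 0 < n) (i : ℕ) :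
    Rep (starCurv n u h i) (star (dx U) n v k i) :=
  rep_starCurvAux hu hh _ (by omega)

lemma repMat_fMat {u : ℕ → ℝ → ℝ → ℝ} {v : ℕ → SmoothFn U} {h : ℝ → ℝ → ℝ} {k : SmoothFn U}
    (hu : ∀ i, i + 1 < n → Rep (u i) (v i)) (hh : Rep h k) :
    RepMat (fun x t => fMat n u h x t 0) (btMat (dx U) n v k) := by
  intro x t hxt
  ext a c
  have hn : 0 < n := by have := a.2; omega
  have e1 := rep_starCurv hu hh hn a x t hxt
  have e2 := fun m => hh.iteratedDeriv_x m x t hxt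
  have e3 := hh x t hxt
  simp only [fMat, btMat, Matrix.map_apply, Matrix.of_apply, nMat, bMat,
    Matrix.add_apply, Matrix.smul_apply, coeff_iterate_der_lin_eq, map_add, map_mul, map_natCast,
    zero_smul, zero_add, Matrix.one_apply, smul_eq_mul]
  rw [← e2]
  have hif : ∀ (p : Prop) [Decidable p] (b : SmoothFn U),
      ev (x, t) hxt (if p then b else 0) = if p then ev (x, t) hxt b else 0 := by
    intro p _ b; split_ifs <;> simp
  rw [hif, hif, map_one, ← e1, add_assoc, add_assoc]
  congr 1
  rcases lt_trichotomy a c with hac | hac | hac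
  · rw [if_pos hac, if_neg hac.ne]; ring
  · subst hac
    have h1 : (if (a : ℕ) + 1 = n then starCurv n u h a x t else 0) = 0 := by
      split_ifs with hl
      · rw [starCurv, show n - 1 - (a : ℕ) = 0 by omega]; rfl
      · rfl
    rw [h1]; simp
  · have h1 : ¬ (c : ℕ) + 1 = n := by
      have := a.2
      have : (c : ℕ) < a := hac
      omega
    rw [if_neg hac.ne', if_neg hac.not_gt, Nat.choose_eq_zero_of_lt hac, if_neg h1]; simp

/-- Coefficientwise extension of a ring homomorphism to Laurent series. -/
def laurentMap {R S : Type*} [CommRing R] [CommRing S] (φ : R →+* S) :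
    LaurentSeries R →+* LaurentSeries S where
  toFun x := HahnSeries.map x φ
  map_one' := by
    ext i
    rw [HahnSeries.map_coeff, HahnSeries.coeff_one, HahnSeries.coeff_one]
    split_ifs <;> simp
  map_mul' x y := HahnSeries.map_mul (φ : R →ₙ+* S)
  map_zero' := by ext i; simp
  map_add' x y := by ext i; simp

@[simp]
lemma coeff_laurentMap {R S : Type*} [CommRing R] [CommRing S] (φ : R →+* S)
    (x : LaurentSeries R) (i : ℤ) :
    HahnSeries.coeff (laurentMap φ x) i = φ (HahnSeries.coeff x i) := rfl

lemma laurent_eq_of_ev {x y : LaurentSeries (SmoothFn U)}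
    (H : ∀ p (h : p ∈ U), laurentMap (ev p h) x = laurentMap (ev p h) y) : x = y := by
  ext i : 2
  refine eq_of_ev fun p h => ?_
  rw [← coeff_laurentMap, H p h, coeff_laurentMap]

lemma map_withLam {R S : Type*} [CommRing R] [CommRing S] (φ : R →+* S)
    (M : Matrix (Fin n) (Fin n) R) : (withLam M).map (laurentMap φ) = withLam (M.map φ) := by
  ext a c i
  rw [Matrix.map_apply, coeff_laurentMap, ← neg_neg i, coeff_withLam, coeff_withLam, map_add]
  congr 1 <;> split_ifs <;> simp

lemma laxMat_eq (u : ℕ → ℝ) : laxMat n u = withLam (bMat n ℝ + uMat n u) := by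
  have h : (bMat n ℝ).map (HahnSeries.C : ℝ →+* LaurentSeries ℝ) = bMat n (LaurentSeries ℝ) := by
    ext a c : 2
    simp only [bMat, Matrix.map_apply, Matrix.of_apply]
    split_ifs <;> simp
  rw [laxMat, withLam_eq, map_cornerMat, Matrix.map_add _ (map_add _), h, ← add_assoc]
  rfl

lemma map_compMat {u : ℕ → ℝ → ℝ → ℝ} {v : ℕ → SmoothFn U}
    (hu : ∀ i, i + 1 < n → Rep (u i) (v i)) (x t : ℝ) (hxt : (x, t) ∈ U) :
    (compMat n v).map (ev (x, t) hxt) = bMat n ℝ + uMat n (fun m => u m x t) := by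
  ext a c
  simp only [compMat, bMat, curvMat, uMat, Matrix.map_apply, Matrix.add_apply, Matrix.of_apply,
    map_add]
  congr 1
  · split_ifs <;> simp
  · split_ifs with h
    · exact (hu a h.2 x t hxt).symm
    · simp

lemma map_laurentMap_pow (φ : SmoothFn U →+* ℝ)
    (M : Matrix (Fin n) (Fin n) (LaurentSeries (SmoothFn U))) (k : ℕ) :
    (M ^ k).map (laurentMap φ) = M.map (laurentMap φ) ^ k := by
  induction k with
  | zero => rw [pow_zero, pow_zero, Matrix.map_one _ (map_zero _) (map_one _)]
  | succ k ih => rw [pow_succ, pow_succ, Matrix.map_mul, ih]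

lemma map_lam_smul_one {R S : Type*} [CommRing R] [CommRing S] (φ : R →+* S) :
    (lamOf R • (1 : Matrix (Fin n) (Fin n) (LaurentSeries R))).map (laurentMap φ)
      = lamOf S • 1 := by
  ext a c i
  rw [Matrix.map_apply, coeff_laurentMap, Matrix.smul_apply, Matrix.smul_apply, Matrix.one_apply,
    Matrix.one_apply]
  split_ifs
  · rw [smul_eq_mul, smul_eq_mul, mul_one, mul_one, lamOf, lamOf, HahnSeries.coeff_single,
      HahnSeries.coeff_single]
    split_ifs <;> simp
  · simp

/-- The value at a point of a matrix of series of smooth functions. -/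
def evSeries (Y : Matrix (Fin n) (Fin n) (LaurentSeries (SmoothFn U))) (x t : ℝ) :
    Matrix (Fin n) (Fin n) (LaurentSeries ℝ) := by
  classical exact if h : (x, t) ∈ U then Y.map (laurentMap (ev (x, t) h)) else 0

lemma evSeries_of_mem (Y : Matrix (Fin n) (Fin n) (LaurentSeries (SmoothFn U))) {x t : ℝ}
    (h : (x, t) ∈ U) : evSeries Y x t = Y.map (laurentMap (ev (x, t) h)) := dif_pos h

lemma rep_lamCoeff {Y : ℝ → ℝ → Matrix (Fin n) (Fin n) (LaurentSeries ℝ)}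
    {Ya : Matrix (Fin n) (Fin n) (LaurentSeries (SmoothFn U))}
    (hY : ∀ x t (h : (x, t) ∈ U), Y x t = Ya.map (laurentMap (ev (x, t) h))) (i : ℤ)
    (a c : Fin n) : Rep (fun x t => lamCoeff i (Y x t) a c) (laurentCoeff i Ya a c) := by
  intro x t hxt
  change lamCoeff i (Y x t) a c = _
  rw [hY x t hxt]; rfl

/-- The pointwise and the algebraic commutation relations agree. -/
lemma commute_iff {u : ℕ → ℝ → ℝ → ℝ} {v : ℕ → SmoothFn U}
    (hu : ∀ i, i + 1 < n → Rep (u i) (v i))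
    {Y : ℝ → ℝ → Matrix (Fin n) (Fin n) (LaurentSeries ℝ)}
    {Ya : Matrix (Fin n) (Fin n) (LaurentSeries (SmoothFn U))}
    (hY : ∀ x t (h : (x, t) ∈ U), Y x t = Ya.map (laurentMap (ev (x, t) h)))
    {x t : ℝ} (hxt : (x, t) ∈ U) (i : ℤ) (a c : Fin n) :
    deriv (fun y => lamCoeff i (Y y t) a c) x
      + lamCoeff i (laxMat n (fun m => u m x t) * Y x t
          - Y x t * laxMat n (fun m => u m x t)) a c
      = ev (x, t) hxt (laurentCoeff i (Ya.map (laurentDer (dx U)) + withLam (compMat n v) * Ya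
          - Ya * withLam (compMat n v)) a c) := by
  have h1 := (rep_lamCoeff hY i a c).deriv_x x t hxt
  change deriv (fun y => lamCoeff i (Y y t) a c) x = _ at h1
  have h2 : laxMat n (fun m => u m x t) * Y x t - Y x t * laxMat n (fun m => u m x t)
      = (withLam (compMat n v) * Ya - Ya * withLam (compMat n v)).map
          (laurentMap (ev (x, t) hxt)) := by
    rw [Matrix.map_sub _ (map_sub _), Matrix.map_mul, Matrix.map_mul, map_withLam,
      map_compMat hu x t hxt, laxMat_eq, hY x t hxt]
  rw [h1, h2, add_sub_assoc]
  change _ = ev (x, t) hxt (laurentCoeff i (Ya.map (laurentDer (dx U))) a c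
    + laurentCoeff i (withLam (compMat n v) * Ya - Ya * withLam (compMat n v)) a c)
  rw [map_add]
  rfl

lemma IsY.exists_isSeries {u : ℕ → ℝ → ℝ → ℝ} {v : ℕ → SmoothFn U}
    (hu : ∀ i, i + 1 < n → Rep (u i) (v i))
    {Y : ℝ → ℝ → Matrix (Fin n) (Fin n) (LaurentSeries ℝ)} (hY : IsY n U u Y) :
    ∃ Ya : Matrix (Fin n) (Fin n) (LaurentSeries (SmoothFn U)),
      (∀ x t (h : (x, t) ∈ U), Y x t = Ya.map (laurentMap (ev (x, t) h))) ∧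
      IsSeries (dx U) v Ya := by
  choose y hy using fun (i : ℤ) (a c : Fin n) => exists_rep (U := U) (F := fun x t => lamCoeff i (Y x t) a c) (hY.smooth i a c)
  have hbdd : ∀ a c, ∀ m : ℤ, m < -1 → y (-m) a c = 0 := by
    intro a c m hm
    refine eq_of_ev fun p hp => ?_
    refine (hy (-m) a c p.1 p.2 hp).symm.trans ?_
    change lamCoeff (-m) (Y p.1 p.2) a c = _
    rw [hY.degree_le p.1 p.2 hp (-m) (by omega), map_zero]; rfl
  -- The pointwise series glue to one series of functions because the bound on the power of `λ` is
  -- uniform on `U`: indices below `-1`, that is powers above `λ^1`, vanish.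
  let Ya : Matrix (Fin n) (Fin n) (LaurentSeries (SmoothFn U)) := Matrix.of fun a c =>
    HahnSeries.ofSuppBddBelow (fun m => y (-m) a c)
      ⟨-1, fun m hm => not_lt.1 fun h => hm (hbdd a c m h)⟩
  have hYa : ∀ x t (h : (x, t) ∈ U), Y x t = Ya.map (laurentMap (ev (x, t) h)) := by
    intro x t h
    ext a c i
    rw [Matrix.map_apply, coeff_laurentMap]
    have := hy (-i) a c x t h
    simp only [lamCoeff, Matrix.of_apply, neg_neg] at this
    rw [this]
    rfl
  have hcoef : ∀ (i : ℤ) (a c : Fin n) p (h : p ∈ U),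
      ev p h (laurentCoeff i Ya a c) = lamCoeff i (Y p.1 p.2) a c :=
    fun i a c p h => (rep_lamCoeff hYa i a c p.1 p.2 h).symm
  refine ⟨Ya, hYa, ?_, ?_, ?_, ?_, ?_⟩
  · refine laurent_eq_of_ev fun p h => ?_
    rw [map_zero, ← hY.trace_zero p.1 p.2 h, hYa p.1 p.2 h]
    simp [Matrix.trace]
  · intro i hi
    refine Matrix.ext fun a c => eq_of_ev fun p h => ?_
    rw [hcoef, hY.degree_le p.1 p.2 h i hi]; simp
  · refine Matrix.ext fun a c => eq_of_ev fun p h => ?_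
    rw [hcoef, hY.leading p.1 p.2 h, ← map_cornerMat (ev p h)]; rfl
  · ext a c i : 3
    refine eq_of_ev fun p h => ?_
    have h1 := commute_iff hu hYa h (-i) a c
    rw [hY.commute p.1 p.2 h] at h1
    rw [laurentCoeff, Matrix.of_apply, neg_neg] at h1
    rw [← h1]; simp
  · refine Matrix.ext fun a c => laurent_eq_of_ev fun p h => ?_
    have h1 := hY.pow_eq p.1 p.2 h
    rw [hYa p.1 p.2 h, ← map_laurentMap_pow] at h1
    have h2 := map_lam_smul_one (n := n) (ev p h)
    exact (congrFun (congrFun h1 a) c).trans (congrFun (congrFun h2 a) c).symm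

lemma IsSeries.isY {u : ℕ → ℝ → ℝ → ℝ} {v : ℕ → SmoothFn U}
    (hu : ∀ i, i + 1 < n → Rep (u i) (v i))
    {Ya : Matrix (Fin n) (Fin n) (LaurentSeries (SmoothFn U))} (hYa : IsSeries (dx U) v Ya) :
    IsY n U u (evSeries Ya) := by
  have hY : ∀ x t (h : (x, t) ∈ U), evSeries Ya x t = Ya.map (laurentMap (ev (x, t) h)) :=
    fun x t h => evSeries_of_mem Ya h
  have hcoef : ∀ (i : ℤ) x t (h : (x, t) ∈ U),
      lamCoeff i (evSeries Ya x t) = (laurentCoeff i Ya).map (ev (x, t) h) := by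
    intro i x t h
    ext a c
    exact rep_lamCoeff hY i a c x t h
  refine ⟨?_, ?_, ?_, ?_, ?_, ?_⟩
  · exact fun i a c => (rep_lamCoeff hY i a c).contDiffOn
  · intro x t h
    have h1 := congrArg (laurentMap (ev (x, t) h)) hYa.trace_zero
    rw [map_zero] at h1
    rw [hY x t h, ← h1]
    simp [Matrix.trace]
  · intro x t h i hi
    rw [hcoef i x t h, hYa.degree_le i hi]; ext a c; simp
  · intro x t h
    rw [hcoef 1 x t h, hYa.leading, map_cornerMat]
  · intro x t h i a c
    rw [commute_iff hu hY h, hYa.commute]; simp [laurentCoeff]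
  · intro x t h
    rw [hY x t h, ← map_laurentMap_pow, hYa.pow_eq, map_lam_smul_one]; rfl

/-- The pointwise and the algebraic versions of `[∂_x + b + u, Z]` agree. -/
lemma repMat_covariant {u : ℕ → ℝ → ℝ → ℝ} {v : ℕ → SmoothFn U}
    (hu : ∀ i, i + 1 < n → Rep (u i) (v i)) {Z : ℝ → ℝ → Matrix (Fin n) (Fin n) ℝ}
    {Za : Matrix (Fin n) (Fin n) (SmoothFn U)} (hZ : RepMat Z Za) :
    RepMat (fun x t => Matrix.of (fun a c => deriv (fun y => Z y t a c) x)
        + (bMat n ℝ + uMat n (fun m => u m x t)) * Z x t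
        - Z x t * (bMat n ℝ + uMat n (fun m => u m x t)))
      (Za.map (dx U) + compMat n v * Za - Za * compMat n v) := by
  intro x t hxt
  have h1 : (Matrix.of fun a c => deriv (fun y => Z y t a c) x)
      = (Za.map (dx U)).map (ev (x, t) hxt) := by
    ext a c
    exact (hZ.apply a c).deriv_x x t hxt
  change (Matrix.of fun a c => deriv (fun y => Z y t a c) x)
    + (bMat n ℝ + uMat n (fun m => u m x t)) * Z x t
    - Z x t * (bMat n ℝ + uMat n (fun m => u m x t)) = _
  rw [h1, ← map_compMat hu x t hxt, hZ x t hxt, ← Matrix.map_mul, ← Matrix.map_mul,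
    ← Matrix.map_add _ (map_add _), ← Matrix.map_sub _ (map_sub _)]

lemma repMat_lamCoeff_pow {Y : ℝ → ℝ → Matrix (Fin n) (Fin n) (LaurentSeries ℝ)}
    {Ya : Matrix (Fin n) (Fin n) (LaurentSeries (SmoothFn U))}
    (hY : ∀ x t (h : (x, t) ∈ U), Y x t = Ya.map (laurentMap (ev (x, t) h))) (i : ℤ) (j : ℕ) :
    RepMat (fun x t => lamCoeff i (Y x t ^ j)) (laurentCoeff i (Ya ^ j)) := by
  have h1 : ∀ x t (h : (x, t) ∈ U), Y x t ^ j = (Ya ^ j).map (laurentMap (ev (x, t) h)) :=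
    fun x t h => by rw [hY x t h, map_laurentMap_pow]
  intro x t hxt
  ext a c
  exact rep_lamCoeff h1 i a c x t hxt

lemma IsZ.exists_isFlowMatrix {j : ℕ} {u : ℕ → ℝ → ℝ → ℝ} {v : ℕ → SmoothFn U}
    (hu : ∀ i, i + 1 < n → Rep (u i) (v i)) {Z : ℝ → ℝ → Matrix (Fin n) (Fin n) ℝ}
    (hZ : IsZ n j U u Z) :
    ∃ (Ya : Matrix (Fin n) (Fin n) (LaurentSeries (SmoothFn U)))
      (Za : Matrix (Fin n) (Fin n) (SmoothFn U)),
      IsSeries (dx U) v Ya ∧ IsFlowMatrix (dx U) v (laurentCoeff 0 (Ya ^ j)) Za ∧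
        RepMat Z Za := by
  obtain ⟨Y, ζ, hY, hζ, hζ0, hZζ, hmem⟩ := hZ
  obtain ⟨Ya, hYa, hs⟩ := hY.exists_isSeries hu
  choose z hz using fun a c : Fin n => exists_rep (U := U) (F := fun x t => ζ x t a c) (hζ a c)
  have hW := repMat_lamCoeff_pow hYa 0 j
  have hrep : RepMat Z (laurentCoeff 0 (Ya ^ j) - Matrix.of z) := by
    intro x t hxt
    have h1 := hW x t hxt
    change lamCoeff 0 (Y x t ^ j) = _ at h1
    rw [hZζ x t hxt, h1, Matrix.map_sub _ (map_sub _)]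
    congr 1
    ext a c
    exact hz a c x t hxt
  refine ⟨Ya, _, hs, ⟨?_, ?_⟩, hrep⟩
  · intro a c hca
    rw [Matrix.sub_apply, sub_eq_self]
    refine eq_of_ev fun p hp => ?_
    rw [map_zero, ← hζ0 p.1 p.2 hp a c hca]
    exact (hz a c p.1 p.2 hp).symm
  · intro a c hac
    refine eq_of_ev fun p hp => ?_
    rw [map_zero, ← hmem p.1 p.2 hp a c hac]
    exact ((repMat_covariant hu hrep).apply a c p.1 p.2 hp).symm

lemma IsFlowMatrix.isZ {j : ℕ} {u : ℕ → ℝ → ℝ → ℝ} {v : ℕ → SmoothFn U}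
    (hu : ∀ i, i + 1 < n → Rep (u i) (v i))
    {Ya : Matrix (Fin n) (Fin n) (LaurentSeries (SmoothFn U))}
    {Za : Matrix (Fin n) (Fin n) (SmoothFn U)} (hs : IsSeries (dx U) v Ya)
    (hZ : IsFlowMatrix (dx U) v (laurentCoeff 0 (Ya ^ j)) Za) :
    IsZ n j U u (fun x t => Matrix.of fun a c => ext (Za a c) (x, t)) := by
  have hY : ∀ x t (h : (x, t) ∈ U), evSeries Ya x t = Ya.map (laurentMap (ev (x, t) h)) :=
    fun x t h => evSeries_of_mem Ya h
  have hW := repMat_lamCoeff_pow hY 0 j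
  have hrep : RepMat (fun x t => Matrix.of fun a c => ext (Za a c) (x, t)) Za := by
    intro x t hxt
    ext a c
    exact ext_eq_ev _ hxt
  have hsub : RepMat (fun x t => lamCoeff 0 (evSeries Ya x t ^ j)
      - Matrix.of fun a c => ext (Za a c) (x, t)) (laurentCoeff 0 (Ya ^ j) - Za) := by
    intro x t hxt
    have h1 := hW x t hxt
    have h2 := hrep x t hxt
    change lamCoeff 0 (evSeries Ya x t ^ j) = _ at h1
    change (Matrix.of fun a c => ext (Za a c) (x, t)) = _ at h2
    change lamCoeff 0 (evSeries Ya x t ^ j) - (Matrix.of fun a c => ext (Za a c) (x, t)) = _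
    rw [h1, h2, Matrix.map_sub _ (map_sub _)]
  refine ⟨evSeries Ya, fun x t => lamCoeff 0 (evSeries Ya x t ^ j)
    - Matrix.of fun a c => ext (Za a c) (x, t), hs.isY hu, fun a c => (hsub.apply a c).contDiffOn, ?_, ?_, ?_⟩
  · intro x t hxt a c hca
    refine (hsub.apply a c x t hxt).trans ?_
    rw [Matrix.sub_apply, hZ.lower a c hca, sub_self, map_zero]
  · intro x t _
    exact (sub_sub_cancel _ _).symm
  · intro x t hxt a c hac
    refine ((repMat_covariant hu hrep).apply a c x t hxt).trans ?_
    rw [hZ.memV a c hac, map_zero]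

end CentralAffine

end

noncomputable section

namespace CentralAffine

/-! ### The Bäcklund equations over a differential ring and their iteration -/

section Permutability

open DiffOp

variable {A : Type*} [CommRing A] [Algebra ℝ A] {d : Derivation ℝ A A} {n : ℕ}

variable (d n) in
/-- `h` is a solution of the Bäcklund equations for `u` with parameter `k`, where `Z` is the matrix
of the `j`-th flow of `u`. -/
structure IsBacklund (e : Derivation ℝ A A) (j : ℕ) (u : ℕ → A) (Z : Matrix (Fin n) (Fin n) A)
    (h k : A) : Prop where
  darboux : IsDarboux d n u h k
  time : ∃ (Y' : Matrix (Fin n) (Fin n) (LaurentSeries A)) (Z' : Matrix (Fin n) (Fin n) A),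
    IsSeries d (star d n u h) Y' ∧
    IsFlowMatrix d (star d n u h) (laurentCoeff 0 (Y' ^ j)) Z' ∧
    ∀ z : Fin n, (z : ℕ) = 0 → e h = (btMat d n u h * Z - Z' * btMat d n u h) z z

lemma IsDarboux.isUnit_det (hn : 2 ≤ n) {u : ℕ → A} {h k : A} (H : IsDarboux d n u h k)
    (hk : IsUnit k) : IsUnit (btMat d n u h).det := by
  rw [H.det hn]; exact IsUnit.mul (IsUnit.pow _ isUnit_one.neg) hk

/-- Two successive Bäcklund transformations of a moving frame. -/
lemma IsFlowFrame.permute [IsReduced A] (hn : 2 ≤ n) {e : Derivation ℝ A A}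
    (hde : ∀ x, d (e x) = e (d x)) {j : ℕ} {u : ℕ → A} {h₁ h₂ m₁ m₂ k₁ k₂ : A}
    {Y : Matrix (Fin n) (Fin n) (LaurentSeries A)} {Z g D₁ D₂ : Matrix (Fin n) (Fin n) A}
    (hg : IsFlowFrame d n e j u Y Z g)
    (B₁ : IsBacklund d n e j u Z h₁ k₁) (B₂ : IsBacklund d n e j u Z h₂ k₂)
    (hc : Compatible d h₁ h₂ m₁ m₂) (hu : IsUnit (h₁ - h₂))
    (hk₁ : d k₁ = 0) (hk₂ : d k₂ = 0) (hk₁' : IsUnit k₁) (hk₂' : IsUnit k₂)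
    (hD₁d : D₁.map d = 0) (hD₁e : D₁.map e = 0) (hD₁ : D₁.det = (-1) ^ n * k₁)
    (hD₂d : D₂.map d = 0) (hD₂e : D₂.map e = 0) (hD₂ : D₂.det = (-1) ^ n * k₂) :
    (∃ Y₁ Z₁, IsFlowFrame d n e j (star d n u h₁) Y₁ Z₁ (D₁ * g * (btMat d n u h₁)⁻¹)) ∧
    ∃ Y₁₂ Z₁₂, IsFlowFrame d n e j (star d n (star d n u h₁) m₂) Y₁₂ Z₁₂
      (D₂ * (D₁ * g * (btMat d n u h₁)⁻¹) * (btMat d n (star d n u h₁) m₂)⁻¹) := by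
  obtain ⟨H₁, Y₁, Z₁, hY₁, hZ₁, ht₁⟩ := B₁
  obtain ⟨H₂, Y₂, Z₂, hY₂, hZ₂, ht₂⟩ := B₂
  obtain ⟨z, hz⟩ : ∃ z : Fin n, (z : ℕ) = 0 := ⟨⟨0, by omega⟩, rfl⟩
  obtain ⟨F₁, e₁⟩ := hg.transform hn hde H₁ hk₁' hY₁ hZ₁ hz (ht₁ z hz) hD₁d hD₁e hD₁
  obtain ⟨-, e₂⟩ := hg.transform hn hde H₂ hk₂' hY₂ hZ₂ hz (ht₂ z hz) hD₂d hD₂e hD₂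
  have hu' : IsUnit (h₂ - h₁) := by rw [← neg_sub]; exact hu.neg
  have H₁₂ := IsDarboux.permute hn hc hu hk₂ H₁ H₂
  have H₂₁ := IsDarboux.permute hn hc.symm hu' hk₁ H₂ H₁
  have hs := star_star_eq hc H₁ H₂ H₁₂ H₂₁
  -- The flow data of the doubly transformed curvature are constructed by conjugation. By `hs` they
  -- also serve for the other order of the transformations.
  obtain ⟨Y₁₂, hY₁₂, c₁₂⟩ := H₁₂.exists_isSeries hn hY₁
  obtain ⟨Z₁₂, hZ₁₂⟩ := hY₁₂.exists_isFlowMatrix hn j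
  have c₂₁ := H₂₁.intertwine hn hY₂ (hs ▸ hY₁₂)
  have ht := map_time_permute hn hde hc hu H₁ H₂ H₁₂ H₂₁ hZ₁ hZ₂ hZ₁₂ e₁ e₂ hz
    (fun a ha => flow_first_column hn c₁₂ hZ₁ hZ₁₂ hz ha)
    (fun a ha => flow_first_column hn c₂₁ hZ₂ hZ₁₂ hz ha)
  exact ⟨⟨Y₁, Z₁, F₁⟩, Y₁₂, Z₁₂,
    (F₁.transform hn hde H₁₂ hk₂' hY₁₂ hZ₁₂ hz ht hD₂d hD₂e hD₂).1⟩

end Permutability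

/-! ### Curves and moving frames -/

open SmoothFn TopologicalSpace DiffOp

variable {U : Opens (ℝ × ℝ)} {n : ℕ}

lemma dx_dt (a : SmoothFn U) : dx U (dt U a) = dt U (dx U a) := dir_comm _ _ a

lemma repMat_frame {γ : ℝ → ℝ → Fin n → ℝ} {γa : Fin n → SmoothFn U}
    (hγ : ∀ a, Rep (fun x t => γ x t a) (γa a)) : RepMat (frame n γ) (frameOf (dx U) γa) := by
  intro x t hxt
  ext a c
  exact (hγ a).iteratedDeriv_x c x t hxt

lemma rep_curv {γ : ℝ → ℝ → Fin n → ℝ} {γa : Fin n → SmoothFn U}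
    (hγ : ∀ a, Rep (fun x t => γ x t a) (γa a)) (i : ℕ) :
    Rep (curv n γ i) (curvOf (dx U) γa i) := by
  intro x t hxt
  unfold curv curvOf
  split_ifs with hi
  · rw [RingHom.map_det]
    congr 1
    ext a c
    rw [RingHom.mapMatrix_apply, Matrix.map_apply, Matrix.updateCol_apply, Matrix.updateCol_apply]
    split_ifs
    · exact (hγ a).iteratedDeriv_x n x t hxt
    · exact (repMat_frame hγ).apply a c x t hxt
  · rw [map_zero]

lemma mulVec_e1 (M : Matrix (Fin n) (Fin n) ℝ) (a : Fin n) {z : Fin n} (hz : (z : ℕ) = 0) :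
    (M *ᵥ e1 n) a = M a z := by
  rw [Matrix.mulVec, dotProduct, Finset.sum_eq_single z]
  · rw [e1, if_pos hz, mul_one]
  · intro k _ hk
    rw [e1, if_neg (fun h => hk (Fin.ext (by omega))), mul_zero]
  · simp

lemma det_eq_iff_of_repMat {M : ℝ → ℝ → Matrix (Fin n) (Fin n) ℝ}
    {N : Matrix (Fin n) (Fin n) (SmoothFn U)} (h : RepMat M N) {b : SmoothFn U} :
    N.det = b ↔ ∀ x t (hxt : (x, t) ∈ U), (M x t).det = ev (x, t) hxt b := by
  have h1 : ∀ x t (hxt : (x, t) ∈ U), (M x t).det = ev (x, t) hxt N.det := fun x t hxt => by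
    rw [h x t hxt, RingHom.map_det]; rfl
  constructor
  · rintro rfl; exact h1
  · exact fun H => eq_of_ev fun p hp => (h1 p.1 p.2 hp).symm.trans (H p.1 p.2 hp)

lemma IsCurveFlowSolution.exists_isFlowFrame {j : ℕ} (hn : 2 ≤ n) {γ : ℝ → ℝ → Fin n → ℝ}
    (hγ : IsCurveFlowSolution n j U γ) :
    ∃ (v : ℕ → SmoothFn U) (Y : Matrix (Fin n) (Fin n) (LaurentSeries (SmoothFn U)))
      (Z g : Matrix (Fin n) (Fin n) (SmoothFn U)),
      (∀ i, Rep (curv n γ i) (v i)) ∧ RepMat (frame n γ) g ∧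
        IsFlowFrame (dx U) n (dt U) j v Y Z g := by
  obtain ⟨hs, hdet, Z, hZ, ht⟩ := hγ
  choose γa hγa using fun a : Fin n => exists_rep (U := U) (F := fun x t => γ x t a) (hs a)
  have hf := repMat_frame hγa
  have hdet' : (frameOf (dx U) γa).det = 1 :=
    (det_eq_iff_of_repMat hf).2 fun x t hxt => by rw [hdet x t hxt, map_one]
  have hx := map_frameOf (dx U) hdet'
  obtain ⟨Y, Za, hY, hZa, hrep⟩ := hZ.exists_isFlowMatrix (fun i _ => rep_curv hγa i)
  obtain ⟨z, hz⟩ : ∃ z : Fin n, (z : ℕ) = 0 := ⟨⟨0, by omega⟩, rfl⟩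
  have h0 : ∀ a, frameOf (dx U) γa a z = γa a := fun a => by
    rw [frameOf, Matrix.of_apply, hz, Function.iterate_zero, id]
  have h1 : ∀ a, dt U (frameOf (dx U) γa a z) = (frameOf (dx U) γa * Za) a z := fun a => by
    rw [h0]
    refine eq_of_ev fun p hp => ?_
    refine ((hγa a).deriv_t p.1 p.2 hp).symm.trans ((ht p.1 p.2 hp a).trans ?_)
    rw [mulVec_e1 _ a hz, hf p.1 p.2 hp, hrep p.1 p.2 hp, ← Matrix.map_mul, Matrix.map_apply]
  have h2 := map_time_of_first_column dx_dt hx hZa hz h1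
  exact ⟨curvOf (dx U) γa, Y, Za, frameOf (dx U) γa, rep_curv hγa, hf, ⟨hY, hZa, hx, h2, hdet'⟩⟩

/-- The first column of a moving frame of the `j`-th flow is a solution of the curve flow. -/
lemma IsFlowFrame.curve {j : ℕ} (hn : 2 ≤ n) {v : ℕ → SmoothFn U}
    {Y : Matrix (Fin n) (Fin n) (LaurentSeries (SmoothFn U))}
    {Z g : Matrix (Fin n) (Fin n) (SmoothFn U)} (hg : IsFlowFrame (dx U) n (dt U) j v Y Z g)
    {G : ℝ → ℝ → Matrix (Fin n) (Fin n) ℝ} (hG : RepMat G g) :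
    RepMat (frame n fun x t => G x t *ᵥ e1 n) g ∧
      (∀ i, i + 1 < n → Rep (curv n (fun x t => G x t *ᵥ e1 n) i) (v i)) ∧
      IsCurveFlowSolution n j U (fun x t => G x t *ᵥ e1 n) := by
  obtain ⟨z, hz⟩ : ∃ z : Fin n, (z : ℕ) = 0 := ⟨⟨0, by omega⟩, rfl⟩
  have hγ : ∀ a, Rep (fun x t => (G x t *ᵥ e1 n) a) (g a z) := fun a x t hxt =>
    (mulVec_e1 _ a hz).trans (hG.apply a z x t hxt)
  have hf : RepMat (frame n fun x t => G x t *ᵥ e1 n) g := by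
    have := repMat_frame hγ
    rwa [iterate_eq_of_map hg.map_x hz] at this
  have hu : ∀ i, i + 1 < n → Rep (curv n (fun x t => G x t *ᵥ e1 n) i) (v i) := fun i hi => by
    have := rep_curv hγ i
    rwa [curvOf_eq_of_map hg.map_x hg.det hz hi] at this
  refine ⟨hf, hu, fun a => (hγ a).contDiffOn, fun x t hxt => ?_, _, hg.flow.isZ hu hg.series,
    fun x t hxt a => ?_⟩
  · rw [(det_eq_iff_of_repMat hf).1 hg.det x t hxt, map_one]
  · rw [mulVec_e1 _ a hz, hf x t hxt]
    refine ((hγ a).deriv_t x t hxt).trans ?_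
    have h1 : (Matrix.of fun a c => ext (Z a c) (x, t)) = Z.map (ev (x, t) hxt) := by
      ext a c
      exact ext_eq_ev _ hxt
    rw [h1, ← Matrix.map_mul, ← hg.map_t]
    rfl

lemma IsBT.exists_isBacklund {j : ℕ} (hn : 2 ≤ n) {u : ℕ → ℝ → ℝ → ℝ} {v : ℕ → SmoothFn U}
    (hu : ∀ i, i + 1 < n → Rep (u i) (v i))
    {Y : Matrix (Fin n) (Fin n) (LaurentSeries (SmoothFn U))}
    {Z : Matrix (Fin n) (Fin n) (SmoothFn U)} (hY : IsSeries (dx U) v Y)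
    (hZ : IsFlowMatrix (dx U) v (laurentCoeff 0 (Y ^ j)) Z) {k : ℝ} {h : ℝ → ℝ → ℝ}
    (hh : IsBT n j U u k h) :
    ∃ ha : SmoothFn U, Rep h ha ∧ IsBacklund (dx U) n (dt U) j v Z ha (algebraMap ℝ _ k) := by
  obtain ⟨hs, hdet, Z₀, Z', hZ₀, hZ', ht⟩ := hh
  obtain ⟨ha, hha⟩ := exists_rep (U := U) (F := h) hs
  have hf := repMat_fMat hu hha
  obtain ⟨Y₀, Za, hY₀, hZa, hrep⟩ := hZ₀.exists_isFlowMatrix hu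
  obtain ⟨Y', Za', hY', hZa', hrep'⟩ :=
    hZ'.exists_isFlowMatrix (fun i _ => rep_starCurv hu hha (by omega) i)
  -- The flow matrix chosen in the Bäcklund equation and the one carried by the curve need not be
  -- the same a priori; uniqueness of `Y` and of `Z` identifies them.
  obtain rfl := hY₀.unique hn hY
  obtain rfl := hZa.unique hZ
  refine ⟨ha, hha, IsDarboux.of_det hn ((dx U).map_algebraMap k) ?_,
    Y', Za', hY', hZa', fun z hz => eq_of_ev fun p hp => ?_⟩
  · refine (det_eq_iff_of_repMat hf).2 fun x t hxt => ?_
    rw [hdet x t hxt, map_mul, map_pow, map_neg, map_one, ev_algebraMap]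
    obtain ⟨m, rfl⟩ : ∃ m, n = m + 1 := ⟨n - 1, by omega⟩
    rw [Nat.add_sub_cancel, pow_succ]; ring
  · rw [← hha.deriv_t p.1 p.2 hp]
    refine (ht p.1 p.2 hp z hz).trans ?_
    have h1 := hf p.1 p.2 hp
    change fMat n u h p.1 p.2 0 = _ at h1
    rw [h1, hrep p.1 p.2 hp, hrep' p.1 p.2 hp, ← Matrix.map_mul, ← Matrix.map_mul,
      ← Matrix.map_sub _ (map_sub _)]
    rfl

/-- A constant matrix. -/
def constMat (U : Opens (ℝ × ℝ)) (D : Matrix (Fin n) (Fin n) ℝ) :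
    Matrix (Fin n) (Fin n) (SmoothFn U) := D.map (algebraMap ℝ (SmoothFn U))

lemma constMat_map (D : Matrix (Fin n) (Fin n) ℝ) (δ : Derivation ℝ (SmoothFn U) (SmoothFn U)) :
    (constMat U D).map δ = 0 :=
  Matrix.ext fun a c => δ.map_algebraMap (D a c)

lemma det_constMat {D : Matrix (Fin n) (Fin n) ℝ} {k : ℝ} (hD : D.det = (-1) ^ n * k) :
    (constMat U D).det = (-1) ^ n * algebraMap ℝ (SmoothFn U) k := by
  have := (algebraMap ℝ (SmoothFn U)).map_det D
  rw [hD, map_mul, map_pow, map_neg, map_one] at this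
  exact this.symm

lemma repMat_btFrame (D : Matrix (Fin n) (Fin n) ℝ) {g : ℝ → ℝ → Matrix (Fin n) (Fin n) ℝ}
    {ga : Matrix (Fin n) (Fin n) (SmoothFn U)} (hg : RepMat g ga)
    {u : ℕ → ℝ → ℝ → ℝ} {v : ℕ → SmoothFn U} (hu : ∀ i, i + 1 < n → Rep (u i) (v i))
    {h : ℝ → ℝ → ℝ} {ha : SmoothFn U} (hh : Rep h ha)
    (hdet : IsUnit (btMat (dx U) n v ha).det) :
    RepMat (btFrame n D g u h) (constMat U D * ga * (btMat (dx U) n v ha)⁻¹) := by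
  intro x t hxt
  have h1 := repMat_fMat hu hh x t hxt
  change fMat n u h x t 0 = _ at h1
  rw [btFrame, h1, hg x t hxt, Matrix.map_mul, Matrix.map_mul, map_inv_of_isUnit _ hdet]
  rfl

/-- The compatible pair determined by two functions with invertible difference. -/
lemma compatible_of_mul_eq_one {A : Type*} [CommRing A] [Algebra ℝ A] (d : Derivation ℝ A A)
    {h₁ h₂ w : A} (hw : (h₁ - h₂) * w = 1) :
    Compatible d h₁ h₂ (h₁ + d (h₁ - h₂) * w) (h₂ + d (h₁ - h₂) * w) := by
  refine ⟨by ring, ?_⟩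
  rw [map_add, map_add]
  have h1 : d h₁ - d h₂ = d (h₁ - h₂) := (map_sub d _ _).symm
  linear_combination (d (h₁ - h₂)) * hw - h1

lemma rep_permShift {h₁ h₂ : ℝ → ℝ → ℝ} {a₁ a₂ w : SmoothFn U} (H₁ : Rep h₁ a₁) (H₂ : Rep h₂ a₂)
    (hw : (a₁ - a₂) * w = 1) : Rep (permShift h₁ h₂) (dx U (a₁ - a₂) * w) := by
  have hs : Rep (fun x t => h₁ x t - h₂ x t) (a₁ - a₂) := fun x t hxt => by
    rw [map_sub, ← H₁ x t hxt, ← H₂ x t hxt]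
  intro x t hxt
  have h1 := hs x t hxt
  have h2 : ev (x, t) hxt (a₁ - a₂) * ev (x, t) hxt w = 1 := by rw [← map_mul, hw, map_one]
  have h3 := hs.deriv_x x t hxt
  change h₁ x t - h₂ x t = _ at h1
  change deriv (fun y => h₁ y t - h₂ y t) x = _ at h3
  rw [permShift, h3, h1, map_mul, div_eq_mul_inv, eq_inv_of_mul_eq_one_right h2]

end CentralAffine

end

/-! ### Permutability for curves -/

theorem mainTheorem6 (n j : ℕ) (hn : 2 ≤ n) (hj : ¬ n ∣ j)
    (U : Set (ℝ × ℝ)) (hU : IsOpen U)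
    (γ : ℝ → ℝ → Fin n → ℝ) (hγ : CentralAffine.IsCurveFlowSolution n j U γ)
    (k₁ k₂ : ℝ) (hk₁ : k₁ ≠ 0) (hk₂ : k₂ ≠ 0)
    (d₁ d₂ : Matrix (Fin n) (Fin n) ℝ)
    (hd₁ : d₁.det = (-1) ^ n * k₁) (hd₂ : d₂.det = (-1) ^ n * k₂)
    (u : ℕ → ℝ → ℝ → ℝ) (hu : u = CentralAffine.curv n γ)
    (g : ℝ → ℝ → Matrix (Fin n) (Fin n) ℝ) (hg : g = CentralAffine.frame n γ)
    (h₁ h₂ : ℝ → ℝ → ℝ)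
    (hh₁ : CentralAffine.IsBT n j U u k₁ h₁) (hh₂ : CentralAffine.IsBT n j U u k₂ h₂)
    (hne : ∀ x t, (x, t) ∈ U → h₁ x t ≠ h₂ x t)
    (h₁' h₂' : ℝ → ℝ → ℝ)
    (hh₁' : h₁' = fun x t => h₁ x t + CentralAffine.permShift h₁ h₂ x t)
    (hh₂' : h₂' = fun x t => h₂ x t + CentralAffine.permShift h₁ h₂ x t)
    (g₁ g₂ : ℝ → ℝ → Matrix (Fin n) (Fin n) ℝ)
    (hg₁ : g₁ = CentralAffine.btFrame n d₁ g u h₁)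
    (hg₂ : g₂ = CentralAffine.btFrame n d₂ g u h₂)
    (γ₁ γ₂ : ℝ → ℝ → Fin n → ℝ)
    (hγ₁ : γ₁ = fun x t => (g₁ x t).mulVec (CentralAffine.e1 n))
    (hγ₂ : γ₂ = fun x t => (g₂ x t).mulVec (CentralAffine.e1 n))
    (γ₁₂ γ₂₁ : ℝ → ℝ → Fin n → ℝ)
    (hγ₁₂ : γ₁₂ = fun x t =>
      (CentralAffine.btFrame n d₂ g₁ (CentralAffine.starCurv n u h₁) h₂' x t).mulVec
        (CentralAffine.e1 n))
    (hγ₂₁ : γ₂₁ = fun x t =>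
      (CentralAffine.btFrame n d₁ g₂ (CentralAffine.starCurv n u h₂) h₁' x t).mulVec
        (CentralAffine.e1 n)) :
    (∀ x t, (x, t) ∈ U → γ₁₂ x t = CentralAffine.btCurve n d₂ γ₁ h₂' x t) ∧
    (∀ x t, (x, t) ∈ U → γ₂₁ x t = CentralAffine.btCurve n d₁ γ₂ h₁' x t) ∧
    (d₁ * d₂ = d₂ * d₁ → ∀ x t, (x, t) ∈ U → γ₁₂ x t = γ₂₁ x t) ∧
    CentralAffine.IsCurveFlowSolution n j U γ₁₂ ∧
    CentralAffine.IsCurveFlowSolution n j U γ₂₁ := by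
  open CentralAffine SmoothFn DiffOp in
  obtain ⟨U, rfl⟩ : ∃ V : TopologicalSpace.Opens (ℝ × ℝ), (V : Set (ℝ × ℝ)) = U := ⟨⟨U, hU⟩, rfl⟩
  obtain ⟨v, Y, Z, ga, hv, hga, F⟩ := hγ.exists_isFlowFrame hn
  rw [← hu] at hv
  rw [← hg] at hga
  have hv' : ∀ i, i + 1 < n → Rep (u i) (v i) := fun i _ => hv i
  obtain ⟨a₁, ra₁, B₁⟩ := hh₁.exists_isBacklund hn hv' F.series F.flow
  obtain ⟨a₂, ra₂, B₂⟩ := hh₂.exists_isBacklund hn hv' F.series F.flow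
  have hunit : IsUnit (a₁ - a₂) := isUnit_of_ev fun p hp => by
    rw [map_sub, ← ra₁ p.1 p.2 hp, ← ra₂ p.1 p.2 hp]
    exact sub_ne_zero.2 (hne p.1 p.2 hp)
  have hunit' : IsUnit (a₂ - a₁) := by rw [← neg_sub]; exact hunit.neg
  obtain ⟨w, hw⟩ := hunit.exists_right_inv
  have hc := compatible_of_mul_eq_one (dx U) hw
  have hp := rep_permShift ra₁ ra₂ hw
  generalize hm₁ : a₁ + dx U (a₁ - a₂) * w = m₁ at hc
  generalize hm₂ : a₂ + dx U (a₁ - a₂) * w = m₂ at hc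
  have rm₁ : Rep h₁' m₁ := fun x t hxt => by
    rw [hh₁', ← hm₁, map_add, ← ra₁ x t hxt, ← hp x t hxt]
  have rm₂ : Rep h₂' m₂ := fun x t hxt => by
    rw [hh₂', ← hm₂, map_add, ← ra₂ x t hxt, ← hp x t hxt]
  have hkd : ∀ k : ℝ, dx U (algebraMap ℝ _ k) = 0 := fun k => (dx U).map_algebraMap k
  have hku : ∀ {k : ℝ}, k ≠ 0 → IsUnit (algebraMap ℝ (SmoothFn U) k) :=
    fun hk => (isUnit_iff_ne_zero.2 hk).map _
  have hfu : ∀ {v : ℕ → SmoothFn U} {h : SmoothFn U} {k : ℝ},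
      k ≠ 0 → IsDarboux (dx U) n v h (algebraMap ℝ _ k) → IsUnit (btMat (dx U) n v h).det :=
    fun hk H => H.isUnit_det hn (hku hk)
  obtain ⟨⟨Y₁, Z₁, F₁⟩, Y₁₂, Z₁₂, F₁₂⟩ := F.permute hn dx_dt B₁ B₂ hc hunit (hkd k₁) (hkd k₂)
    (hku hk₁) (hku hk₂) (constMat_map d₁ _) (constMat_map d₁ _) (det_constMat hd₁)
    (constMat_map d₂ _) (constMat_map d₂ _) (det_constMat hd₂)
  obtain ⟨⟨Y₂, Z₂, F₂⟩, Y₂₁, Z₂₁, F₂₁⟩ := F.permute hn dx_dt B₂ B₁ hc.symm hunit' (hkd k₂)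
    (hkd k₁) (hku hk₂) (hku hk₁) (constMat_map d₂ _) (constMat_map d₂ _) (det_constMat hd₂)
    (constMat_map d₁ _) (constMat_map d₁ _) (det_constMat hd₁)
  have H₁ := B₁.darboux
  have H₂ := B₂.darboux
  have H₁₂ := IsDarboux.permute hn hc hunit (hkd k₂) H₁ H₂
  have H₂₁ := IsDarboux.permute hn hc.symm hunit' (hkd k₁) H₂ H₁
  have rg₁ := repMat_btFrame d₁ hga hv' ra₁ (hfu hk₁ H₁)
  have rg₂ := repMat_btFrame d₂ hga hv' ra₂ (hfu hk₂ H₂)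
  rw [← hg₁] at rg₁
  rw [← hg₂] at rg₂
  have rg₁₂ := repMat_btFrame d₂ rg₁ (fun i _ => rep_starCurv hv' ra₁ (by omega) i) rm₂
    (hfu hk₂ H₁₂)
  have rg₂₁ := repMat_btFrame d₁ rg₂ (fun i _ => rep_starCurv hv' ra₂ (by omega) i) rm₁
    (hfu hk₁ H₂₁)
  -- The moving frame of `γ₁` is `g₁` and its curvature is `h₁ ∗ u`, likewise for `γ₂`; so the
  -- transform of `γ₁` by `h̃₂` is computed from the same matrices as `γ₁₂`.
  obtain ⟨rf₁, rc₁, -⟩ := F₁.curve hn rg₁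
  obtain ⟨rf₂, rc₂, -⟩ := F₂.curve hn rg₂
  rw [← hγ₁] at rf₁ rc₁
  rw [← hγ₂] at rf₂ rc₂
  have s₁₂ := repMat_btFrame d₂ rf₁ rc₁ rm₂ (hfu hk₂ H₁₂)
  have s₂₁ := repMat_btFrame d₁ rf₂ rc₂ rm₁ (hfu hk₁ H₂₁)
  have S₁₂ := (F₁₂.curve hn rg₁₂).2.2
  have S₂₁ := (F₂₁.curve hn rg₂₁).2.2
  rw [← hγ₁₂] at S₁₂
  rw [← hγ₂₁] at S₂₁
  refine ⟨fun x t hxt => ?_, fun x t hxt => ?_, fun hcomm x t hxt => ?_, S₁₂, S₂₁⟩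
  · rw [hγ₁₂, btCurve, s₁₂ x t hxt]
    change _ *ᵥ _ = _
    rw [rg₁₂ x t hxt]
  · rw [hγ₂₁, btCurve, s₂₁ x t hxt]
    change _ *ᵥ _ = _
    rw [rg₂₁ x t hxt]
  · rw [hγ₁₂, hγ₂₁]
    change _ *ᵥ _ = _ *ᵥ _
    have hD : constMat U d₂ * constMat U d₁ = constMat U d₁ * constMat U d₂ := by
      rw [constMat, constMat, ← Matrix.map_mul, ← hcomm, Matrix.map_mul]
    -- Inverting the equality of products gives `f₁⁻¹ f₁₂⁻¹ = f₂⁻¹ f₂₁⁻¹`; only the order of the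
    -- constant factors on the left of `g` remains to be matched.
    have hB := congrArg (·⁻¹) (btMat_mul_btMat hn hc H₁ H₂ H₁₂ H₂₁)
    simp only [Matrix.mul_inv_rev] at hB
    rw [rg₁₂ x t hxt, rg₂₁ x t hxt]
    congr 2
    simp only [mul_assoc] at hB ⊢
    rw [hB, ← mul_assoc, ← mul_assoc, hD]
    simp only [mul_assoc]
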